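/- Let $K$ be an algebraically closed field of characteristic $0$. Let $V=K\{a,b,c\}$ be the Yetter–Drinfeld module $(\mathcal O^3_2,-1)$ over $S_3$, with degrees $\deg a=(12)$, $\deg b=(23)$, $\deg c=(13)$ and action $(12)\colon a\mapsto -a,\ b\mapsto -c,\ c\mapsto -b$, $(123)\colon a\mapsto b\mapsto c\mapsto a$. Let $\mathrm B(V)=FK_3=T(V)/(a^2,\,b^2,\,c^2,\,ab+bc+ca,\,ac+cb+ba)$ be its Nichols algebra (the Fomin–Kirillov algebra), and let $H=\mathrm B(V)\#KS_3$ be the bosonization: the smash product, with $\Delta(g)=g\otimes g$ for $g\in S_3$ and $\Delta(x)=x\otimes 1+\deg(x)\otimes x$ for $x=a,b,c$. It is a Hopf algebra of dimension $72$. A cocycle deformation of $H$ is an $H$-comodule algebra isomorphic to ${}^{\alpha}H$, that is, to $H$ with coaction $\Delta$ and product $x\cdot_\alpha y=\alpha(x_1,y_1)x_2y_2$, for a convolution invertible normalized Hopf 2-cocycle $\alpha$. Let $W$ be a vector space of dimension $\dim H$. Let $Y_H$ be the affine variety of all triples $(m,T,\rho)$, where $(m,\rho)$ is an $H$-comodule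 algebra structure on $W$ and $T\colon W\otimes H\to W\otimes W$ is a two-sided inverse of $M\colon W\otimes W\to W\otimes H$, $x\otimes y\mapsto xy_1\otimes y_2$. Let $X_H=Y_H/GL(W)$ be the moduli space of cocycle deformations, with $K[X_H]=K[Y_H]^{GL(W)}$. A cocycle deformation $W$ realizes $(\lambda,\mu)\in K^2$ if there are elements of $W$ as follows. The element $w_{(12)}\ne 0$ satisfies $\rho(w_{(12)})=w_{(12)}\otimes(12)$. The element $w_{(123)}$ equals $v^{-1}w_{(12)}v\,w_{(12)}^{-1}$ for a nonzero $v$ with $\rho(v)=v\otimes(23)$. The element $w_a$ satisfies $\rho(w_a)=w_a\otimes1+w_{(12)}\otimes a$ and $w_{(12)}w_aw_{(12)}^{-1}=-w_a$. Put $w_b=w_{(123)}w_aw_{(123)}^{-1}$ and $w_c=w_{(123)}^{-1}w_aw_{(123)}$. Then it is required that $w_{(12)}^2=c_0$, $w_a^2=\lambda_0$ and $w_aw_b+w_bw_c+w_cw_a=\mu_0$ are scalars with $c_0\neq0$, $\lambda=\lambda_0/c_0$ and $\mu=\mu_0/c_0$. Then every cocycle deformation of $H$ realizes exactly one pair $(\lambda,\mu)$;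 every pair $(\lambda,\mu)\in K^2$ is realized by some ${}^{\alpha}H$; and two cocycle deformations are isomorphic as $H$-comodule algebras if and only if they realize the same pair. The points of $Y_H$ are exactly the structures that make $W$ a cocycle deformation of $H$ (each ${}^\alpha H$ occurs), and $(\lambda,\mu)$ induces an isomorphism of affine varieties $X_H\cong\mathbb A^2$: it is a bijection $X_H\to K^2$, and the regular functions on $X_H$ are exactly the polynomials in $\lambda$ and $\mu$. Moreover, put $w_1=1$, $w_{(132)}=w_{(123)}^2$, $w_{(23)}=w_{(12)}w_{(123)}$ and $w_{(13)}=w_{(12)}w_{(123)}^2$. Fix a basis of $W$ indexed by pairs $(u,g)$ with $u$ one of the twelve words $1,a,b,c,ab,ac,ba,bc,aba,abc,bac,abac$ and $g\in S_3$. Let $Y'\subseteq Y_H$ be the subvariety of those structures for which this basis consists of the products $w_u w_g$ (where $w_u$ is the product of the elements $w_a,w_b,w_c$ spelled by $u$) for some elements as above. Let $N=GL_1$, where $\nu\in N$ multiplies the basis vector $(u,g)$ by $\nu^{|u|+(1-\mathrm{sgn}(g))/2}$. Then the ideal $I$ in $K[Y']^N\cong K[\lambda,\mu]/I$ is zero: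 the map $K[\lambda,\mu]\to K[Y']^N$ is an isomorphism. -/

import Mathlib

open scoped TensorProduct

noncomputable section

/-! ## The Fomin–Kirillov algebra and its bosonization -/

/-- The symmetric group on three letters.  The letters `1, 2, 3` are the elements `0, 1, 2` of
`Fin 3`, and the product is composition from right to left. -/
abbrev S3 : Type := Equiv.Perm (Fin 3)

namespace FK3

/-- The letters `1, 2, 3` index the basis of `V = (O^3_2, -1)`: a basis vector is labelled by the
letter which is fixed by the transposition that is its degree.  So `b` (degree `(23)`) has the
index `0`, `c` (degree `(13)`) the index `1` and `a` (degree `(12)`) the index `2`. -/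
abbrev ia : Fin 3 := 2

/-- The index of `b`, see `FK3.ia`. -/
abbrev ib : Fin 3 := 0

/-- The index of `c`, see `FK3.ia`. -/
abbrev ic : Fin 3 := 1

/-- The degree of the basis vector `i` of `V`: the transposition that fixes the letter `i`. -/
def deg (i : Fin 3) : S3 := Equiv.swap (i + 1) (i + 2)

/-- The defining relations of `FK_3 = B(V)` in the tensor algebra of `V`:
`a² = b² = c² = 0`, `ab + bc + ca = 0` and `ac + cb + ba = 0`. -/
inductive Rel (K : Type*) [Field K] : FreeAlgebra K (Fin 3) → FreeAlgebra K (Fin 3) → Prop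
  | sq (i : Fin 3) : Rel K (FreeAlgebra.ι K i * FreeAlgebra.ι K i) 0
  | abc : Rel K (FreeAlgebra.ι K ia * FreeAlgebra.ι K ib + FreeAlgebra.ι K ib * FreeAlgebra.ι K ic
      + FreeAlgebra.ι K ic * FreeAlgebra.ι K ia) 0
  | acb : Rel K (FreeAlgebra.ι K ia * FreeAlgebra.ι K ic + FreeAlgebra.ι K ic * FreeAlgebra.ι K ib
      + FreeAlgebra.ι K ib * FreeAlgebra.ι K ia) 0

end FK3

/-- The Fomin–Kirillov algebra `FK_3`, the Nichols algebra `B(V)` of `V = (O^3_2, -1)`. -/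
def FK3 (K : Type*) [Field K] : Type _ := RingQuot (FK3.Rel K)

namespace FK3

variable (K : Type*) [Field K]

instance : Ring (FK3 K) := inferInstanceAs (Ring (RingQuot (FK3.Rel K)))

instance : Algebra K (FK3 K) := inferInstanceAs (Algebra K (RingQuot (FK3.Rel K)))

/-- The generators of `FK_3`: `x ia = a`, `x ib = b`, `x ic = c`. -/
def x (i : Fin 3) : FK3 K := RingQuot.mkAlgHom K (Rel K) (FreeAlgebra.ι K i)

variable {K}

/-- The universal property of `FK_3`. -/
def lift {A : Type*} [Ring A] [Algebra K A] (f : Fin 3 → A) (hsq : ∀ i, f i * f i = 0)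
    (habc : f ia * f ib + f ib * f ic + f ic * f ia = 0)
    (hacb : f ia * f ic + f ic * f ib + f ib * f ia = 0) : FK3 K →ₐ[K] A :=
  RingQuot.liftAlgHom K ⟨FreeAlgebra.lift K f, by
    intro p q h
    cases h with
    | sq i => simpa using hsq i
    | abc => simpa using habc
    | acb => simpa using hacb⟩

@[simp] lemma lift_x {A : Type*} [Ring A] [Algebra K A] (f : Fin 3 → A) (hsq) (habc) (hacb)
    (i : Fin 3) : lift (K := K) f hsq habc hacb (x K i) = f i := by
  simp only [lift, x]
  erw [RingQuot.liftAlgHom_mkAlgHom_apply]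
  simp

lemma algHom_ext {A : Type*} [Ring A] [Algebra K A] {f g : FK3 K →ₐ[K] A}
    (h : ∀ i, f (x K i) = g (x K i)) : f = g := by
  apply RingQuot.ringQuot_ext'
  apply FreeAlgebra.hom_ext
  funext i
  exact h i

lemma x_sq (i : Fin 3) : x K i * x K i = 0 := by
  have := RingQuot.mkAlgHom_rel K (Rel.sq (K := K) i)
  rw [map_mul, map_zero] at this
  exact this

lemma x_abc : x K ia * x K ib + x K ib * x K ic + x K ic * x K ia = 0 := by
  have := RingQuot.mkAlgHom_rel K (Rel.abc (K := K))
  simp only [map_mul, map_add, map_zero] at this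
  exact this

lemma x_acb : x K ia * x K ic + x K ic * x K ib + x K ib * x K ia = 0 := by
  have := RingQuot.mkAlgHom_rel K (Rel.acb (K := K))
  simp only [map_mul, map_add, map_zero] at this
  exact this

lemma perm_cases (g : S3) : (g ia = ia ∧ g ib = ib ∧ g ic = ic) ∨ (g ia = ia ∧ g ib = ic ∧ g ic = ib)
    ∨ (g ia = ib ∧ g ib = ia ∧ g ic = ic) ∨ (g ia = ib ∧ g ib = ic ∧ g ic = ia)
    ∨ (g ia = ic ∧ g ib = ia ∧ g ic = ib) ∨ (g ia = ic ∧ g ib = ib ∧ g ic = ia) := by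
  revert g; decide

/-- The sign of a permutation, as a scalar. -/
def sgn (K : Type*) [Field K] (g : S3) : K := ((Equiv.Perm.sign g : ℤˣ) : ℤ)

@[simp] lemma sgn_one : sgn K 1 = 1 := by simp [sgn]

@[simp] lemma sgn_mul (g h : S3) : sgn K (g * h) = sgn K g * sgn K h := by simp [sgn]

/-- The action of `g ∈ S_3` on `FK_3` by algebra automorphisms, `g · x_i = sgn(g) x_{g i}`.  So
`(12)` maps `a, b, c` to `-a, -c, -b`, and `(123)` maps `a ↦ b ↦ c ↦ a`. -/
def act (g : S3) : FK3 K →ₐ[K] FK3 K :=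
  lift (fun i => sgn K g • x K (g i))
    (by intro i; rw [smul_mul_smul_comm, x_sq, smul_zero])
    (by
      simp only [smul_mul_smul_comm, ← smul_add]
      have h1 := x_abc (K := K)
      have h2 := x_acb (K := K)
      rcases perm_cases g with h | h | h | h | h | h <;> rw [h.1, h.2.1, h.2.2] <;>
        first
        | (rw [show ∀ p q r : FK3 K, p + q + r = r + p + q by intros; abel, h1, smul_zero])
        | (rw [h1, smul_zero])
        | (rw [h2, smul_zero])
        | (rw [show ∀ p q r : FK3 K, p + q + r = q + r + p by intros; abel, h1, smul_zero])
        | (rw [show ∀ p q r : FK3 K, p + q + r = r + p + q by intros; abel, h2, smul_zero])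
        | (rw [show ∀ p q r : FK3 K, p + q + r = q + r + p by intros; abel, h2, smul_zero]))
    (by
      simp only [smul_mul_smul_comm, ← smul_add]
      have h1 := x_abc (K := K)
      have h2 := x_acb (K := K)
      rcases perm_cases g with h | h | h | h | h | h <;> rw [h.1, h.2.1, h.2.2] <;>
        first
        | (rw [h1, smul_zero])
        | (rw [h2, smul_zero])
        | (rw [show ∀ p q r : FK3 K, p + q + r = r + p + q by intros; abel, h1, smul_zero])
        | (rw [show ∀ p q r : FK3 K, p + q + r = q + r + p by intros; abel, h1, smul_zero])
        | (rw [show ∀ p q r : FK3 K, p + q + r = r + p + q by intros; abel, h2, smul_zero])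
        | (rw [show ∀ p q r : FK3 K, p + q + r = q + r + p by intros; abel, h2, smul_zero]))

@[simp] lemma act_x (g : S3) (i : Fin 3) :
    act g (x K i) = sgn K g • x K (g i) := by
  simp [act]

lemma act_one : act (K := K) 1 = AlgHom.id K (FK3 K) := algHom_ext fun i => by simp

lemma act_mul (g h : S3) : act (K := K) (g * h) = (act g).comp (act h) :=
  algHom_ext fun i => by simp [smul_smul, mul_comm]

instance : MulSemiringAction S3 (FK3 K) where
  smul g p := act g p
  one_smul p := congrArg (fun f : FK3 K →ₐ[K] FK3 K => f p) act_one
  mul_smul g h p := congrArg (fun f : FK3 K →ₐ[K] FK3 K => f p) (act_mul g h)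
  smul_zero g := map_zero (act g)
  smul_add g := map_add (act g)
  smul_one g := map_one (act g)
  smul_mul g := map_mul (act g)

lemma smul_def (g : S3) (p : FK3 K) : g • p = act g p := rfl

instance : SMulCommClass S3 K (FK3 K) where
  smul_comm g k p := map_smul (act g) k p

end FK3

/-- The bosonization (Radford biproduct) `H = B(V) # KS_3`: the algebra of finite sums
`∑ p_g # g` with `p_g ∈ FK_3` and `(p # g)(q # h) = p (g · q) # gh`. -/
def Boson (K : Type*) [Field K] : Type _ := SkewMonoidAlgebra (FK3 K) S3

namespace Boson

variable (K : Type*) [Field K]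

instance : Ring (Boson K) := inferInstanceAs (Ring (SkewMonoidAlgebra (FK3 K) S3))

instance : Algebra K (Boson K) := inferInstanceAs (Algebra K (SkewMonoidAlgebra (FK3 K) S3))

/-- The inclusion of `S_3` into `H`. -/
def grp : S3 →* Boson K := SkewMonoidAlgebra.of (FK3 K) S3

/-- The inclusion of `FK_3` into `H`. -/
def incl : FK3 K →ₐ[K] Boson K where
  toFun p := SkewMonoidAlgebra.single 1 p
  map_one' := rfl
  map_mul' p q := by
    have h : (SkewMonoidAlgebra.single 1 p * SkewMonoidAlgebra.single 1 q :
        SkewMonoidAlgebra (FK3 K) S3) = SkewMonoidAlgebra.single 1 (p * q) := by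
      rw [SkewMonoidAlgebra.single_mul_single, one_smul, one_mul]
    exact h.symm
  map_zero' := SkewMonoidAlgebra.single_zero _
  map_add' p q := SkewMonoidAlgebra.single_add _ _ _
  commutes' r := by
    rfl

/-- The elements `a, b, c` of `H`: `X ia = a`, `X ib = b`, `X ic = c`. -/
def X (i : Fin 3) : Boson K := incl K (FK3.x K i)

variable {K}

lemma grp_mul_incl (g : S3) (p : FK3 K) : grp K g * incl K p = incl K (g • p) * grp K g := by
  have h : (SkewMonoidAlgebra.single g 1 * SkewMonoidAlgebra.single 1 p :
      SkewMonoidAlgebra (FK3 K) S3)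
      = SkewMonoidAlgebra.single 1 (g • p) * SkewMonoidAlgebra.single g 1 := by
    rw [SkewMonoidAlgebra.single_mul_single, SkewMonoidAlgebra.single_mul_single, one_smul,
      one_mul, mul_one, one_mul, mul_one]
  exact h

lemma grp_mul_X (g : S3) (i : Fin 3) :
    grp K g * X K i = FK3.sgn K g • (X K (g i) * grp K g) := by
  rw [X, grp_mul_incl, FK3.smul_def, FK3.act_x, map_smul, smul_mul_assoc, X]

/-- The universal property of the smash product. -/
def lift {A : Type*} [Ring A] [Algebra K A] (f : FK3 K →ₐ[K] A) (φ : S3 →* A)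
    (h : ∀ (p : FK3 K) (g : S3), f (g • p) * φ g = φ g * f p) : Boson K →ₐ[K] A :=
  SkewMonoidAlgebra.liftNCAlgHom f φ (fun {p g} => h p g)

lemma lift_single {A : Type*} [Ring A] [Algebra K A] (f : FK3 K →ₐ[K] A) (φ : S3 →* A)
    (h) (g : S3) (p : FK3 K) :
    lift f φ h (SkewMonoidAlgebra.single g p : SkewMonoidAlgebra (FK3 K) S3) = f p * φ g :=
  SkewMonoidAlgebra.liftNC_single _ _ _ _

@[simp] lemma lift_grp {A : Type*} [Ring A] [Algebra K A] (f : FK3 K →ₐ[K] A) (φ : S3 →* A)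
    (h) (g : S3) : lift f φ h (grp K g) = φ g := by
  rw [show lift f φ h (grp K g) = f 1 * φ g from lift_single f φ h g 1, map_one, one_mul]

@[simp] lemma lift_incl {A : Type*} [Ring A] [Algebra K A] (f : FK3 K →ₐ[K] A) (φ : S3 →* A)
    (h) (p : FK3 K) : lift f φ h (incl K p) = f p := by
  rw [show lift f φ h (incl K p) = f p * φ 1 from lift_single f φ h 1 p, map_one, mul_one]

@[simp] lemma lift_X {A : Type*} [Ring A] [Algebra K A] (f : FK3 K →ₐ[K] A) (φ : S3 →* A)
    (h) (i : Fin 3) : lift f φ h (X K i) = f (FK3.x K i) := by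
  rw [X, lift_incl]

lemma single_eq (g : S3) (p : FK3 K) :
    (SkewMonoidAlgebra.single g p : SkewMonoidAlgebra (FK3 K) S3) = incl K p * grp K g := by
  have h : (SkewMonoidAlgebra.single 1 p * SkewMonoidAlgebra.single g 1 :
      SkewMonoidAlgebra (FK3 K) S3) = SkewMonoidAlgebra.single g p := by
    rw [SkewMonoidAlgebra.single_mul_single, one_smul, one_mul, mul_one]
  exact h.symm

lemma induction {P : Boson K → Prop} (hadd : ∀ p q, P p → P q → P (p + q))
    (hmul : ∀ p g, P (incl K p * grp K g)) (y : Boson K) : P y := by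
  have : ∀ y : SkewMonoidAlgebra (FK3 K) S3, P y := by
    intro y
    induction y with
    | single g p => rw [single_eq]; exact hmul p g
    | add p q hp hq => exact hadd p q hp hq
  exact this y

lemma algHom_ext {A : Type*} [Ring A] [Algebra K A] {f g : Boson K →ₐ[K] A}
    (hg : ∀ s, f (grp K s) = g (grp K s)) (hX : ∀ i, f (X K i) = g (X K i)) : f = g := by
  have h1 : f.comp (incl K) = g.comp (incl K) := FK3.algHom_ext hX
  ext y
  induction y using induction with
  | hadd p q hp hq => rw [map_add, map_add, hp, hq]
  | hmul p s => rw [map_mul, map_mul, hg]; congr 1; exact DFunLike.congr_fun h1 p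

lemma subalgebra_eq_top (D : Subalgebra K (Boson K)) (hg : ∀ g, grp K g ∈ D)
    (hX : ∀ i, X K i ∈ D) (y : Boson K) : y ∈ D := by
  have h1 : ∀ p : FK3 K, incl K p ∈ D := by
    intro p
    obtain ⟨q, rfl⟩ : ∃ q, RingQuot.mkAlgHom K (FK3.Rel K) q = p :=
      RingQuot.mkAlgHom_surjective K (FK3.Rel K) p
    let π : FreeAlgebra K (Fin 3) →ₐ[K] FK3 K := RingQuot.mkAlgHom K (FK3.Rel K)
    change incl K (π q) ∈ D
    induction q using FreeAlgebra.induction with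
    | grade0 r => rw [AlgHom.commutes, AlgHom.commutes]; exact D.algebraMap_mem r
    | grade1 i => exact hX i
    | mul a b ha hb => rw [map_mul, map_mul]; exact D.mul_mem ha hb
    | add a b ha hb => rw [map_add, map_add]; exact D.add_mem ha hb
  induction y using induction with
  | hadd p q hp hq => exact D.add_mem hp hq
  | hmul p g => exact D.mul_mem (h1 p) (hg g)

/-- Compatibility of `f` and `φ` in `Boson.lift` need only be checked on `a, b, c`. -/
lemma compat {A : Type*} [Ring A] [Algebra K A] (f : FK3 K →ₐ[K] A) (φ : S3 →* A)
    (h : ∀ (i : Fin 3) (g : S3), f (g • FK3.x K i) * φ g = φ g * f (FK3.x K i))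
    (p : FK3 K) (g : S3) : f (g • p) * φ g = φ g * f p := by
  have hinv : φ g * φ g⁻¹ = 1 := by rw [← map_mul, mul_inv_cancel, map_one]
  have hinv' : φ g⁻¹ * φ g = 1 := by rw [← map_mul, inv_mul_cancel, map_one]
  let c : FK3 K →ₐ[K] A :=
    { toFun := fun p => φ g * f p * φ g⁻¹
      map_one' := by simp [hinv]
      map_mul' := fun p q => by
        rw [map_mul]
        calc φ g * (f p * f q) * φ g⁻¹ = φ g * f p * 1 * f q * φ g⁻¹ := by simp only [mul_assoc, one_mul]
          _ = _ := by rw [← hinv']; simp only [mul_assoc]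
      map_zero' := by simp
      map_add' := fun p q => by simp [mul_add, add_mul]
      commutes' := fun r => by
        rw [AlgHom.commutes, ← Algebra.commutes, mul_assoc, hinv, mul_one] }
  have hc : f.comp (FK3.act g) = c := FK3.algHom_ext fun i => by
    show f (g • FK3.x K i) = φ g * f (FK3.x K i) * φ g⁻¹
    rw [← h, mul_assoc, hinv, mul_one]
  have := DFunLike.congr_fun hc p
  change f (g • p) = φ g * f p * φ g⁻¹ at this
  rw [this, mul_assoc, hinv', mul_one]

@[simp] lemma X_sq (i : Fin 3) : X K i * X K i = 0 := by
  rw [X, ← map_mul, FK3.x_sq, map_zero]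

lemma X_abc : X K FK3.ia * X K FK3.ib + X K FK3.ib * X K FK3.ic + X K FK3.ic * X K FK3.ia = 0 := by
  simp only [X, ← map_mul, ← map_add, FK3.x_abc, map_zero]

lemma X_acb : X K FK3.ia * X K FK3.ic + X K FK3.ic * X K FK3.ib + X K FK3.ib * X K FK3.ia = 0 := by
  simp only [X, ← map_mul, ← map_add, FK3.x_acb, map_zero]

lemma sgn_deg (i : Fin 3) : FK3.sgn K (FK3.deg i) = -1 := by
  have : Equiv.Perm.sign (FK3.deg i) = -1 := by revert i; decide
  simp [FK3.sgn, this]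

lemma deg_mul_self (i : Fin 3) : FK3.deg i * FK3.deg i = 1 := by revert i; decide

lemma deg_conj (g : S3) (i : Fin 3) : FK3.deg (g i) * g = g * FK3.deg i := by
  revert g i; decide

lemma grp_deg_mul_X (i j : Fin 3) :
    grp K (FK3.deg i) * X K j = -(X K (FK3.deg i j) * grp K (FK3.deg i)) := by
  rw [grp_mul_X, sgn_deg, neg_one_smul]

/-- The comultiplication of `H` as an algebra map: `Δ(g) = g ⊗ g` for `g ∈ S_3` and
`Δ(x) = x ⊗ 1 + deg(x) ⊗ x` for `x = a, b, c`. -/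
def comulHom (K : Type*) [Field K] : Boson K →ₐ[K] Boson K ⊗[K] Boson K :=
  lift
    (FK3.lift (fun i => X K i ⊗ₜ[K] 1 + grp K (FK3.deg i) ⊗ₜ[K] X K i)
      (by
        intro i
        have h : FK3.deg i i = i := by revert i; decide
        simp only [add_mul, mul_add, Algebra.TensorProduct.tmul_mul_tmul, one_mul, mul_one, X_sq,
          grp_deg_mul_X, h, TensorProduct.tmul_zero, TensorProduct.zero_tmul,
          TensorProduct.neg_tmul]
        abel)
      (by
        have h1 : FK3.deg FK3.ia FK3.ib = FK3.ic := by decide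
        have h2 : FK3.deg FK3.ib FK3.ic = FK3.ia := by decide
        have h3 : FK3.deg FK3.ic FK3.ia = FK3.ib := by decide
        have e1 : FK3.deg FK3.ib * FK3.deg FK3.ic = FK3.deg FK3.ia * FK3.deg FK3.ib := by decide
        have e2 : FK3.deg FK3.ic * FK3.deg FK3.ia = FK3.deg FK3.ia * FK3.deg FK3.ib := by decide
        have key : (X K FK3.ia * X K FK3.ib + X K FK3.ib * X K FK3.ic + X K FK3.ic * X K FK3.ia)
              ⊗ₜ[K] (1 : Boson K)
            + grp K (FK3.deg FK3.ia * FK3.deg FK3.ib) ⊗ₜ[K]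
              (X K FK3.ia * X K FK3.ib + X K FK3.ib * X K FK3.ic + X K FK3.ic * X K FK3.ia) = 0 := by
          rw [X_abc, TensorProduct.zero_tmul, TensorProduct.tmul_zero, add_zero]
        rw [← key]
        simp only [add_mul, mul_add, Algebra.TensorProduct.tmul_mul_tmul, one_mul, mul_one,
          grp_deg_mul_X, h1, h2, h3, ← map_mul, e1, e2, TensorProduct.tmul_add,
          TensorProduct.add_tmul, TensorProduct.neg_tmul]
        abel)
      (by
        have h1 : FK3.deg FK3.ia FK3.ic = FK3.ib := by decide
        have h2 : FK3.deg FK3.ib FK3.ia = FK3.ic := by decide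
        have h3 : FK3.deg FK3.ic FK3.ib = FK3.ia := by decide
        have e1 : FK3.deg FK3.ic * FK3.deg FK3.ib = FK3.deg FK3.ia * FK3.deg FK3.ic := by decide
        have e2 : FK3.deg FK3.ib * FK3.deg FK3.ia = FK3.deg FK3.ia * FK3.deg FK3.ic := by decide
        have key : (X K FK3.ia * X K FK3.ic + X K FK3.ic * X K FK3.ib + X K FK3.ib * X K FK3.ia)
              ⊗ₜ[K] (1 : Boson K)
            + grp K (FK3.deg FK3.ia * FK3.deg FK3.ic) ⊗ₜ[K]
              (X K FK3.ia * X K FK3.ic + X K FK3.ic * X K FK3.ib + X K FK3.ib * X K FK3.ia) = 0 := by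
          rw [X_acb, TensorProduct.zero_tmul, TensorProduct.tmul_zero, add_zero]
        rw [← key]
        simp only [add_mul, mul_add, Algebra.TensorProduct.tmul_mul_tmul, one_mul, mul_one,
          grp_deg_mul_X, h1, h2, h3, ← map_mul, e1, e2, TensorProduct.tmul_add,
          TensorProduct.add_tmul, TensorProduct.neg_tmul]
        abel))
    { toFun := fun g => grp K g ⊗ₜ[K] grp K g
      map_one' := by rw [map_one]; rfl
      map_mul' := fun g h => by
        rw [map_mul, Algebra.TensorProduct.tmul_mul_tmul] }
    (compat _ _ fun i g => by
      simp only [FK3.smul_def, FK3.act_x, map_smul, FK3.lift_x, MonoidHom.coe_mk, OneHom.coe_mk,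
        add_mul, mul_add, smul_add, smul_mul_assoc, Algebra.TensorProduct.tmul_mul_tmul, one_mul,
        mul_one, grp_mul_X, ← map_mul, deg_conj, TensorProduct.tmul_smul,
        TensorProduct.smul_tmul'])

/-- The counit of `H` as an algebra map: `ε(g) = 1` and `ε(a) = ε(b) = ε(c) = 0`. -/
def counitHom (K : Type*) [Field K] : Boson K →ₐ[K] K :=
  lift (FK3.lift (fun _ => 0) (by simp) (by simp) (by simp)) 1
    (compat _ _ fun i g => by simp [FK3.smul_def])

@[simp] lemma comulHom_grp (g : S3) : comulHom K (grp K g) = grp K g ⊗ₜ[K] grp K g :=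
  lift_grp _ _ _ _

@[simp] lemma comulHom_X (i : Fin 3) :
    comulHom K (X K i) = X K i ⊗ₜ[K] 1 + grp K (FK3.deg i) ⊗ₜ[K] X K i := by
  rw [comulHom, lift_X, FK3.lift_x]

@[simp] lemma counitHom_grp (g : S3) : counitHom K (grp K g) = 1 := by
  rw [counitHom, lift_grp]; rfl

@[simp] lemma counitHom_X (i : Fin 3) : counitHom K (X K i) = 0 := by
  rw [counitHom, lift_X, FK3.lift_x]

instance : Bialgebra K (Boson K) :=
  Bialgebra.ofAlgHom (comulHom K) (counitHom K)
    (algHom_ext (fun g => by simp) (fun i => by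
      simp [TensorProduct.add_tmul, TensorProduct.tmul_add, Algebra.TensorProduct.one_def]
      abel))
    (algHom_ext (fun g => by simp) (fun i => by simp))
    (algHom_ext (fun g => by simp) (fun i => by simp))

lemma comul_eq (y : Boson K) : Coalgebra.comul (R := K) y = comulHom K y := rfl

lemma counit_eq (y : Boson K) : Coalgebra.counit (R := K) y = counitHom K y := rfl

lemma X_grp_mul (i j : Fin 3) :
    (X K i * grp K (FK3.deg i)) * (X K j * grp K (FK3.deg j))
      = -(X K i * X K (FK3.deg i j) * grp K (FK3.deg i * FK3.deg j)) := by
  rw [mul_assoc, ← mul_assoc (grp K _), grp_deg_mul_X, map_mul]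
  simp only [neg_mul, mul_neg, mul_assoc]

open MulOpposite in
/-- The antipode of `H` as an algebra map to the opposite algebra: `S(g) = g⁻¹` for `g ∈ S_3` and
`S(x) = -deg(x)⁻¹ x = x deg(x)` for `x = a, b, c`. -/
def antipodeHom (K : Type*) [Field K] : Boson K →ₐ[K] (Boson K)ᵐᵒᵖ :=
  lift
    (FK3.lift (fun i => op (X K i * grp K (FK3.deg i)))
      (by
        intro i
        have h : FK3.deg i i = i := by revert i; decide
        rw [← op_mul, X_grp_mul, h, X_sq, zero_mul, neg_zero, op_zero])
      (by
        have h1 : FK3.deg FK3.ib FK3.ia = FK3.ic := by decide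
        have h2 : FK3.deg FK3.ic FK3.ib = FK3.ia := by decide
        have h3 : FK3.deg FK3.ia FK3.ic = FK3.ib := by decide
        have e1 : FK3.deg FK3.ic * FK3.deg FK3.ib = FK3.deg FK3.ib * FK3.deg FK3.ia := by decide
        have e2 : FK3.deg FK3.ia * FK3.deg FK3.ic = FK3.deg FK3.ib * FK3.deg FK3.ia := by decide
        simp only [← op_mul, ← op_add]
        rw [X_grp_mul, X_grp_mul, X_grp_mul, h1, h2, h3, e1, e2, ← neg_add, ← neg_add, ← add_mul,
          ← add_mul, show X K FK3.ib * X K FK3.ic + X K FK3.ic * X K FK3.ia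
            + X K FK3.ia * X K FK3.ib = 0 by rw [← X_abc]; abel, zero_mul, neg_zero, op_zero])
      (by
        have h1 : FK3.deg FK3.ic FK3.ia = FK3.ib := by decide
        have h2 : FK3.deg FK3.ib FK3.ic = FK3.ia := by decide
        have h3 : FK3.deg FK3.ia FK3.ib = FK3.ic := by decide
        have e1 : FK3.deg FK3.ib * FK3.deg FK3.ic = FK3.deg FK3.ic * FK3.deg FK3.ia := by decide
        have e2 : FK3.deg FK3.ia * FK3.deg FK3.ib = FK3.deg FK3.ic * FK3.deg FK3.ia := by decide
        simp only [← op_mul, ← op_add]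
        rw [X_grp_mul, X_grp_mul, X_grp_mul, h1, h2, h3, e1, e2, ← neg_add, ← neg_add, ← add_mul,
          ← add_mul, show X K FK3.ic * X K FK3.ib + X K FK3.ib * X K FK3.ia
            + X K FK3.ia * X K FK3.ic = 0 by rw [← X_acb]; abel, zero_mul, neg_zero, op_zero]))
    { toFun := fun g => op (grp K g⁻¹)
      map_one' := by simp
      map_mul' := fun g h => by rw [← op_mul, ← map_mul, mul_inv_rev] }
    (compat _ _ fun i g => by
      simp only [FK3.smul_def, FK3.act_x, map_smul, FK3.lift_x, MonoidHom.coe_mk, OneHom.coe_mk]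
      have e : g⁻¹ * FK3.deg (g i) = FK3.deg i * g⁻¹ := by
        rw [inv_mul_eq_iff_eq_mul, ← mul_assoc, ← deg_conj, mul_assoc, mul_inv_cancel, mul_one]
      rw [← op_smul, ← op_mul, ← op_mul, mul_smul_comm, ← mul_assoc, grp_mul_X, smul_mul_assoc,
        smul_smul, ← FK3.sgn_mul, mul_inv_cancel, FK3.sgn_one, one_smul, 
        show g⁻¹ (g i) = i from g.symm_apply_apply i,
        mul_assoc, ← map_mul, e, map_mul, mul_assoc])

@[simp] lemma antipodeHom_grp (g : S3) :
    antipodeHom K (grp K g) = MulOpposite.op (grp K g⁻¹) := lift_grp _ _ _ _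

@[simp] lemma antipodeHom_X (i : Fin 3) :
    antipodeHom K (X K i) = MulOpposite.op (X K i * grp K (FK3.deg i)) := by
  rw [antipodeHom, lift_X, FK3.lift_x]

/-- The antipode of `H`. -/
def antip (K : Type*) [Field K] : Boson K →ₗ[K] Boson K :=
  (MulOpposite.opLinearEquiv K).symm.toLinearMap ∘ₗ (antipodeHom K).toLinearMap

@[simp] lemma antip_grp (g : S3) : antip K (grp K g) = grp K g⁻¹ := by
  simp [antip]

@[simp] lemma antip_X (i : Fin 3) : antip K (X K i) = X K i * grp K (FK3.deg i) := by
  simp [antip]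

@[simp] lemma antip_one : antip K 1 = 1 := by simp [antip]

lemma antip_mul (p q : Boson K) : antip K (p * q) = antip K q * antip K p := by
  simp [antip]

lemma left_mul (s : Boson K ⊗[K] Boson K) (c d : Boson K) :
    LinearMap.mul' K _ ((antip K).rTensor _ (s * c ⊗ₜ[K] d))
      = antip K c * LinearMap.mul' K _ ((antip K).rTensor _ s) * d := by
  induction s with
  | zero => simp
  | tmul a b => simp [antip_mul, mul_assoc]
  | add s t hs ht => rw [add_mul, map_add, map_add, hs, ht, map_add, map_add, mul_add, add_mul]

lemma right_mul (s : Boson K ⊗[K] Boson K) (c d : Boson K) :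
    LinearMap.mul' K _ ((antip K).lTensor _ (c ⊗ₜ[K] d * s))
      = c * LinearMap.mul' K _ ((antip K).lTensor _ s) * antip K d := by
  induction s with
  | zero => simp
  | tmul a b => simp [antip_mul, mul_assoc]
  | add s t hs ht => rw [mul_add, map_add, map_add, hs, ht, map_add, map_add, mul_add, add_mul]

lemma antip_left (y : Boson K) :
    LinearMap.mul' K _ ((antip K).rTensor _ (comulHom K y)) = algebraMap K _ (counitHom K y) := by
  let D : Subalgebra K (Boson K) :=
    { carrier := {y | LinearMap.mul' K _ ((antip K).rTensor _ (comulHom K y))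
        = algebraMap K _ (counitHom K y)}
      mul_mem' := by
        intro p q hp hq
        have key : ∀ t, LinearMap.mul' K _ ((antip K).rTensor _ (comulHom K p * t))
            = counitHom K p • LinearMap.mul' K _ ((antip K).rTensor _ t) := by
          intro t
          induction t with
          | zero => simp
          | tmul c d =>
            rw [left_mul, hp, ← Algebra.commutes, mul_assoc, ← Algebra.smul_def]
            simp
          | add s t hs ht => rw [mul_add, map_add, map_add, hs, ht, map_add, map_add, smul_add]
        show _ = _
        rw [map_mul, key, hq, map_mul, map_mul, Algebra.smul_def]
      add_mem' := by
        intro p q hp hq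
        show _ = _
        rw [map_add, map_add, map_add, hp, hq, map_add, map_add]
      algebraMap_mem' := by
        intro r
        show _ = _
        rw [AlgHom.commutes, AlgHom.commutes, Algebra.TensorProduct.algebraMap_apply]
        simp [Algebra.algebraMap_eq_smul_one] }
  exact subalgebra_eq_top D
    (fun g => by show _ = _; simp [← map_mul])
    (fun i => by
      show _ = _
      rw [comulHom_X, counitHom_X, map_add, map_add, map_zero, LinearMap.rTensor_tmul,
        LinearMap.rTensor_tmul, LinearMap.mul'_apply, LinearMap.mul'_apply, antip_X, antip_grp,
        inv_eq_of_mul_eq_one_left (deg_mul_self i), grp_deg_mul_X,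
        show FK3.deg i i = i by revert i; decide, mul_one, add_neg_cancel]) y

lemma antip_right (y : Boson K) :
    LinearMap.mul' K _ ((antip K).lTensor _ (comulHom K y)) = algebraMap K _ (counitHom K y) := by
  let D : Subalgebra K (Boson K) :=
    { carrier := {y | LinearMap.mul' K _ ((antip K).lTensor _ (comulHom K y))
        = algebraMap K _ (counitHom K y)}
      mul_mem' := by
        intro p q hp hq
        have key : ∀ t, LinearMap.mul' K _ ((antip K).lTensor _ (t * comulHom K q))
            = counitHom K q • LinearMap.mul' K _ ((antip K).lTensor _ t) := by
          intro t
          induction t with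
          | zero => simp
          | tmul c d =>
            rw [right_mul, hq, ← Algebra.commutes, mul_assoc, ← Algebra.smul_def]
            simp
          | add s t hs ht => rw [add_mul, map_add, map_add, hs, ht, map_add, map_add, smul_add]
        show _ = _
        rw [map_mul, key, hp, map_mul, map_mul, Algebra.smul_def, Algebra.commutes]
      add_mem' := by
        intro p q hp hq
        show _ = _
        rw [map_add, map_add, map_add, hp, hq, map_add, map_add]
      algebraMap_mem' := by
        intro r
        show _ = _
        rw [AlgHom.commutes, AlgHom.commutes, Algebra.TensorProduct.algebraMap_apply]
        simp [Algebra.algebraMap_eq_smul_one] }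
  exact subalgebra_eq_top D
    (fun g => by show _ = _; simp [← map_mul])
    (fun i => by
      show _ = _
      rw [comulHom_X, counitHom_X, map_add, map_add, map_zero, LinearMap.lTensor_tmul,
        LinearMap.lTensor_tmul, LinearMap.mul'_apply, LinearMap.mul'_apply, antip_X, antip_one,
        ← mul_assoc, grp_deg_mul_X,
        show FK3.deg i i = i by revert i; decide, mul_one, neg_mul, mul_assoc, ← map_mul,
        deg_mul_self, map_one, mul_one, add_neg_cancel]) y

instance : HopfAlgebra K (Boson K) where
  antipode := antip K
  mul_antipode_rTensor_comul := LinearMap.ext antip_left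
  mul_antipode_lTensor_comul := LinearMap.ext antip_right

end Boson

/-! ## Cocycle deformations -/

section CocycleDeformations

/-- A normalized Hopf 2-cocycle on `H`: a convolution invertible `α : H ⊗ H → K` such that
`α(x₁, y₁) α(x₂ y₂, z) = α(y₁, z₁) α(x, y₂ z₂)` and `α(1, x) = α(x, 1) = ε(x)`. -/
structure TwoCocycle (K H : Type*) [Field K] [Ring H] [Bialgebra K H] where
  /-- The underlying linear form. -/
  form : H ⊗[K] H →ₗ[K] K
  isUnit_conv : IsUnit (WithConv.toConv form)
  /-- Both sides of the cocycle identity are written through the linear map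
  `x ⊗ y ↦ α(x₁, y₁) x₂ y₂`. -/
  cocycle : ∀ x y z : H,
    form (TensorProduct.lid K H (TensorProduct.map form (LinearMap.mul' K H)
        (Coalgebra.comul (R := K) (x ⊗ₜ[K] y))) ⊗ₜ[K] z)
      = form (x ⊗ₜ[K] TensorProduct.lid K H (TensorProduct.map form (LinearMap.mul' K H)
        (Coalgebra.comul (R := K) (y ⊗ₜ[K] z))))
  one_left : ∀ x : H, form (1 ⊗ₜ[K] x) = Coalgebra.counit (R := K) x
  one_right : ∀ x : H, form (x ⊗ₜ[K] 1) = Coalgebra.counit (R := K) x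

/-- The multiplication `x ·_α y = α(x₁, y₁) x₂ y₂` of the cocycle deformation `^αH`.  The coaction
of `H` on `^αH` is the comultiplication of `H`. -/
def TwoCocycle.mul {K H : Type*} [Field K] [Ring H] [Bialgebra K H] (α : TwoCocycle K H) :
    H ⊗[K] H →ₗ[K] H :=
  (TensorProduct.lid K H).toLinearMap ∘ₗ TensorProduct.map α.form (LinearMap.mul' K H) ∘ₗ
    Coalgebra.comul

variable {K H W W' : Type*} [Field K] [Ring H] [Bialgebra K H]
  [AddCommGroup W] [Module K W] [AddCommGroup W'] [Module K W']

/-- `(m, ρ)` is the structure of a (unital, associative, right) `H`-comodule algebra on `W`. -/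
structure IsComoduleAlgebra (m : W ⊗[K] W →ₗ[K] W) (ρ : W →ₗ[K] W ⊗[K] H) : Prop where
  assoc : ∀ x y z, m (m (x ⊗ₜ[K] y) ⊗ₜ[K] z) = m (x ⊗ₜ[K] m (y ⊗ₜ[K] z))
  exists_one : ∃ e, (∀ x, m (e ⊗ₜ[K] x) = x ∧ m (x ⊗ₜ[K] e) = x) ∧ ρ e = e ⊗ₜ[K] 1
  coassoc : (TensorProduct.assoc K W H H).toLinearMap ∘ₗ ρ.rTensor H ∘ₗ ρ
    = (Coalgebra.comul (R := K) (A := H)).lTensor W ∘ₗ ρ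
  counit : (TensorProduct.rid K W).toLinearMap ∘ₗ
    (Coalgebra.counit (R := K) (A := H)).lTensor W ∘ₗ ρ = LinearMap.id
  map_mul : ρ ∘ₗ m = TensorProduct.map m (LinearMap.mul' K H) ∘ₗ
    (TensorProduct.tensorTensorTensorComm K W H W H).toLinearMap ∘ₗ TensorProduct.map ρ ρ

/-- An isomorphism of `H`-comodule algebras exists between `(W, m, ρ)` and `(W', m', ρ')`. -/
def IsoComoduleAlgebra (m : W ⊗[K] W →ₗ[K] W) (ρ : W →ₗ[K] W ⊗[K] H)
    (m' : W' ⊗[K] W' →ₗ[K] W') (ρ' : W' →ₗ[K] W' ⊗[K] H) : Prop :=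
  ∃ g : W ≃ₗ[K] W', g.toLinearMap ∘ₗ m = m' ∘ₗ TensorProduct.map g.toLinearMap g.toLinearMap ∧
    g.toLinearMap.rTensor H ∘ₗ ρ = ρ' ∘ₗ g.toLinearMap

/-- The map `M : W ⊗ W → W ⊗ H`, `x ⊗ y ↦ x y₁ ⊗ y₂`. -/
def canMap (m : W ⊗[K] W →ₗ[K] W) (ρ : W →ₗ[K] W ⊗[K] H) : W ⊗[K] W →ₗ[K] W ⊗[K] H :=
  m.rTensor H ∘ₗ (TensorProduct.assoc K W W H).symm.toLinearMap ∘ₗ ρ.lTensor W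

variable (K H W) in
/-- The affine space in which the structures on `W` live: the points are the triples `(m, T, ρ)`
of a multiplication, a map `W ⊗ H → W ⊗ W` and a coaction. -/
abbrev AffSp : Type _ :=
  (W ⊗[K] W →ₗ[K] W) × (W ⊗[K] H →ₗ[K] W ⊗[K] W) × (W →ₗ[K] W ⊗[K] H)

variable (K H W) in
/-- The variety `Y_H` of all cocycle deformation structures on `W`: the triples `(m, T, ρ)` for
which `(m, ρ)` is a comodule algebra structure and `T` is inverse to the map `M`. -/
def YH : Set (AffSp K H W) :=
  {y | IsComoduleAlgebra y.1 y.2.2 ∧ canMap y.1 y.2.2 ∘ₗ y.2.1 = LinearMap.id ∧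
    y.2.1 ∘ₗ canMap y.1 y.2.2 = LinearMap.id}

/-- The action of `g ∈ GL(W)` on the affine space, by transport of structure. -/
def transport (g : W ≃ₗ[K] W) (y : AffSp K H W) : AffSp K H W :=
  (g.toLinearMap ∘ₗ y.1 ∘ₗ TensorProduct.map g.symm.toLinearMap g.symm.toLinearMap,
    TensorProduct.map g.toLinearMap g.toLinearMap ∘ₗ y.2.1 ∘ₗ g.symm.toLinearMap.rTensor H,
    g.toLinearMap.rTensor H ∘ₗ y.2.2 ∘ₗ g.symm.toLinearMap)

lemma transport_refl (y : AffSp K H W) : transport (LinearEquiv.refl K W) y = y := by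
  refine Prod.ext ?_ (Prod.ext ?_ ?_) <;> ext <;> simp [transport]

lemma transport_trans (g h : W ≃ₗ[K] W) (y : AffSp K H W) :
    transport (g.trans h) y = transport h (transport g y) := by
  have e1 : (g.trans h).toLinearMap = h.toLinearMap ∘ₗ g.toLinearMap := rfl
  have e2 : (g.trans h).symm.toLinearMap = g.symm.toLinearMap ∘ₗ h.symm.toLinearMap := rfl
  simp only [transport, e1, e2, TensorProduct.map_comp, LinearMap.rTensor_comp,
    LinearMap.comp_assoc]

variable (K H W) in
/-- Two points of `Y_H` are equivalent if they lie in one `GL(W)`-orbit. -/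
def orbitSetoid : Setoid (YH K H W) where
  r y y' := ∃ g : W ≃ₗ[K] W, transport g y.1 = y'.1
  iseqv :=
    { refl := fun y => ⟨LinearEquiv.refl K W, transport_refl y.1⟩
      symm := by
        rintro y y' ⟨g, h⟩
        exact ⟨g.symm, by rw [← h, ← transport_trans, LinearEquiv.self_trans_symm, transport_refl]⟩
      trans := by
        rintro y y' y'' ⟨g, h⟩ ⟨g', h'⟩
        exact ⟨g.trans g', by rw [transport_trans, h, h']⟩ }

variable (K H W) in
/-- The moduli space `X_H = Y_H / GL(W)`. -/
abbrev XH : Type _ := Quotient (orbitSetoid K H W)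

/-- The ring `K[Y]` of regular functions on a closed subset `Y` of a finite dimensional vector
space `V`: the functions on `Y` that are polynomials in linear forms on `V`. -/
def coordRing {V : Type*} [AddCommGroup V] [Module K V] (Y : Set V) : Subalgebra K (Y → K) :=
  Algebra.adjoin K (Set.range fun (ℓ : Module.Dual K V) (y : Y) => ℓ y.1)

variable (K H W) in
/-- The ring of regular functions on `X_H`: the functions on the set of orbits that pull back to
regular functions on `Y_H`, that is, `K[X_H] = K[Y_H]^{GL(W)}`. -/
def coordRingXH : Subalgebra K (XH K H W → K) where
  carrier := {f | (fun y => f (Quotient.mk _ y)) ∈ coordRing (YH K H W)}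
  mul_mem' hf hg := (coordRing (YH K H W)).mul_mem hf hg
  add_mem' hf hg := (coordRing (YH K H W)).add_mem hf hg
  algebraMap_mem' r := (coordRing (YH K H W)).algebraMap_mem r

end CocycleDeformations

/-! ## The parameters `(λ, μ)` of a cocycle deformation of `FK_3 # KS_3` -/

section Parameters

open FK3

variable {K W : Type*} [Field K] [AddCommGroup W] [Module K W]

/-- `(12)`, `(23)`, `(13)` and `(123)` in `S_3`. -/
abbrev s12 : S3 := Equiv.swap 0 1

/-- See `s12`. -/
abbrev s23 : S3 := Equiv.swap 1 2

/-- See `s12`. -/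
abbrev s13 : S3 := Equiv.swap 0 2

/-- See `s12`. -/
abbrev c123 : S3 := finRotate 3

/-- The distinguished elements of a cocycle deformation `W` of `H = FK_3 # KS_3`:
`G g = w_g` for `g ∈ S_3`, and `w ia = w_a`, `w ib = w_b`, `w ic = w_c`.
* `w_{(12)} ≠ 0` is homogeneous of degree `(12)`;
* `w_{(123)} = v⁻¹ (w_{(12)} v w_{(12)}⁻¹)` for a nonzero `v` of degree `(23)`;
* `w_1 = 1` and `w_{(132)}`, `w_{(23)}`, `w_{(13)}` are the products
  `w_{(123)}²`, `w_{(12)} w_{(123)}`, `w_{(12)} w_{(123)}²`;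
* `w_a` satisfies `ρ(w_a) = w_a ⊗ 1 + w_{(12)} ⊗ a` and `w_{(12)} w_a w_{(12)}⁻¹ = - w_a`;
* `w_b = w_{(123)} w_a w_{(123)}⁻¹` and `w_c = w_{(123)}⁻¹ w_a w_{(123)}`. -/
structure IsFrame (m : W ⊗[K] W →ₗ[K] W) (ρ : W →ₗ[K] W ⊗[K] Boson K)
    (G : S3 → W) (w : Fin 3 → W) : Prop where
  one : ∀ x, m (G 1 ⊗ₜ[K] x) = x ∧ m (x ⊗ₜ[K] G 1) = x
  s12_ne_zero : G s12 ≠ 0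
  coact_s12 : ρ (G s12) = G s12 ⊗ₜ[K] Boson.grp K s12
  c123_eq : ∃ v : W, v ≠ 0 ∧ ρ v = v ⊗ₜ[K] Boson.grp K s23 ∧
    m (m (v ⊗ₜ[K] G c123) ⊗ₜ[K] G s12) = m (G s12 ⊗ₜ[K] v)
  c132_eq : G (c123 * c123) = m (G c123 ⊗ₜ[K] G c123)
  s23_eq : G s23 = m (G s12 ⊗ₜ[K] G c123)
  s13_eq : G s13 = m (G s12 ⊗ₜ[K] G (c123 * c123))
  coact_a : ρ (w ia) = w ia ⊗ₜ[K] 1 + G s12 ⊗ₜ[K] Boson.X K ia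
  conj_a : m (G s12 ⊗ₜ[K] w ia) = - m (w ia ⊗ₜ[K] G s12)
  b_eq : m (w ib ⊗ₜ[K] G c123) = m (G c123 ⊗ₜ[K] w ia)
  c_eq : m (G c123 ⊗ₜ[K] w ic) = m (w ia ⊗ₜ[K] G c123)

/-- The cocycle deformation `(W, m, ρ)` realizes the pair `(λ, μ)`: for suitable distinguished
elements, `w_{(12)}² = c₀`, `w_a² = λ₀` and `w_a w_b + w_b w_c + w_c w_a = μ₀` are scalars with
`c₀ ≠ 0`, and `λ = λ₀ / c₀`, `μ = μ₀ / c₀`. -/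
def Realizes (m : W ⊗[K] W →ₗ[K] W) (ρ : W →ₗ[K] W ⊗[K] Boson K) (lam mu : K) : Prop :=
  ∃ (G : S3 → W) (w : Fin 3 → W) (c₀ lam₀ mu₀ : K), IsFrame m ρ G w ∧ c₀ ≠ 0 ∧
    m (G s12 ⊗ₜ[K] G s12) = c₀ • G 1 ∧
    m (w ia ⊗ₜ[K] w ia) = lam₀ • G 1 ∧
    m (w ia ⊗ₜ[K] w ib) + m (w ib ⊗ₜ[K] w ic) + m (w ic ⊗ₜ[K] w ia) = mu₀ • G 1 ∧
    lam = lam₀ / c₀ ∧ mu = mu₀ / c₀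

/-- The words `1, a, b, c, ab, ac, ba, bc, aba, abc, bac, abac`. -/
def words : Fin 12 → List (Fin 3) :=
  ![[], [ia], [ib], [ic], [ia, ib], [ia, ic], [ib, ia], [ib, ic], [ia, ib, ia], [ia, ib, ic],
    [ib, ia, ic], [ia, ib, ia, ic]]

/-- The product in `(W, m)` of a word in `w_a, w_b, w_c` with the element `y`. -/
def wordMul (m : W ⊗[K] W →ₗ[K] W) (w : Fin 3 → W) (l : List (Fin 3)) (y : W) : W :=
  l.foldr (fun i z => m (w i ⊗ₜ[K] z)) y

/-- For a basis `B` of `W` indexed by the products of one of the twelve words and an element of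
`S_3`, the subvariety `Y' ⊆ Y_H` of the structures for which `B` is the basis of the products
`w_{i₁} ⋯ w_{iₜ} w_g` of the distinguished elements. -/
def YPrime (B : Module.Basis (Fin 12 × S3) K W) : Set (AffSp K (Boson K) W) :=
  {y | y ∈ YH K (Boson K) W ∧ ∃ (G : S3 → W) (w : Fin 3 → W), IsFrame y.1 y.2.2 G w ∧
    ∀ i g, B (i, g) = wordMul y.1 w (words i) (G g)}

/-- The embedding of `N = GL_1` in `GL(W)`: `ν` multiplies the basis vector indexed by a word of
length `t` and `g ∈ S_3` by `ν ^ (t + (1 - sgn g) / 2)`. -/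
def actN (B : Module.Basis (Fin 12 × S3) K W) (ν : Kˣ) : W ≃ₗ[K] W :=
  B.equiv (B.unitsSMul fun p =>
    ν ^ ((words p.1).length + if Equiv.Perm.sign p.2 = 1 then 0 else 1)) (Equiv.refl _)

/-- The ring `K[Y']^N` of `N`-invariant regular functions on `Y'`. -/
def coordRingYPrime (B : Module.Basis (Fin 12 × S3) K W) : Subalgebra K (YPrime B → K) where
  carrier := {f | f ∈ coordRing (YPrime B) ∧
    ∀ (ν : Kˣ) (y y' : YPrime B), transport (actN B ν) y.1 = y'.1 → f y = f y'}
  mul_mem' hf hg := ⟨(coordRing (YPrime B)).mul_mem hf.1 hg.1, fun ν y y' h => by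
    rw [Pi.mul_apply, Pi.mul_apply, hf.2 ν y y' h, hg.2 ν y y' h]⟩
  add_mem' hf hg := ⟨(coordRing (YPrime B)).add_mem hf.1 hg.1, fun ν y y' h => by
    rw [Pi.add_apply, Pi.add_apply, hf.2 ν y y' h, hg.2 ν y y' h]⟩
  algebraMap_mem' r := ⟨(coordRing (YPrime B)).algebraMap_mem r, fun _ _ _ _ => rfl⟩

end Parameters

end

/-!
Cocycle deformations of `H = FK_3 # KS_3` are the same as `H`-Galois objects of dimension `72`,
that is, comodule algebras for which the canonical map `M` is bijective, and these are classified
by generators and relations. For `p = (λ, μ)` let `GalObj K p` be the smash product `E(λ, μ) #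
KS_3`, where `E(λ, μ)` is generated by `a, b, c` with `a² = b² = c² = λ` and `ab + bc + ca = ac +
cb + ba = μ`.

*The family consists of Galois objects.* Rewriting shows that the products of the twelve words
with group elements span `GalObj K p` (`FKRelations.mul_mem`). The algebra is nonzero, since it
has a representation induced from `2 × 2` matrices (`exists_matrix_solution`, `exists_induced`).
Hence there is a linear form `f` with value `1` on the group elements, and `x ↦ f(x₀) x₁` is a
colinear map to `H` that is triangular with respect to word length. So it is an isomorphism of
comodules, the dimension is `72`, and `M` is bijective because it is surjective
(`GalObj.isGalois`). Transport along this isomorphism gives a multiplication on `H`, and its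
composition with the counit is a `2`-cocycle (`GalObj.exists_twoCocycle`). Conversely the
canonical map of `ᵅH` is the one of `H` composed with convolution by `α`, so it is bijective
(`TwoCocycle.canMap_bijective`).

*Every Galois object is in the family.* The slices of the tensors `M⁻¹(1 ⊗ h)` provide homogeneous
elements `w_g` and a skew primitive element `w_a` (`IsGaloisComodule.exists_distinguished`). Over
an algebraically closed field they can be rescaled so that the `w_g` represent `S_3`. The left
sides of the relations are then coinvariant, hence scalars, and a dimension count finishes the
proof (`IsGaloisComodule.exists_equiv`). The same argument applied to arbitrary distinguished
elements shows that they are the standard ones up to a common factor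
(`IsGaloisComodule.frame_normalForm`), so that a pair is realized exactly by the isomorphic copies
of the corresponding algebra (`IsComoduleAlgebra.realizes_iff`).

*Regular functions.* With `T = M⁻¹` at hand, elements such as `w_s⁻¹ w_a` and the commutators of
the `w_g`, which do not depend on the rescaling, are polynomial in `(m, T)`. They give `λ` and `μ`
as polynomials in the structure constants (`param_mem_coordRing`, `param_eq`); in particular the
pair is unique. In the other direction, the structure constants of `GalObj K p` in the basis of
words are polynomials in `λ` and `μ`, also those of the inverse of `M` (`GalObj.regular_point`).
So a regular function that is constant on orbits is a polynomial in `λ` and `μ`, by evaluation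
along this family, and no two different polynomials agree on it. On `Y'` every point is in the
orbit of a member of the family under the torus `N` alone (`exists_transport_point_eq`).
-/

noncomputable section

/-! ### Words in deformed Fomin–Kirillov generators -/

/-- `G` and `w` satisfy the relations of the deformed smash product with parameters `lam`, `mu`:
the `w i` have square `lam`, the two cyclic sums are `mu`, and `S_3` acts on the `w i` by signed
permutations.  The base `k` is an arbitrary commutative ring, because the spanning results are also
used for families of algebras over a polynomial ring. -/
structure FKRelations {k R : Type*} [CommRing k] [Ring R] [Algebra k R] (lam mu : k)
    (G : S3 →* R) (w : Fin 3 → R) : Prop where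
  sq : ∀ i, w i * w i = algebraMap k R lam
  abc : w FK3.ia * w FK3.ib + w FK3.ib * w FK3.ic + w FK3.ic * w FK3.ia = algebraMap k R mu
  acb : w FK3.ia * w FK3.ic + w FK3.ic * w FK3.ib + w FK3.ib * w FK3.ia = algebraMap k R mu
  conj : ∀ g i, G g * w i = ((Equiv.Perm.sign g : ℤˣ) : ℤ) • (w (g i) * G g)

namespace FKRelations

variable {k R : Type*} [CommRing k] [Ring R] [Algebra k R] {lam mu : k} {G : S3 →* R}
  {w : Fin 3 → R}

/-- The twelve words times `y` span a subspace that is closed under left multiplication by the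
generators: the relations rewrite `ca`, `cb` and `bab` into normal form. -/
lemma mul_word_mem (h : FKRelations lam mu G w) {y : R} {S : Submodule k R}
    (hS : ∀ j, ((words j).map w).prod * y ∈ S) (i : Fin 3) (j : Fin 12) :
    w i * (((words j).map w).prod * y) ∈ S := by
  obtain ⟨a, ha⟩ : ∃ a, a = w FK3.ia := ⟨_, rfl⟩
  obtain ⟨b, hb⟩ : ∃ b, b = w FK3.ib := ⟨_, rfl⟩
  obtain ⟨c, hc⟩ : ∃ c, c = w FK3.ic := ⟨_, rfl⟩
  have hab := h.abc
  have hac := h.acb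
  rw [← ha, ← hb, ← hc] at hab hac
  have haa : ∀ z, a * (a * z) = lam • z := fun z => by
    rw [← mul_assoc, ha, h.sq, Algebra.smul_def]
  have hbb : ∀ z, b * (b * z) = lam • z := fun z => by
    rw [← mul_assoc, hb, h.sq, Algebra.smul_def]
  have hcc : ∀ z, c * (c * z) = lam • z := fun z => by
    rw [← mul_assoc, hc, h.sq, Algebra.smul_def]
  have hca : ∀ z, c * (a * z) = mu • z - a * (b * z) - b * (c * z) := fun z => by
    rw [Algebra.smul_def, ← hab]; noncomm_ring
  have hcb : ∀ z, c * (b * z) = mu • z - b * (a * z) - a * (c * z) := fun z => by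
    rw [Algebra.smul_def, ← hac]; noncomm_ring
  -- `bab` is computed from the two ways of rewriting `caa`
  have hbab : ∀ z, b * (a * (b * z)) = a * (b * (a * z)) - mu • (a * z) + mu • (b * z) := by
    intro z
    have e : c * (a * (a * z)) = lam • (c * z) := by rw [haa, mul_smul_comm]
    rw [hca, hca] at e
    simp only [mul_sub, mul_smul_comm, hbb] at e
    refine sub_eq_zero.mp (Eq.trans ?_ (sub_eq_zero.mpr e))
    abel
  have h0 := hS 0
  have h1 := hS 1
  have h2 := hS 2
  have h3 := hS 3
  have h4 := hS 4
  have h5 := hS 5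
  have h6 := hS 6
  have h7 := hS 7
  have h8 := hS 8
  have h9 := hS 9
  have h10 := hS 10
  have h11 := hS 11
  simp only [words, Matrix.cons_val, List.map_cons, List.map_nil, List.prod_cons, List.prod_nil,
    mul_one, one_mul, ← ha, ← hb, ← hc, mul_assoc] at h0 h1 h2 h3 h4 h5 h6 h7 h8 h9 h10 h11
  have hi : w i = a ∨ w i = b ∨ w i = c := by
    fin_cases i
    exacts [Or.inr (Or.inl hb.symm), Or.inr (Or.inr hc.symm), Or.inl ha.symm]
  rcases hi with hi | hi | hi <;> rw [hi] <;> fin_cases j <;>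
    simp only [words, Fin.mk_one, Fin.zero_eta, Fin.reduceFinMk, Matrix.cons_val, List.map_cons,
      List.map_nil, List.prod_cons, List.prod_nil, mul_one, one_mul, ← ha, ← hb, ← hc, mul_assoc,
      haa, hbb, hcc, hca, hcb, hbab, mul_sub, mul_smul_comm] <;>
    repeat (first | assumption | apply S.add_mem | apply S.sub_mem | apply S.smul_mem)

/-- The span of the products of one of the twelve words with an element of `S_3`. -/
def wordSpan (k : Type*) {R : Type*} [CommRing k] [Ring R] [Algebra k R] (G : S3 →* R)
    (w : Fin 3 → R) : Submodule k R :=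
  Submodule.span k (Set.range fun p : Fin 12 × S3 => ((words p.1).map w).prod * G p.2)

lemma word_mul_mem_wordSpan (u : Fin 12) (g : S3) :
    ((words u).map w).prod * G g ∈ wordSpan k G w := Submodule.subset_span ⟨(u, g), rfl⟩

lemma one_mem_wordSpan : (1 : R) ∈ wordSpan k G w := by
  simpa [words] using word_mul_mem_wordSpan (k := k) (w := w) (G := G) 0 1

lemma gen_mul_mem (h : FKRelations lam mu G w) (i : Fin 3) {z : R} (hz : z ∈ wordSpan k G w) :
    w i * z ∈ wordSpan k G w := by
  induction hz using Submodule.span_induction with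
  | mem x hx =>
    obtain ⟨⟨u, g⟩, rfl⟩ := hx
    exact h.mul_word_mem (fun j => word_mul_mem_wordSpan j g) i u
  | zero => rw [mul_zero]; exact Submodule.zero_mem _
  | add x y _ _ hx hy => rw [mul_add]; exact Submodule.add_mem _ hx hy
  | smul c x _ hx => rw [mul_smul_comm]; exact Submodule.smul_mem _ _ hx

/-- The span of the words is closed under left multiplication by words of any length. -/
lemma prod_mul_mem (h : FKRelations lam mu G w) (l : List (Fin 3)) {z : R}
    (hz : z ∈ wordSpan k G w) : (l.map w).prod * z ∈ wordSpan k G w := by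
  induction l with
  | nil => simpa using hz
  | cons i l ih => rw [List.map_cons, List.prod_cons, mul_assoc]; exact h.gen_mul_mem i ih

/-- Moving a group element past a word permutes its letters and changes at most the sign. -/
lemma grp_mul_prod (h : FKRelations lam mu G w) (g : S3) (l : List (Fin 3)) :
    ∃ n : ℤ, G g * (l.map w).prod = n • (((l.map g).map w).prod * G g) := by
  induction l with
  | nil => exact ⟨1, by simp⟩
  | cons i l ih =>
    obtain ⟨n, hn⟩ := ih
    refine ⟨((Equiv.Perm.sign g : ℤˣ) : ℤ) * n, ?_⟩
    rw [List.map_cons, List.prod_cons, ← mul_assoc, h.conj, smul_mul_assoc, mul_assoc, hn,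
      mul_smul_comm, smul_smul, List.map_cons, List.map_cons, List.prod_cons, mul_assoc]

lemma grp_mul_mem (h : FKRelations lam mu G w) (g : S3) {z : R} (hz : z ∈ wordSpan k G w) :
    G g * z ∈ wordSpan k G w := by
  induction hz using Submodule.span_induction with
  | mem x hx =>
    obtain ⟨⟨u, g'⟩, rfl⟩ := hx
    obtain ⟨n, hn⟩ := h.grp_mul_prod g (words u)
    change G g * (((words u).map w).prod * G g') ∈ _
    rw [← mul_assoc, hn, smul_mul_assoc, mul_assoc, ← map_mul]
    refine zsmul_mem (h.prod_mul_mem _ ?_) n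
    simpa [words] using word_mul_mem_wordSpan (k := k) (w := w) (G := G) 0 (g * g')
  | zero => rw [mul_zero]; exact Submodule.zero_mem _
  | add x y _ _ hx hy => rw [mul_add]; exact Submodule.add_mem _ hx hy
  | smul c x _ hx => rw [mul_smul_comm]; exact Submodule.smul_mem _ _ hx

/-- The span of the words is closed under multiplication. -/
lemma mul_mem (h : FKRelations lam mu G w) {y z : R} (hy : y ∈ wordSpan k G w)
    (hz : z ∈ wordSpan k G w) : y * z ∈ wordSpan k G w := by
  induction hy using Submodule.span_induction with
  | mem x hx =>
    obtain ⟨⟨u, g⟩, rfl⟩ := hx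
    change ((words u).map w).prod * G g * z ∈ _
    rw [mul_assoc]
    exact h.prod_mul_mem _ (h.grp_mul_mem _ hz)
  | zero => rw [zero_mul]; exact Submodule.zero_mem _
  | add x y _ _ hx hy => rw [add_mul]; exact Submodule.add_mem _ hx hy
  | smul c x _ hx => rw [smul_mul_assoc]; exact Submodule.smul_mem _ _ hx

lemma gen_mem (h : FKRelations lam mu G w) (i : Fin 3) : w i ∈ wordSpan k G w := by
  simpa using h.gen_mul_mem i one_mem_wordSpan

lemma grp_mem (h : FKRelations lam mu G w) (g : S3) : G g ∈ wordSpan k G w := by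
  simpa using h.grp_mul_mem g one_mem_wordSpan

end FKRelations

/-! ### The dimension of the bosonization -/

namespace FK3

/-- The matrices of left multiplication by `a, b, c` on the twelve words: the column `v` holds the
expansion of the product of the generator with the word `v`.  They are integral, so that the
relations can be checked by evaluation. -/
def regMat (i : Fin 3) : Matrix (Fin 12) (Fin 12) ℤ := fun u v =>
  if i = ia then
    (if (u, v) ∈ [((1 : Fin 12), (0 : Fin 12)), (4, 2), (5, 3), (8, 6), (9, 7), (11, 10)]
      then 1 else 0)
  else if i = ib then
    (if (u, v) ∈ [((2 : Fin 12), (0 : Fin 12)), (6, 1), (7, 3), (8, 4), (10, 5), (11, 9)]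
      then 1 else 0)
  else
    (if (u, v) ∈ [((3 : Fin 12), (0 : Fin 12)), (10, 4), (9, 6)] then 1 else
      if (u, v) ∈ [((4 : Fin 12), (1 : Fin 12)), (7, 1), (6, 2), (5, 2), (9, 5), (10, 7), (11, 8)]
      then -1 else 0)

lemma regMat_sq (i : Fin 3) : regMat i * regMat i = 0 := by revert i; decide +kernel

lemma regMat_abc : regMat ia * regMat ib + regMat ib * regMat ic + regMat ic * regMat ia = 0 := by
  decide +kernel

lemma regMat_acb : regMat ia * regMat ic + regMat ic * regMat ib + regMat ib * regMat ia = 0 := by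
  decide +kernel

/-- The word `v` maps the empty word to the basis vector `v`; this gives the linear independence of
the words. -/
lemma regMat_words (u v : Fin 12) :
    ((words v).map regMat).prod u 0 = if u = v then 1 else 0 := by revert u v; decide +kernel

variable {K : Type*} [Field K]

/-- The left regular representation of `FK_3` in terms of the twelve words. -/
def regRep (K : Type*) [Field K] : FK3 K →ₐ[K] Matrix (Fin 12) (Fin 12) K :=
  lift (fun i => (Int.castRingHom K).mapMatrix (regMat i))
    (fun i => by rw [← map_mul, regMat_sq, map_zero])
    (by rw [← map_mul, ← map_mul, ← map_mul, ← map_add, ← map_add, regMat_abc, map_zero])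
    (by rw [← map_mul, ← map_mul, ← map_mul, ← map_add, ← map_add, regMat_acb, map_zero])

lemma regRep_word (u v : Fin 12) :
    regRep K ((words v).map (x K)).prod u 0 = if u = v then 1 else 0 := by
  have h : regRep K ((words v).map (x K)).prod
      = (Int.castRingHom K).mapMatrix ((words v).map regMat).prod := by
    rw [map_list_prod, map_list_prod, List.map_map, List.map_map]
    congr 2
    funext i
    simp [regRep]
  rw [h, RingHom.mapMatrix_apply, Matrix.map_apply, regMat_words]
  split_ifs <;> simp

end FK3

namespace Boson

variable {K : Type*} [Field K]

/-- The component of an element of `H` at `g ∈ S_3`, as an element of `FK_3`. -/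
def coeff (g : S3) : Boson K →ₗ[K] FK3 K :=
  (Finsupp.lapply g : (S3 →₀ FK3 K) →ₗ[K] FK3 K) ∘ₗ
    (SkewMonoidAlgebra.coeffLinearEquiv (S := K) (k := FK3 K) (G := S3)).toLinearMap

lemma coeff_incl_mul_grp (g h : S3) (p : FK3 K) :
    coeff g (incl K p * grp K h) = if h = g then p else 0 := by
  rw [← single_eq]
  exact SkewMonoidAlgebra.coeff_single_apply

/-- The coordinate of an element of `H` at the product of the word `u` with `g`. -/
def coord (u : Fin 12) (g : S3) : Boson K →ₗ[K] K :=
  (Matrix.entryLinearMap K K u 0 : Matrix (Fin 12) (Fin 12) K →ₗ[K] K) ∘ₗ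
    (FK3.regRep K).toLinearMap ∘ₗ coeff g

lemma prod_X (l : List (Fin 3)) : (l.map (X K)).prod = incl K (l.map (FK3.x K)).prod := by
  rw [map_list_prod, List.map_map]
  rfl

lemma coord_word (u v : Fin 12) (g h : S3) :
    coord u g (((words v).map (X K)).prod * grp K h) = if (v, h) = (u, g) then 1 else 0 := by
  rw [prod_X, coord, LinearMap.comp_apply, LinearMap.comp_apply, coeff_incl_mul_grp]
  split_ifs with h1 h2 h2
  · simp only [Prod.mk.injEq] at h2
    exact (FK3.regRep_word u v).trans (if_pos h2.1.symm)
  · refine (FK3.regRep_word u v).trans (if_neg ?_)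
    rintro rfl
    exact h2 (by rw [h1])
  · simp only [Prod.mk.injEq] at h2
    exact absurd h2.2 h1
  · simp

lemma fkRelations : FKRelations (0 : K) 0 (grp K) (X K) where
  sq i := by rw [X_sq, map_zero]
  abc := by rw [X_abc, map_zero]
  acb := by rw [X_acb, map_zero]
  conj g i := by rw [grp_mul_X, FK3.sgn, Int.cast_smul_eq_zsmul]

lemma wordSpan_eq_top : FKRelations.wordSpan K (grp K) (X K) = ⊤ := by
  refine eq_top_iff.mpr fun y _ => ?_
  let D : Subalgebra K (Boson K) :=
    { carrier := FKRelations.wordSpan K (grp K) (X K)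
      mul_mem' := fun ha hb => fkRelations.mul_mem ha hb
      add_mem' := fun ha hb => Submodule.add_mem _ ha hb
      algebraMap_mem' := fun r => by
        rw [Algebra.algebraMap_eq_smul_one]
        exact Submodule.smul_mem _ r FKRelations.one_mem_wordSpan }
  exact subalgebra_eq_top D fkRelations.grp_mem fkRelations.gen_mem y

/-- The basis of `H` that consists of the products of one of the twelve words with a group
element. -/
def wordBasis (K : Type*) [Field K] : Module.Basis (Fin 12 × S3) K (Boson K) :=
  Module.Basis.mk (v := fun p : Fin 12 × S3 => ((words p.1).map (X K)).prod * grp K p.2)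
    (by
      rw [Fintype.linearIndependent_iff]
      intro c hc p
      have := congrArg (coord p.1 p.2) hc
      simpa [coord_word] using this)
    (by rw [← wordSpan_eq_top]; exact le_rfl)

lemma finrank_eq : Module.finrank K (Boson K) = 72 := by
  rw [Module.finrank_eq_card_basis (wordBasis K), Fintype.card_prod, Fintype.card_fin,
    Fintype.card_perm, Fintype.card_fin]
  rfl

instance : FiniteDimensional K (Boson K) := (wordBasis K).finiteDimensional_of_finite

/-- The forms `coord 0 g` separate the group elements of `H`. -/
lemma coord_grp (g h : S3) : coord (K := K) 0 g (grp K h) = if h = g then 1 else 0 := by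
  have := coord_word (K := K) 0 0 g h
  simpa [words] using this

/-- A subspace of `H` that contains `1` and is closed under right multiplication by the generators
is everything. -/
lemma mem_of_right_closed (S : Submodule K (Boson K)) (h1 : 1 ∈ S)
    (hg : ∀ g, ∀ y ∈ S, y * grp K g ∈ S) (hX : ∀ i, ∀ y ∈ S, y * X K i ∈ S) (y : Boson K) :
    y ∈ S := by
  let D : Subalgebra K (Boson K) :=
    { carrier := {z | ∀ y ∈ S, y * z ∈ S}
      mul_mem' := fun {a b} ha hb y hy => by rw [← mul_assoc]; exact hb _ (ha _ hy)
      add_mem' := fun ha hb y hy => by rw [mul_add]; exact S.add_mem (ha _ hy) (hb _ hy)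
      algebraMap_mem' := fun r y hy => by
        rw [← Algebra.commutes, ← Algebra.smul_def]; exact S.smul_mem _ hy }
  have := subalgebra_eq_top D (fun g y hy => hg g y hy) (fun i y hy => hX i y hy) y 1 h1
  rwa [one_mul] at this

end Boson

/-! ### Comodule algebras over the bosonization -/

section Slices

variable {K A H : Type*} [Field K] [Ring A] [Algebra K A] [Ring H] [Bialgebra K H]

/-- In a comodule algebra, the canonical map is `x ⊗ y ↦ (x ⊗ 1) ρ(y)`. -/
lemma canMap_mul'_tmul (ρ : A →ₗ[K] A ⊗[K] H) (x y : A) :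
    canMap (LinearMap.mul' K A) ρ (x ⊗ₜ y) = (x ⊗ₜ 1) * ρ y := by
  have : ∀ s : A ⊗[K] H, (LinearMap.mul' K A).rTensor H
      ((TensorProduct.assoc K A A H).symm (x ⊗ₜ s)) = (x ⊗ₜ 1) * s := by
    intro s
    induction s with
    | zero => simp
    | tmul a h => simp
    | add s t hs ht => rw [TensorProduct.tmul_add, map_add, map_add, hs, ht, mul_add]
  simpa [canMap] using this (ρ y)

lemma canMap_mul (ρ : A →ₐ[K] A ⊗[K] H) (t : A ⊗[K] A) (z : A) :
    canMap (LinearMap.mul' K A) ρ.toLinearMap (t * (1 ⊗ₜ z))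
      = canMap (LinearMap.mul' K A) ρ.toLinearMap t * ρ z := by
  induction t with
  | zero => simp
  | tmul x y =>
    rw [Algebra.TensorProduct.tmul_mul_tmul, mul_one, canMap_mul'_tmul, canMap_mul'_tmul, mul_assoc]
    simp
  | add s t hs ht => rw [add_mul, map_add, map_add, hs, ht, add_mul]

/-- Evaluation of a linear form on the first tensor factor. -/
def slice {V L : Type*} [AddCommGroup V] [Module K V] [AddCommGroup L] [Module K L]
    (f : V →ₗ[K] K) : V ⊗[K] L →ₗ[K] L :=
  (TensorProduct.lid K L).toLinearMap ∘ₗ f.rTensor L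

@[simp] lemma slice_tmul {V L : Type*} [AddCommGroup V] [Module K V] [AddCommGroup L] [Module K L]
    (f : V →ₗ[K] K) (x : V) (y : L) :
    slice f (x ⊗ₜ[K] y) = f x • y := by simp [slice]

/-- An element of a tensor product over a field vanishes if all its slices do. -/
lemma eq_zero_of_slice {V L : Type*} [AddCommGroup V] [Module K V] [AddCommGroup L] [Module K L]
    (t : V ⊗[K] L) (h : ∀ f : V →ₗ[K] K, slice f t = 0) : t = 0 := by
  let b := Module.Free.chooseBasis K V
  rw [← (TensorProduct.equivFinsuppOfBasisLeft b).map_eq_zero_iff]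
  ext i
  rw [TensorProduct.equivFinsuppOfBasisLeft_apply]
  exact h _

lemma slice_mul (f : A →ₗ[K] K) (x : A) (h : H) (s : A ⊗[K] H) :
    slice f ((x ⊗ₜ h) * s) = h * slice (f ∘ₗ LinearMap.mulLeft K x) s := by
  induction s with
  | zero => simp
  | tmul a k => simp
  | add s t hs ht => rw [mul_add, map_add, map_add, hs, ht, mul_add]

/-- The map `x ↦ f(x₀) x₁`; it is the colinear map that corresponds to the linear form `f`. -/
def coMap {V L : Type*} [AddCommGroup V] [Module K V] [AddCommGroup L] [Module K L]
    (ρ : V →ₗ[K] V ⊗[K] L) (f : V →ₗ[K] K) : V →ₗ[K] L := slice f ∘ₗ ρ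

end Slices

section NormalFrames

variable {K A : Type*} [Field K] [Ring A] [Algebra K A]

/-- A frame of a comodule algebra over `H` that satisfies the deformed relations; it is normalized,
in that `g ↦ G g` is multiplicative. -/
structure IsNormalFrame (ρ : A →ₐ[K] A ⊗[K] Boson K) (lam mu : K) (G : S3 →* A) (w : Fin 3 → A) :
    Prop where
  rel : FKRelations lam mu G w
  coact_grp : ∀ g, ρ (G g) = G g ⊗ₜ Boson.grp K g
  coact_gen : ∀ i, ρ (w i) = w i ⊗ₜ 1 + G (FK3.deg i) ⊗ₜ Boson.X K i

lemma Boson.isNormalFrame : IsNormalFrame (Boson.comulHom K) 0 0 (Boson.grp K) (Boson.X K) where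
  rel := Boson.fkRelations
  coact_grp := Boson.comulHom_grp
  coact_gen := Boson.comulHom_X

namespace IsNormalFrame

variable {ρ : A →ₐ[K] A ⊗[K] Boson K} {lam mu : K} {G : S3 →* A} {w : Fin 3 → A}

lemma inv_mul_grp (g : S3) : G g⁻¹ * G g = 1 := by rw [← map_mul, inv_mul_cancel, map_one]

/-- A preimage of `x ⊗ h g` under the canonical map. -/
lemma canMap_grp (h : IsNormalFrame ρ lam mu G w) {x : A} {y : Boson K} {t : A ⊗[K] A} (g : S3)
    (ht : canMap (LinearMap.mul' K A) ρ.toLinearMap t = (x * G g⁻¹) ⊗ₜ y) :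
    canMap (LinearMap.mul' K A) ρ.toLinearMap (t * (1 ⊗ₜ G g)) = x ⊗ₜ (y * Boson.grp K g) := by
  rw [canMap_mul, ht, h.coact_grp, Algebra.TensorProduct.tmul_mul_tmul, mul_assoc, inv_mul_grp,
    mul_one]

/-- A preimage of `x ⊗ h x_i` under the canonical map. -/
lemma canMap_gen (h : IsNormalFrame ρ lam mu G w) {x : A} {y : Boson K} {t t' : A ⊗[K] A}
    (i : Fin 3)
    (ht : canMap (LinearMap.mul' K A) ρ.toLinearMap t = (x * G (FK3.deg i)) ⊗ₜ y)
    (ht' : canMap (LinearMap.mul' K A) ρ.toLinearMap t' = (x * G (FK3.deg i) * w i) ⊗ₜ y) :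
    canMap (LinearMap.mul' K A) ρ.toLinearMap (t * (1 ⊗ₜ w i) - t')
      = x ⊗ₜ (y * Boson.X K i) := by
  rw [map_sub, canMap_mul, ht, ht', h.coact_gen, mul_add, Algebra.TensorProduct.tmul_mul_tmul,
    Algebra.TensorProduct.tmul_mul_tmul, mul_one, mul_assoc x (G _) (G _), ← map_mul,
    Boson.deg_mul_self, map_one, mul_one, add_sub_cancel_left]

lemma canMap_one (x : A) :
    canMap (LinearMap.mul' K A) ρ.toLinearMap (x ⊗ₜ 1) = x ⊗ₜ 1 := by
  rw [canMap_mul'_tmul, AlgHom.toLinearMap_apply, map_one, mul_one]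

/-- The elements `x ⊗ h` are in the image by induction on the length of `h`: `M(t (1 ⊗ z))` is
`M(t) ρ(z)`, so the frame gives preimages for `h g` and `h x_i` from preimages for `h`. -/
lemma canMap_surjective (h : IsNormalFrame ρ lam mu G w) :
    Function.Surjective (canMap (LinearMap.mul' K A) ρ.toLinearMap) := by
  let S : Submodule K (Boson K) :=
    { carrier := {y | ∀ x : A, ∃ t, canMap (LinearMap.mul' K A) ρ.toLinearMap t = x ⊗ₜ y}
      add_mem' := by
        intro y z hy hz x
        obtain ⟨t, ht⟩ := hy x
        obtain ⟨t', ht'⟩ := hz x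
        exact ⟨t + t', by rw [map_add, ht, ht', TensorProduct.tmul_add]⟩
      zero_mem' := fun x => ⟨0, by simp⟩
      smul_mem' := by
        intro c y hy x
        obtain ⟨t, ht⟩ := hy x
        exact ⟨c • t, by rw [map_smul, ht, TensorProduct.tmul_smul]⟩ }
  have hS : ∀ y, y ∈ S := Boson.mem_of_right_closed S (fun x => ⟨_, canMap_one x⟩)
    (fun g y hy x => by
      obtain ⟨t, ht⟩ := hy (x * G g⁻¹)
      exact ⟨_, h.canMap_grp g ht⟩)
    (fun i y hy x => by
      obtain ⟨t, ht⟩ := hy (x * G (FK3.deg i))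
      obtain ⟨t', ht'⟩ := hy (x * G (FK3.deg i) * w i)
      exact ⟨_, h.canMap_gen i ht ht'⟩)
  intro s
  induction s with
  | zero => exact ⟨0, map_zero _⟩
  | tmul x y => exact hS y x
  | add s t hs ht =>
    obtain ⟨s', rfl⟩ := hs
    obtain ⟨t', rfl⟩ := ht
    exact ⟨s' + t', map_add _ _ _⟩

lemma coMap_grp (h : IsNormalFrame ρ lam mu G w) (f : A →ₗ[K] K) (g : S3) :
    coMap ρ.toLinearMap f (G g) = f (G g) • Boson.grp K g := by
  simp [coMap, h.coact_grp]

lemma coMap_gen_mul (h : IsNormalFrame ρ lam mu G w) (f : A →ₗ[K] K) (i : Fin 3) (y : A) :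
    coMap ρ.toLinearMap f (w i * y) = coMap ρ.toLinearMap (f ∘ₗ LinearMap.mulLeft K (w i)) y
      + Boson.X K i * coMap ρ.toLinearMap (f ∘ₗ LinearMap.mulLeft K (G (FK3.deg i))) y := by
  simp only [coMap, LinearMap.comp_apply, AlgHom.toLinearMap_apply, map_mul, h.coact_gen, add_mul,
    map_add, slice_mul, one_mul]

/-- The part of `H` that is spanned by words of length less than `n`. -/
def lowDegree (K : Type*) [Field K] (n : ℕ) : Submodule K (Boson K) :=
  Submodule.span K {y | ∃ (l : List (Fin 3)) (g : S3), l.length < n ∧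
    y = (l.map (Boson.X K)).prod * Boson.grp K g}

lemma lowDegree_mono {n m : ℕ} (h : n ≤ m) : lowDegree K n ≤ lowDegree K m := by
  refine Submodule.span_mono ?_
  rintro _ ⟨l, g, hl, rfl⟩
  exact ⟨l, g, by omega, rfl⟩

lemma X_mul_mem_lowDegree {n : ℕ} (i : Fin 3) {y : Boson K} (hy : y ∈ lowDegree K n) :
    Boson.X K i * y ∈ lowDegree K (n + 1) := by
  induction hy using Submodule.span_induction with
  | mem x hx =>
    obtain ⟨l, g, hl, rfl⟩ := hx
    exact Submodule.subset_span ⟨i :: l, g, by simpa using hl, by simp [mul_assoc]⟩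
  | zero => rw [mul_zero]; exact Submodule.zero_mem _
  | add x y _ _ hx hy => rw [mul_add]; exact Submodule.add_mem _ hx hy
  | smul c x _ hx => rw [mul_smul_comm]; exact Submodule.smul_mem _ _ hx

/-- The map `x ↦ f(x₀) x₁` is triangular with respect to the length of words. -/
lemma coMap_word (h : IsNormalFrame ρ lam mu G w) (l : List (Fin 3)) (g : S3) (f : A →ₗ[K] K) :
    coMap ρ.toLinearMap f ((l.map w).prod * G g)
      - f (G ((l.map FK3.deg).prod * g)) • ((l.map (Boson.X K)).prod * Boson.grp K g)
      ∈ lowDegree K l.length := by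
  induction l generalizing f with
  | nil => simp [h.coMap_grp]
  | cons i l ih =>
    have h1 := ih (f ∘ₗ LinearMap.mulLeft K (w i))
    have h2 := X_mul_mem_lowDegree i (ih (f ∘ₗ LinearMap.mulLeft K (G (FK3.deg i))))
    have h3 : coMap ρ.toLinearMap (f ∘ₗ LinearMap.mulLeft K (w i)) ((l.map w).prod * G g)
        ∈ lowDegree K (l.length + 1) := by
      rw [← sub_add_cancel (coMap ρ.toLinearMap (f ∘ₗ LinearMap.mulLeft K (w i))
        ((l.map w).prod * G g))]
      exact Submodule.add_mem _ (lowDegree_mono (Nat.le_succ _) h1)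
        (Submodule.smul_mem _ _ (Submodule.subset_span ⟨l, g, Nat.lt_succ_self _, rfl⟩))
    have h4 := Submodule.add_mem _ h3 h2
    simp only [LinearMap.comp_apply, LinearMap.mulLeft_apply, ← map_mul] at h4
    simp only [List.map_cons, List.prod_cons, List.length_cons, mul_assoc, h.coMap_gen_mul]
    rw [mul_sub, mul_smul_comm, add_sub, ← mul_assoc (Boson.X K i)] at h4
    simpa [mul_assoc] using h4

/-- A linear form that does not vanish on group elements gives a surjective map to `H`, because the
map is triangular with nonzero diagonal entries. -/
lemma coMap_surjective (h : IsNormalFrame ρ lam mu G w) {f : A →ₗ[K] K} (hf : ∀ g, f (G g) ≠ 0) :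
    Function.Surjective (coMap ρ.toLinearMap f) := by
  have key : ∀ n, lowDegree K n ≤ LinearMap.range (coMap ρ.toLinearMap f) := by
    intro n
    induction n with
    | zero =>
      refine Submodule.span_le.mpr ?_
      rintro _ ⟨l, g, hl, rfl⟩
      exact absurd hl (Nat.not_lt_zero _)
    | succ n ih =>
      refine Submodule.span_le.mpr ?_
      rintro _ ⟨l, g, hl, rfl⟩
      have h1 := ih (lowDegree_mono (Nat.lt_succ_iff.mp hl) (h.coMap_word l g f))
      have h2 := Submodule.sub_mem _ (LinearMap.mem_range_self (coMap ρ.toLinearMap f)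
        ((l.map w).prod * G g)) h1
      rw [sub_sub_cancel] at h2
      exact (Submodule.smul_mem_iff _ (hf _)).mp h2
  intro y
  have hy : y ∈ FKRelations.wordSpan K (Boson.grp K) (Boson.X K) := by
    rw [Boson.wordSpan_eq_top]; trivial
  have hle : FKRelations.wordSpan K (Boson.grp K) (Boson.X K)
      ≤ LinearMap.range (coMap ρ.toLinearMap f) := by
    refine Submodule.span_le.mpr ?_
    rintro _ ⟨p, rfl⟩
    exact key _ (Submodule.subset_span ⟨_, _, Nat.lt_succ_self _, rfl⟩)
  exact hle hy

end IsNormalFrame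

end NormalFrames

/-! ### The two-parameter family of Galois objects -/

/-- The relations of the deformed smash product with parameters `p 0` and `p 1`. -/
inductive GalRel (K : Type*) [Field K] (p : Fin 2 → K) :
    FreeAlgebra K (Fin 3 ⊕ S3) → FreeAlgebra K (Fin 3 ⊕ S3) → Prop
  | one : GalRel K p (FreeAlgebra.ι K (Sum.inr 1)) 1
  | mul (g h : S3) : GalRel K p (FreeAlgebra.ι K (Sum.inr (g * h)))
      (FreeAlgebra.ι K (Sum.inr g) * FreeAlgebra.ι K (Sum.inr h))
  | sq (i : Fin 3) : GalRel K p (FreeAlgebra.ι K (Sum.inl i) * FreeAlgebra.ι K (Sum.inl i))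
      (algebraMap K _ (p 0))
  | abc : GalRel K p
      (FreeAlgebra.ι K (Sum.inl FK3.ia) * FreeAlgebra.ι K (Sum.inl FK3.ib)
        + FreeAlgebra.ι K (Sum.inl FK3.ib) * FreeAlgebra.ι K (Sum.inl FK3.ic)
        + FreeAlgebra.ι K (Sum.inl FK3.ic) * FreeAlgebra.ι K (Sum.inl FK3.ia))
      (algebraMap K _ (p 1))
  | acb : GalRel K p
      (FreeAlgebra.ι K (Sum.inl FK3.ia) * FreeAlgebra.ι K (Sum.inl FK3.ic)
        + FreeAlgebra.ι K (Sum.inl FK3.ic) * FreeAlgebra.ι K (Sum.inl FK3.ib)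
        + FreeAlgebra.ι K (Sum.inl FK3.ib) * FreeAlgebra.ι K (Sum.inl FK3.ia))
      (algebraMap K _ (p 1))
  | conj (g : S3) (i : Fin 3) : GalRel K p
      (FreeAlgebra.ι K (Sum.inr g) * FreeAlgebra.ι K (Sum.inl i))
      (((Equiv.Perm.sign g : ℤˣ) : ℤ) •
        (FreeAlgebra.ι K (Sum.inl (g i)) * FreeAlgebra.ι K (Sum.inr g)))

/-- The algebra `E(λ, μ) # KS_3`, where `E(λ, μ)` is generated by `a, b, c` with the relations
`a² = b² = c² = λ` and `ab + bc + ca = ac + cb + ba = μ`.  The parameters are `λ = p 0` and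
`μ = p 1`. -/
def GalObj (K : Type*) [Field K] (p : Fin 2 → K) : Type _ := RingQuot (GalRel K p)

namespace GalObj

variable (K : Type*) [Field K] (p : Fin 2 → K)

instance : Ring (GalObj K p) := inferInstanceAs (Ring (RingQuot (GalRel K p)))

instance : Algebra K (GalObj K p) := inferInstanceAs (Algebra K (RingQuot (GalRel K p)))

/-- The quotient map. -/
def mk : FreeAlgebra K (Fin 3 ⊕ S3) →ₐ[K] GalObj K p := RingQuot.mkAlgHom K (GalRel K p)

variable {K p} in
lemma mk_rel {x y : FreeAlgebra K (Fin 3 ⊕ S3)} (h : GalRel K p x y) : mk K p x = mk K p y :=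
  RingQuot.mkAlgHom_rel K h

/-- The generators `a, b, c` of `E(λ, μ) # KS_3`. -/
def gen (i : Fin 3) : GalObj K p := mk K p (FreeAlgebra.ι K (Sum.inl i))

/-- The group elements of `E(λ, μ) # KS_3`. -/
def grp : S3 →* GalObj K p where
  toFun g := mk K p (FreeAlgebra.ι K (Sum.inr g))
  map_one' := by rw [mk_rel GalRel.one, map_one]
  map_mul' g h := by rw [mk_rel (GalRel.mul g h), map_mul]

lemma fkRelations : FKRelations (p 0) (p 1) (grp K p) (gen K p) where
  sq i := by
    have := mk_rel (GalRel.sq (p := p) i)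
    rwa [map_mul, AlgHom.commutes] at this
  abc := by
    have := mk_rel (GalRel.abc (p := p))
    rwa [map_add, map_add, map_mul, map_mul, map_mul, AlgHom.commutes] at this
  acb := by
    have := mk_rel (GalRel.acb (p := p))
    rwa [map_add, map_add, map_mul, map_mul, map_mul, AlgHom.commutes] at this
  conj g i := by
    have := mk_rel (GalRel.conj (p := p) g i)
    rwa [map_zsmul, map_mul, map_mul] at this

variable {K p}

/-- The universal property of `E(λ, μ) # KS_3`. -/
def lift {A : Type*} [Ring A] [Algebra K A] {G : S3 →* A} {w : Fin 3 → A}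
    (h : FKRelations (p 0) (p 1) G w) : GalObj K p →ₐ[K] A :=
  RingQuot.liftAlgHom K ⟨FreeAlgebra.lift K (Sum.elim w G), by
    intro x y hxy
    cases hxy with
    | one => simp
    | mul g g' => simp
    | sq i => simpa using h.sq i
    | abc => simpa using h.abc
    | acb => simpa using h.acb
    | conj g i => simpa using h.conj g i⟩

@[simp] lemma lift_gen {A : Type*} [Ring A] [Algebra K A] {G : S3 →* A} {w : Fin 3 → A}
    (h : FKRelations (p 0) (p 1) G w) (i : Fin 3) : lift h (gen K p i) = w i := by
  simp only [lift, gen, mk]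
  erw [RingQuot.liftAlgHom_mkAlgHom_apply]
  simp

@[simp] lemma lift_grp {A : Type*} [Ring A] [Algebra K A] {G : S3 →* A} {w : Fin 3 → A}
    (h : FKRelations (p 0) (p 1) G w) (g : S3) : lift h (grp K p g) = G g := by
  simp only [lift, grp, mk]
  erw [RingQuot.liftAlgHom_mkAlgHom_apply]
  simp

lemma algHom_ext {A : Type*} [Ring A] [Algebra K A] {f f' : GalObj K p →ₐ[K] A}
    (hg : ∀ g, f (grp K p g) = f' (grp K p g)) (hw : ∀ i, f (gen K p i) = f' (gen K p i)) :
    f = f' := by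
  apply RingQuot.ringQuot_ext'
  apply FreeAlgebra.hom_ext
  funext i
  cases i with
  | inl i => exact hw i
  | inr g => exact hg g

/-- The coaction preserves the defining relations.  This is stated for an arbitrary algebra `A` with
elements that satisfy the relations, as it also computes the coaction of the defining relations in
an arbitrary comodule algebra. -/
lemma coact_sq {A : Type*} [Ring A] [Algebra K A] {G : S3 →* A} {w : Fin 3 → A}
    (hc : ∀ g i, G g * w i = ((Equiv.Perm.sign g : ℤˣ) : ℤ) • (w (g i) * G g)) (i : Fin 3) :
    (w i ⊗ₜ[K] (1 : Boson K) + G (FK3.deg i) ⊗ₜ Boson.X K i)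
      * (w i ⊗ₜ[K] (1 : Boson K) + G (FK3.deg i) ⊗ₜ Boson.X K i) = (w i * w i) ⊗ₜ 1 := by
  have h : FK3.deg i i = i := by revert i; decide
  have hs : Equiv.Perm.sign (FK3.deg i) = -1 := by revert i; decide
  simp only [add_mul, mul_add, Algebra.TensorProduct.tmul_mul_tmul, one_mul, mul_one, Boson.X_sq,
    hc, h, hs, TensorProduct.tmul_zero, Units.val_neg, Units.val_one, neg_smul, one_smul,
    TensorProduct.neg_tmul]
  abel

/-- The coaction of a cyclic sum: the two kinds of mixed terms cancel, and the terms in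
`FK_3` sum up to a relation of `FK_3`. -/
lemma coact_cyclic {A : Type*} [Ring A] [Algebra K A] {G : S3 →* A} {w : Fin 3 → A}
    (hc : ∀ g i, G g * w i = ((Equiv.Perm.sign g : ℤˣ) : ℤ) • (w (g i) * G g)) {i j k : Fin 3}
    (hX : Boson.X K i * Boson.X K j + Boson.X K j * Boson.X K k + Boson.X K k * Boson.X K i = 0)
    (h1 : FK3.deg i j = k) (h2 : FK3.deg j k = i) (h3 : FK3.deg k i = j)
    (e1 : FK3.deg j * FK3.deg k = FK3.deg i * FK3.deg j)
    (e2 : FK3.deg k * FK3.deg i = FK3.deg i * FK3.deg j) :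
    (w i ⊗ₜ[K] (1 : Boson K) + G (FK3.deg i) ⊗ₜ Boson.X K i)
        * (w j ⊗ₜ[K] (1 : Boson K) + G (FK3.deg j) ⊗ₜ Boson.X K j)
      + (w j ⊗ₜ[K] (1 : Boson K) + G (FK3.deg j) ⊗ₜ Boson.X K j)
        * (w k ⊗ₜ[K] (1 : Boson K) + G (FK3.deg k) ⊗ₜ Boson.X K k)
      + (w k ⊗ₜ[K] (1 : Boson K) + G (FK3.deg k) ⊗ₜ Boson.X K k)
        * (w i ⊗ₜ[K] (1 : Boson K) + G (FK3.deg i) ⊗ₜ Boson.X K i)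
      = (w i * w j + w j * w k + w k * w i) ⊗ₜ 1 := by
  have hs : ∀ i, Equiv.Perm.sign (FK3.deg i) = -1 := by decide
  have key : (w i * w j + w j * w k + w k * w i) ⊗ₜ[K] (1 : Boson K)
      = (w i * w j + w j * w k + w k * w i) ⊗ₜ[K] (1 : Boson K)
        + G (FK3.deg i * FK3.deg j) ⊗ₜ[K] (Boson.X K i * Boson.X K j
          + Boson.X K j * Boson.X K k + Boson.X K k * Boson.X K i) := by
    rw [hX, TensorProduct.tmul_zero, add_zero]
  rw [key]
  simp only [add_mul, mul_add, Algebra.TensorProduct.tmul_mul_tmul, one_mul, mul_one, hc, h1, h2,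
    h3, hs, ← map_mul, e1, e2, Units.val_neg, Units.val_one, neg_smul, one_smul,
    TensorProduct.neg_tmul, TensorProduct.tmul_add, TensorProduct.add_tmul]
  abel

lemma coact_conj {A : Type*} [Ring A] [Algebra K A] {G : S3 →* A} {w : Fin 3 → A}
    (hc : ∀ g i, G g * w i = ((Equiv.Perm.sign g : ℤˣ) : ℤ) • (w (g i) * G g)) (g : S3)
    (i : Fin 3) :
    G g ⊗ₜ[K] Boson.grp K g * (w i ⊗ₜ[K] (1 : Boson K) + G (FK3.deg i) ⊗ₜ Boson.X K i)
      = ((Equiv.Perm.sign g : ℤˣ) : ℤ) •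
        ((w (g i) ⊗ₜ[K] (1 : Boson K) + G (FK3.deg (g i)) ⊗ₜ Boson.X K (g i))
          * G g ⊗ₜ[K] Boson.grp K g) := by
  have e : Boson.grp K g * Boson.X K i
      = ((Equiv.Perm.sign g : ℤˣ) : ℤ) • (Boson.X K (g i) * Boson.grp K g) :=
    Boson.fkRelations.conj g i
  simp only [add_mul, mul_add, smul_add, Algebra.TensorProduct.tmul_mul_tmul, one_mul, mul_one,
    hc, e, ← map_mul, Boson.deg_conj]
  rcases Int.units_eq_one_or (Equiv.Perm.sign g) with h | h <;>
    simp [h, TensorProduct.neg_tmul, TensorProduct.tmul_neg]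

variable (K p) in
/-- The coaction on group elements. -/
def coactGrp : S3 →* GalObj K p ⊗[K] Boson K where
  toFun g := grp K p g ⊗ₜ Boson.grp K g
  map_one' := by rw [map_one, map_one]; rfl
  map_mul' g h := by rw [map_mul, map_mul, Algebra.TensorProduct.tmul_mul_tmul]

lemma coact_fkRelations : FKRelations (p 0) (p 1) (coactGrp K p)
    (fun i => gen K p i ⊗ₜ[K] (1 : Boson K) + grp K p (FK3.deg i) ⊗ₜ Boson.X K i) where
  sq i := by
    rw [coact_sq (fkRelations K p).conj, (fkRelations K p).sq,
      Algebra.TensorProduct.algebraMap_apply]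
  abc := by
    rw [coact_cyclic (fkRelations K p).conj Boson.X_abc (by decide) (by decide) (by decide)
      (by decide) (by decide), (fkRelations K p).abc,
      Algebra.TensorProduct.algebraMap_apply]
  acb := by
    rw [coact_cyclic (fkRelations K p).conj Boson.X_acb (by decide) (by decide) (by decide)
      (by decide) (by decide), (fkRelations K p).acb,
      Algebra.TensorProduct.algebraMap_apply]
  conj := coact_conj (fkRelations K p).conj

variable (K p) in
/-- The coaction of `H` on `E(λ, μ) # KS_3`. -/
def coact : GalObj K p →ₐ[K] GalObj K p ⊗[K] Boson K := lift coact_fkRelations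

lemma isNormalFrame : IsNormalFrame (coact K p) (p 0) (p 1) (grp K p) (gen K p) where
  rel := fkRelations K p
  coact_grp g := by rw [coact, lift_grp]; rfl
  coact_gen i := by rw [coact, lift_gen]

lemma wordSpan_eq_top : FKRelations.wordSpan K (grp K p) (gen K p) = ⊤ := by
  refine eq_top_iff.mpr fun y _ => ?_
  obtain ⟨q, rfl⟩ : ∃ q, mk K p q = y := RingQuot.mkAlgHom_surjective K (GalRel K p) y
  induction q using FreeAlgebra.induction with
  | grade0 r =>
    rw [AlgHom.commutes, Algebra.algebraMap_eq_smul_one]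
    exact Submodule.smul_mem _ r FKRelations.one_mem_wordSpan
  | grade1 i =>
    cases i with
    | inl i => exact (fkRelations K p).gen_mem i
    | inr g => exact (fkRelations K p).grp_mem g
  | mul a b ha hb => rw [map_mul]; exact (fkRelations K p).mul_mem (ha trivial) (hb trivial)
  | add a b ha hb => rw [map_add]; exact Submodule.add_mem _ (ha trivial) (hb trivial)

end GalObj

/-! ### The dimension of the Galois objects -/

/-- The deformed Fomin–Kirillov relations are solved in `2 × 2` matrices with `a = b`, where they
become the relations of a Clifford algebra. -/
lemma exists_matrix_solution (K : Type*) [Field K] [IsAlgClosed K] (p : Fin 2 → K) :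
    ∃ m : Fin 3 → Matrix (Fin 2) (Fin 2) K, (∀ i, m i * m i = algebraMap K _ (p 0)) ∧
      m FK3.ia * m FK3.ib + m FK3.ib * m FK3.ic + m FK3.ic * m FK3.ia = algebraMap K _ (p 1) ∧
      m FK3.ia * m FK3.ic + m FK3.ic * m FK3.ib + m FK3.ib * m FK3.ia = algebraMap K _ (p 1) := by
  obtain ⟨t, ht⟩ := IsAlgClosed.exists_pow_nat_eq (p 0) (n := 2) (by norm_num)
  refine ⟨![!![0, p 0; 1, 0], !![t, p 1 - p 0; 0, -t], !![0, p 0; 1, 0]], ?_, ?_, ?_⟩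
  · intro i
    ext r s
    fin_cases i <;> fin_cases r <;> fin_cases s <;>
      simp [Matrix.algebraMap_matrix_apply, ← ht] <;> ring
  · ext r s
    fin_cases r <;> fin_cases s <;> simp [FK3.ia, Matrix.algebraMap_matrix_apply, mul_comm]
  · ext r s
    fin_cases r <;> fin_cases s <;> simp [FK3.ia, Matrix.algebraMap_matrix_apply, mul_comm]

/-- A solution of the deformed Fomin–Kirillov relations induces a representation of the deformed
smash product on functions on `S_3`. -/
lemma exists_induced {K B : Type*} [Field K] [Ring B] [Algebra K B] {lam mu : K} (m : Fin 3 → B)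
    (hsq : ∀ i, m i * m i = algebraMap K _ lam)
    (habc : m FK3.ia * m FK3.ib + m FK3.ib * m FK3.ic + m FK3.ic * m FK3.ia = algebraMap K _ mu)
    (hacb : m FK3.ia * m FK3.ic + m FK3.ic * m FK3.ib + m FK3.ib * m FK3.ia = algebraMap K _ mu) :
    ∃ (G : S3 →* Module.End K (S3 → B)) (w : Fin 3 → Module.End K (S3 → B)),
      FKRelations lam mu G w := by
  let G : S3 →* Module.End K (S3 → B) :=
    { toFun := fun g => LinearMap.funLeft K B (fun h => g⁻¹ * h)
      map_one' := by ext f h; simp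
      map_mul' := fun g g' => LinearMap.ext fun f => funext fun h => by
        simp [mul_assoc] }
  -- the value at `h` is multiplied by the conjugate of the generator by `h⁻¹`, with a sign
  let w : Fin 3 → Module.End K (S3 → B) := fun i =>
    { toFun := fun f h => ((Equiv.Perm.sign h : ℤˣ) : ℤ) • (m (h⁻¹ i) * f h)
      map_add' := fun f f' => by ext h; simp [mul_add]
      map_smul' := fun c f => by ext h; simp [smul_comm] }
  have hw : ∀ i f h, w i f h = ((Equiv.Perm.sign h : ℤˣ) : ℤ) • (m (h⁻¹ i) * f h) :=
    fun _ _ _ => rfl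
  have hww : ∀ i j f h, (w i * w j) f h = m (h⁻¹ i) * m (h⁻¹ j) * f h := by
    intro i j f h
    rw [Module.End.mul_apply, hw, hw]
    rcases Int.units_eq_one_or (Equiv.Perm.sign h) with e | e <;> simp [e, mul_assoc]
  have hcyc : ∀ h : S3, m (h FK3.ia) * m (h FK3.ib) + m (h FK3.ib) * m (h FK3.ic)
      + m (h FK3.ic) * m (h FK3.ia) = algebraMap K _ mu ∧
      m (h FK3.ia) * m (h FK3.ic) + m (h FK3.ic) * m (h FK3.ib)
      + m (h FK3.ib) * m (h FK3.ia) = algebraMap K _ mu := by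
    intro h
    rcases FK3.perm_cases h with e | e | e | e | e | e <;> rw [e.1, e.2.1, e.2.2] <;>
      constructor <;> first
        | exact habc
        | exact hacb
        | (rw [← habc]; abel1)
        | (rw [← hacb]; abel1)
  refine ⟨G, w, ?_, ?_, ?_, ?_⟩
  · intro i
    refine LinearMap.ext fun f => funext fun h => ?_
    rw [hww, hsq, ← Algebra.smul_def]
    rfl
  · refine LinearMap.ext fun f => funext fun h => ?_
    rw [LinearMap.add_apply, LinearMap.add_apply, Pi.add_apply, Pi.add_apply, hww, hww, hww,
      ← add_mul, ← add_mul, (hcyc h⁻¹).1, ← Algebra.smul_def]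
    rfl
  · refine LinearMap.ext fun f => funext fun h => ?_
    rw [LinearMap.add_apply, LinearMap.add_apply, Pi.add_apply, Pi.add_apply, hww, hww, hww,
      ← add_mul, ← add_mul, (hcyc h⁻¹).2, ← Algebra.smul_def]
    rfl
  · intro g i
    refine LinearMap.ext fun f => funext fun h => ?_
    change ((Equiv.Perm.sign (g⁻¹ * h) : ℤˣ) : ℤ) • (m ((g⁻¹ * h)⁻¹ i) * f (g⁻¹ * h))
      = ((Equiv.Perm.sign g : ℤˣ) : ℤ) • ((Equiv.Perm.sign h : ℤˣ) : ℤ) •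
        (m (h⁻¹ (g i)) * f (g⁻¹ * h))
    rw [smul_smul, mul_inv_rev, inv_inv, Equiv.Perm.sign_mul, Equiv.Perm.sign_inv,
      Units.val_mul]
    rfl

instance {K : Type*} [Field K] [IsAlgClosed K] (p : Fin 2 → K) : Nontrivial (GalObj K p) := by
  obtain ⟨m, h1, h2, h3⟩ := exists_matrix_solution K p
  obtain ⟨G, w, h⟩ := exists_induced m h1 h2 h3
  exact (GalObj.lift h).toRingHom.domain_nontrivial

section

variable {K A : Type*} [Field K] [Ring A] [Algebra K A]

/-- Group elements are linearly independent, as they are invertible of distinct degrees. -/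
lemma linearIndependent_grpLike [Nontrivial A] {ρ : A →ₐ[K] A ⊗[K] Boson K} {G : S3 →* A}
    (h : ∀ g, ρ (G g) = G g ⊗ₜ Boson.grp K g) : LinearIndependent K G := by
  rw [Fintype.linearIndependent_iff]
  intro c hc g
  have h1 := congrArg (fun x => TensorProduct.rid K A ((Boson.coord 0 g).lTensor A (ρ x))) hc
  simp only [map_sum, map_smul, h, LinearMap.lTensor_tmul, Boson.coord_grp,
    TensorProduct.rid_tmul, ite_smul, one_smul, zero_smul, smul_ite, smul_zero,
    Finset.sum_ite_eq', Finset.mem_univ, if_true, map_zero] at h1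
  have hu : IsUnit (G g) := (Group.isUnit g).map G
  exact (smul_eq_zero.mp h1).resolve_right hu.ne_zero

/-- There is a linear form with value `1` on all group elements. -/
lemma exists_form_grpLike [Nontrivial A] {ρ : A →ₐ[K] A ⊗[K] Boson K} {G : S3 →* A}
    (h : ∀ g, ρ (G g) = G g ⊗ₜ Boson.grp K g) : ∃ f : A →ₗ[K] K, ∀ g, f (G g) = 1 := by
  have hli := linearIndependent_grpLike h
  obtain ⟨f, hf⟩ := LinearMap.exists_extend ((Module.Basis.span hli).constr K fun _ => (1 : K))
  refine ⟨f, fun g => ?_⟩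
  have h1 := LinearMap.congr_fun hf (Module.Basis.span hli g)
  rw [Module.Basis.constr_basis, LinearMap.comp_apply] at h1
  rw [← h1]
  congr 1
  exact (congrArg Subtype.val (Module.Basis.span_apply hli g)).symm

end

namespace GalObj

variable (K : Type*) [Field K] (p : Fin 2 → K)

instance : FiniteDimensional K (GalObj K p) :=
  Module.Finite.of_fg_top (by
    rw [← wordSpan_eq_top]
    exact Submodule.fg_span (Set.finite_range _))

lemma coMap_surjective (f : GalObj K p →ₗ[K] K) (hf : ∀ g, f (grp K p g) ≠ 0) :
    Function.Surjective (coMap (coact K p).toLinearMap f) :=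
  isNormalFrame.coMap_surjective hf

variable [IsAlgClosed K]

/-- A linear form with value `1` on all group elements. -/
def form : GalObj K p →ₗ[K] K := (exists_form_grpLike (isNormalFrame (p := p)).coact_grp).choose

lemma form_grp (g : S3) : form K p (grp K p g) = 1 :=
  (exists_form_grpLike (isNormalFrame (p := p)).coact_grp).choose_spec g

/-- The twelve words give the upper bound, and the colinear map to `H` that corresponds to a linear
form gives the lower bound. -/
lemma finrank_eq : Module.finrank K (GalObj K p) = 72 := by
  refine le_antisymm ?_ ?_
  · have h := finrank_range_le_card (R := K)
      (fun q : Fin 12 × S3 => ((words q.1).map (gen K p)).prod * grp K p q.2)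
    rw [Set.finrank] at h
    have e : Submodule.span K (Set.range fun q : Fin 12 × S3 =>
      ((words q.1).map (gen K p)).prod * grp K p q.2) = ⊤ := wordSpan_eq_top
    rw [e, finrank_top] at h
    refine h.trans (le_of_eq ?_)
    rw [Fintype.card_prod, Fintype.card_fin, Fintype.card_perm, Fintype.card_fin]
    rfl
  · rw [← Boson.finrank_eq (K := K)]
    refine LinearMap.finrank_le_finrank_of_surjective
      (f := coMap (coact K p).toLinearMap (form K p)) (coMap_surjective K p _ fun g => ?_)
    rw [form_grp]
    exact one_ne_zero

/-- The basis of `E(λ, μ) # KS_3` that consists of the products of one of the twelve words with a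
group element. -/
def wordBasis : Module.Basis (Fin 12 × S3) K (GalObj K p) :=
  basisOfTopLeSpanOfCardEqFinrank
    (fun q : Fin 12 × S3 => ((words q.1).map (gen K p)).prod * grp K p q.2)
    (by rw [← wordSpan_eq_top]; exact le_rfl)
    (by
      rw [finrank_eq, Fintype.card_prod, Fintype.card_fin, Fintype.card_perm, Fintype.card_fin]
      rfl)

lemma wordBasis_apply (q : Fin 12 × S3) :
    wordBasis K p q = ((words q.1).map (gen K p)).prod * grp K p q.2 := by
  rw [wordBasis, coe_basisOfTopLeSpanOfCardEqFinrank]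

lemma coMap_bijective (f : GalObj K p →ₗ[K] K) (hf : ∀ g, f (grp K p g) ≠ 0) :
    Function.Bijective (coMap (coact K p).toLinearMap f) := by
  have h := coMap_surjective K p f hf
  exact ⟨(LinearMap.injective_iff_surjective_of_finrank_eq_finrank
    (by rw [finrank_eq, Boson.finrank_eq])).mpr h, h⟩

end GalObj

/-- A comodule algebra over `H` for which the canonical map is bijective. -/
structure IsGaloisComodule {K A : Type*} [Field K] [Ring A] [Algebra K A]
    (ρ : A →ₐ[K] A ⊗[K] Boson K) : Prop where
  coassoc : (TensorProduct.assoc K A (Boson K) (Boson K)).toLinearMap ∘ₗ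
    ρ.toLinearMap.rTensor (Boson K) ∘ₗ ρ.toLinearMap
      = (Coalgebra.comul (R := K) (A := Boson K)).lTensor A ∘ₗ ρ.toLinearMap
  counit : (TensorProduct.rid K A).toLinearMap ∘ₗ
    (Coalgebra.counit (R := K) (A := Boson K)).lTensor A ∘ₗ ρ.toLinearMap = LinearMap.id
  bijective : Function.Bijective (canMap (LinearMap.mul' K A) ρ.toLinearMap)

lemma canMap_bijective_of_surjective {K A : Type*} [Field K] [AddCommGroup A] [Module K A]
    [FiniteDimensional K A] {m : A ⊗[K] A →ₗ[K] A} {ρ : A →ₗ[K] A ⊗[K] Boson K}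
    (hA : Module.finrank K A = Module.finrank K (Boson K))
    (h : Function.Surjective (canMap m ρ)) : Function.Bijective (canMap m ρ) :=
  ⟨(LinearMap.injective_iff_surjective_of_finrank_eq_finrank
    (by rw [Module.finrank_tensorProduct, Module.finrank_tensorProduct, hA])).mpr h, h⟩

lemma GalObj.isGalois (K : Type*) [Field K] [IsAlgClosed K] (p : Fin 2 → K) :
    IsGaloisComodule (coact K p) where
  coassoc := by
    have h : ((Algebra.TensorProduct.assoc K K K (GalObj K p) (Boson K) (Boson K)).toAlgHom.comp
        (Algebra.TensorProduct.map (coact K p) (AlgHom.id K (Boson K)))).comp (coact K p)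
        = (Algebra.TensorProduct.map (AlgHom.id K (GalObj K p)) (Boson.comulHom K)).comp
          (coact K p) := by
      refine algHom_ext (fun g => ?_) fun i => ?_
      · simp [isNormalFrame.coact_grp]
      · simp [isNormalFrame.coact_grp, isNormalFrame.coact_gen, TensorProduct.add_tmul,
          TensorProduct.tmul_add, Algebra.TensorProduct.one_def]
        abel
    exact LinearMap.ext fun x => DFunLike.congr_fun h x
  counit := by
    have h : ((Algebra.TensorProduct.rid K K (GalObj K p)).toAlgHom.comp
        (Algebra.TensorProduct.map (AlgHom.id K (GalObj K p)) (Boson.counitHom K))).comp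
          (coact K p) = AlgHom.id K _ := by
      refine algHom_ext (fun g => ?_) fun i => ?_
      · simp [isNormalFrame.coact_grp]
      · simp [isNormalFrame.coact_gen]
    exact LinearMap.ext fun x => DFunLike.congr_fun h x
  bijective := canMap_bijective_of_surjective (by rw [finrank_eq, Boson.finrank_eq])
    isNormalFrame.canMap_surjective

/-! ### Classification of Galois objects -/

/-- The standard presentation of `S_3`. -/
lemma exists_hom_S3 {A : Type*} [Monoid A] {s r : A} (hs : s * s = 1) (hr : r * r * r = 1)
    (hsr : s * r * s = r * r) : ∃ G : S3 →* A, G s12 = s ∧ G c123 = r := by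
  -- every element of `S_3` is `(12) ^ i * (123) ^ j`, and `j - 1` is the image of the letter `2`
  -- under `(123) ^ j`, modulo `3`
  let i : S3 → ℕ := fun g => if Equiv.Perm.sign g = 1 then 0 else 1
  let j : S3 → ℕ := fun g => (((s12 ^ i g * g) 2 : Fin 3) : ℕ) + 1
  have hs2 : ∀ n, s ^ n = s ^ (n % 2) := fun n => by
    conv_lhs => rw [← Nat.mod_add_div n 2, pow_add, pow_mul, pow_two, hs, one_pow, mul_one]
  have hr3 : ∀ n, r ^ n = r ^ (n % 3) := fun n => by
    conv_lhs => rw [← Nat.mod_add_div n 3, pow_add, pow_mul, pow_three', hr, one_pow, mul_one]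
  have hc : ∀ m, r ^ m * s = s * r ^ (m * 2) := by
    intro m
    have h : SemiconjBy s (r ^ 2) r := by
      change s * r ^ 2 = r * s
      rw [pow_two, ← hsr, ← mul_assoc, ← mul_assoc, hs, one_mul]
    rw [mul_comm m 2, pow_mul]
    exact (h.pow_right m).eq.symm
  have hcc : ∀ m n, r ^ m * s ^ n = s ^ n * r ^ (m * 2 ^ n) := by
    intro m n
    induction n with
    | zero => simp
    | succ n ih =>
      rw [pow_succ, ← mul_assoc, ih, mul_assoc, hc, ← mul_assoc, pow_succ 2, mul_assoc m]
  refine ⟨{ toFun := fun g => s ^ i g * r ^ j g, map_one' := ?_, map_mul' := ?_ }, ?_, ?_⟩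
  · change s ^ i 1 * r ^ j 1 = 1
    rw [hr3, show i 1 = 0 by decide, show j 1 % 3 = 0 by decide, pow_zero, pow_zero, mul_one]
  · intro g h
    have e1 : ∀ g h, i (g * h) = (i g + i h) % 2 := by decide
    have e2 : ∀ g h, j (g * h) % 3 = (j g * 2 ^ i h + j h) % 3 := by decide
    change s ^ i (g * h) * r ^ j (g * h) = s ^ i g * r ^ j g * (s ^ i h * r ^ j h)
    rw [e1, ← hs2, hr3, e2, ← hr3, pow_add, pow_add]
    simp only [mul_assoc]
    rw [← mul_assoc (r ^ j g), hcc, mul_assoc]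
  · change s ^ i s12 * r ^ j s12 = s
    rw [hr3, show i s12 = 1 by decide, show j s12 % 3 = 0 by decide, pow_zero, pow_one, mul_one]
  · change s ^ i c123 * r ^ j c123 = r
    rw [hr3, show i c123 = 0 by decide, show j c123 % 3 = 1 by decide, pow_zero, pow_one, one_mul]

lemma S3_induction {P : S3 → Prop} (h1 : P 1) (hm : ∀ g h, P g → P h → P (g * h)) (hs : P s12)
    (hr : P c123) (g : S3) : P g := by
  have key : ∀ g : S3, g = 1 ∨ g = c123 ∨ g = c123 * c123 ∨ g = s12 ∨ g = s12 * c123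
      ∨ g = s12 * (c123 * c123) := by decide
  rcases key g with h | h | h | h | h | h <;> rw [h]
  exacts [h1, hr, hm _ _ hr hr, hs, hm _ _ hs hr, hm _ _ hs (hm _ _ hr hr)]

namespace IsGaloisComodule

variable {K A : Type*} [Field K] [Ring A] [Algebra K A]
  {ρ : A →ₐ[K] A ⊗[K] Boson K}

lemma exists_form_one (K A : Type*) [Field K] [Ring A] [Algebra K A] [Nontrivial A] :
    ∃ f : A →ₗ[K] K, f 1 = 1 :=
  (LinearMap.exists_leftInverse_of_injective (LinearMap.toSpanSingleton K A 1)
    (LinearMap.ker_toSpanSingleton K one_ne_zero)).imp fun f hf => by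
      simpa using LinearMap.congr_fun hf 1

lemma canMap_one_tmul (x : A) :
    canMap (LinearMap.mul' K A) ρ.toLinearMap (1 ⊗ₜ x) = ρ x := by
  rw [canMap_mul'_tmul, ← Algebra.TensorProduct.one_def, one_mul, AlgHom.toLinearMap_apply]

lemma canMap_homogeneous {y : A} {h : Boson K} (hy : ρ y = y ⊗ₜ h) (x : A) :
    canMap (LinearMap.mul' K A) ρ.toLinearMap (x ⊗ₜ y) = (x * y) ⊗ₜ h := by
  rw [canMap_mul'_tmul, AlgHom.toLinearMap_apply, hy, Algebra.TensorProduct.tmul_mul_tmul, one_mul]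

/-- Homogeneous components are at most one-dimensional. -/
lemma eq_smul_of_homogeneous [Nontrivial A] (hρ : IsGaloisComodule ρ) {y z : A}
    {h : Boson K} (hu : IsUnit y)
    (hy : ρ y = y ⊗ₜ h) (hz : ρ z = z ⊗ₜ h) : ∃ c : K, z = c • y := by
  obtain ⟨u, rfl⟩ := hu
  obtain ⟨f, hf⟩ := exists_form_one K A
  have e : (z * ↑u⁻¹) ⊗ₜ[K] (u : A) = 1 ⊗ₜ z := hρ.bijective.1 (by
    rw [canMap_homogeneous hy, Units.inv_mul_cancel_right, canMap_one_tmul, hz])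
  refine ⟨f (z * ↑u⁻¹), ?_⟩
  have := congrArg (slice f) e
  rw [slice_tmul, slice_tmul, hf, one_smul] at this
  exact this.symm

/-- Coinvariants are scalars. -/
lemma eq_smul_one [Nontrivial A] (hρ : IsGaloisComodule ρ) {z : A} (hz : ρ z = z ⊗ₜ 1) :
    ∃ c : K, z = c • 1 :=
  hρ.eq_smul_of_homogeneous isUnit_one (by rw [map_one]; rfl) hz

/-- Right multiplication by a nonzero homogeneous element is injective, because `x ⊗ y ↦ xy ⊗ h` is
a restriction of the canonical map. -/
lemma isUnit_of_homogeneous [FiniteDimensional K A] (hρ : IsGaloisComodule ρ) {y : A}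
    {h : Boson K} (hy0 : y ≠ 0) (hy : ρ y = y ⊗ₜ h) : IsUnit y := by
  have hinj : Function.Injective (LinearMap.mulRight K y) := by
    rw [← LinearMap.ker_eq_bot, LinearMap.ker_eq_bot']
    intro x hx
    have h0 : x ⊗ₜ[K] y = 0 := hρ.bijective.1 (by
      rw [canMap_homogeneous hy, map_zero, show x * y = 0 from hx, TensorProduct.zero_tmul])
    obtain ⟨f, hf⟩ : ∃ f : A →ₗ[K] K, f y = 1 := by
      obtain ⟨f, hf⟩ := LinearMap.exists_leftInverse_of_injective (LinearMap.toSpanSingleton K A y)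
        (LinearMap.ker_toSpanSingleton K hy0)
      exact ⟨f, by simpa using LinearMap.congr_fun hf 1⟩
    have := congrArg (fun t => TensorProduct.rid K A (f.lTensor A t)) h0
    simpa [hf] using this
  obtain ⟨x, hx⟩ := LinearMap.injective_iff_surjective.mp hinj 1
  have hxy : x * y = 1 := hx
  have hyx : y * x = 1 := hinj (by
    simp only [LinearMap.mulRight_apply]
    rw [mul_assoc, hxy, mul_one, one_mul])
  exact ⟨⟨y, x, hyx, hxy⟩, rfl⟩

/-- The canonical map is colinear. -/
lemma canMap_colinear (hρ : IsGaloisComodule ρ) (t : A ⊗[K] A) :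
    TensorProduct.assoc K A (Boson K) (Boson K)
      ((canMap (LinearMap.mul' K A) ρ.toLinearMap).rTensor (Boson K)
      ((TensorProduct.assoc K A A (Boson K)).symm (ρ.toLinearMap.lTensor A t)))
      = (Coalgebra.comul (R := K) (A := Boson K)).lTensor A
        (canMap (LinearMap.mul' K A) ρ.toLinearMap t) := by
  have e : ∀ (x : A) (s : A ⊗[K] Boson K), TensorProduct.assoc K A (Boson K) (Boson K)
      ((canMap (LinearMap.mul' K A) ρ.toLinearMap).rTensor (Boson K)
        ((TensorProduct.assoc K A A (Boson K)).symm (x ⊗ₜ s)))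
      = (x ⊗ₜ[K] 1) * (TensorProduct.assoc K A (Boson K) (Boson K)
        (ρ.toLinearMap.rTensor (Boson K) s)) := by
    intro x s
    induction s with
    | zero => simp
    | tmul y h =>
      rw [TensorProduct.assoc_symm_tmul, LinearMap.rTensor_tmul, canMap_mul'_tmul,
        LinearMap.rTensor_tmul]
      induction ρ.toLinearMap y with
      | zero => simp
      | tmul a b => simp [Algebra.TensorProduct.one_def]
      | add s t hs ht =>
        rw [mul_add, TensorProduct.add_tmul, map_add, hs, ht, TensorProduct.add_tmul, map_add,
          mul_add]
    | add s t hs ht => simp only [TensorProduct.tmul_add, map_add, hs, ht, mul_add]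
  induction t with
  | zero => simp
  | tmul x y =>
    rw [LinearMap.lTensor_tmul, e, canMap_mul'_tmul]
    have h := LinearMap.congr_fun hρ.coassoc y
    simp only [LinearMap.comp_apply, LinearEquiv.coe_coe] at h
    rw [h]
    induction ρ.toLinearMap y with
    | zero => simp
    | tmul a b => simp [Boson.comul_eq]
    | add s t hs ht => simp only [mul_add, map_add, hs, ht]
  | add s t hs ht => simp only [map_add, hs, ht]

/-- The coaction of the slices of the translation map `h ↦ M⁻¹(1 ⊗ h)`. -/
lemma coact_slice (hρ : IsGaloisComodule ρ) {t : A ⊗[K] A} {h : Boson K}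
    (ht : canMap (LinearMap.mul' K A) ρ.toLinearMap t = 1 ⊗ₜ h) {s : (A ⊗[K] A) ⊗[K] Boson K}
    (hs : (canMap (LinearMap.mul' K A) ρ.toLinearMap).rTensor (Boson K) s
      = (TensorProduct.assoc K A (Boson K) (Boson K)).symm
        (1 ⊗ₜ Coalgebra.comul (R := K) (A := Boson K) h)) (f : A →ₗ[K] K) :
    ρ (slice f t) = (slice f).rTensor (Boson K) s := by
  have hinj : Function.Injective
      ((canMap (LinearMap.mul' K A) ρ.toLinearMap).rTensor (Boson K)) :=
    Module.Flat.rTensor_preserves_injective_linearMap _ hρ.bijective.1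
  have e : (TensorProduct.assoc K A A (Boson K)).symm (ρ.toLinearMap.lTensor A t) = s := by
    refine hinj ?_
    rw [hs, LinearEquiv.eq_symm_apply, hρ.canMap_colinear, ht, LinearMap.lTensor_tmul]
  rw [← e]
  clear e hs ht
  induction t with
  | zero => simp
  | tmul x y =>
    rw [slice_tmul, LinearMap.lTensor_tmul, map_smul, AlgHom.toLinearMap_apply]
    induction ρ y with
    | zero => simp
    | tmul a b => simp [TensorProduct.smul_tmul']
    | add s t hs ht => simp only [smul_add, TensorProduct.tmul_add, map_add, hs, ht]
  | add s t hs ht => simp only [map_add, hs, ht]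

lemma coact_slice_grp (hρ : IsGaloisComodule ρ) {t : A ⊗[K] A} {g : S3}
    (ht : canMap (LinearMap.mul' K A) ρ.toLinearMap t = 1 ⊗ₜ Boson.grp K g) (f : A →ₗ[K] K) :
    ρ (slice f t) = slice f t ⊗ₜ Boson.grp K g := by
  rw [hρ.coact_slice ht (s := t ⊗ₜ Boson.grp K g) (by simp [ht, Boson.comul_eq]),
    LinearMap.rTensor_tmul]

/-- The slices of `M⁻¹(1 ⊗ g)` are homogeneous of degree `g`, and they cannot all vanish. -/
lemma exists_homogeneous [Nontrivial A] (hρ : IsGaloisComodule ρ) (g : S3) :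
    ∃ y : A, y ≠ 0 ∧ ρ y = y ⊗ₜ Boson.grp K g := by
  obtain ⟨t, ht⟩ := hρ.bijective.2 (1 ⊗ₜ Boson.grp K g)
  by_contra! hcon
  have h0 : t = 0 := eq_zero_of_slice t fun f => by
    by_contra hf
    exact hcon _ hf (hρ.coact_slice_grp ht f)
  rw [h0, map_zero] at ht
  have := congrArg (fun t => TensorProduct.rid K A ((Boson.coord 0 g).lTensor A t)) ht
  simp [Boson.coord_grp] at this

/-- Distinguished elements exist in every Galois object. -/
lemma exists_distinguished [Nontrivial A] [FiniteDimensional K A] [CharZero K]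
    (hρ : IsGaloisComodule ρ) :
    ∃ s v r x : A, s ≠ 0 ∧ ρ s = s ⊗ₜ Boson.grp K s12 ∧ v ≠ 0 ∧ ρ v = v ⊗ₜ Boson.grp K s23 ∧
      v * r * s = s * v ∧ ρ x = x ⊗ₜ 1 + s ⊗ₜ Boson.X K FK3.ia ∧ s * x = -(x * s) := by
  obtain ⟨s, hs0, hs⟩ := hρ.exists_homogeneous s12
  obtain ⟨v, hv0, hv⟩ := hρ.exists_homogeneous s23
  obtain ⟨s', hss', hs's⟩ := isUnit_iff_exists.mp (hρ.isUnit_of_homogeneous hs0 hs)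
  obtain ⟨v', hvv', hv'v⟩ := isUnit_iff_exists.mp (hρ.isUnit_of_homogeneous hv0 hv)
  have hs' : ρ s' = s' ⊗ₜ Boson.grp K s12 := by
    have e : s12 * s12 = 1 := by decide
    calc ρ s' = ρ s' * ((s * s') ⊗ₜ Boson.grp K (s12 * s12)) := by
          rw [hss', e, map_one, ← Algebra.TensorProduct.one_def, mul_one]
      _ = ρ (s' * s) * s' ⊗ₜ Boson.grp K s12 := by
          rw [map_mul ρ, hs, mul_assoc (ρ s'), Algebra.TensorProduct.tmul_mul_tmul, map_mul]
      _ = _ := by rw [hs's, map_one, one_mul]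
  obtain ⟨f, hf⟩ := exists_form_one K A
  obtain ⟨t, ht⟩ := hρ.bijective.2 (1 ⊗ₜ Boson.X K FK3.ia)
  have hd : FK3.deg FK3.ia = s12 := by decide
  -- a skew primitive element over `a` is a slice of `M⁻¹(1 ⊗ a)`
  have hx0 := hρ.coact_slice ht (s := t ⊗ₜ 1 + (s' ⊗ₜ s) ⊗ₜ Boson.X K FK3.ia)
    (by
      rw [map_add, LinearMap.rTensor_tmul, LinearMap.rTensor_tmul, ht, canMap_homogeneous hs, hs's,
        Boson.comul_eq, Boson.comulHom_X, hd]
      simp [TensorProduct.tmul_add]) (f ∘ₗ LinearMap.mulRight K s)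
  rw [map_add, LinearMap.rTensor_tmul, LinearMap.rTensor_tmul, slice_tmul, LinearMap.comp_apply,
    LinearMap.mulRight_apply, hs's, hf, one_smul] at hx0
  obtain ⟨x, hx⟩ : ∃ x, x = slice (f ∘ₗ LinearMap.mulRight K s) t := ⟨_, rfl⟩
  rw [← hx] at hx0
  have hXs : Boson.grp K s12 * Boson.X K FK3.ia * Boson.grp K s12 = -Boson.X K FK3.ia := by
    rw [← hd, Boson.grp_deg_mul_X, show FK3.deg FK3.ia FK3.ia = FK3.ia by decide, neg_mul,
      mul_assoc, ← map_mul, Boson.deg_mul_self, map_one, mul_one]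
  obtain ⟨c, hc⟩ := hρ.eq_smul_one (z := s * x * s' + x) (by
    have e : Boson.grp K s12 * Boson.grp K s12 = 1 := by
      rw [← map_mul, show s12 * s12 = 1 by decide, map_one]
    rw [map_add, map_mul, map_mul, hs, hs', hx0]
    simp only [mul_add, add_mul, Algebra.TensorProduct.tmul_mul_tmul, mul_one, hXs, e]
    rw [mul_assoc s s s', hss', mul_one, TensorProduct.tmul_neg, TensorProduct.add_tmul]
    abel)
  -- `s x s⁻¹ + x` is the scalar `c`, and subtracting `c / 2` makes `x` anticommute with `s`
  refine ⟨s, v, v' * s * v * s', x - (c / 2) • 1, hs0, hs, hv0, hv, ?_, ?_, ?_⟩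
  · simp only [mul_assoc, hs's, mul_one]
    rw [← mul_assoc v, hvv', one_mul]
  · rw [map_sub, map_smul, map_one, hx0, TensorProduct.sub_tmul, ← TensorProduct.smul_tmul',
      ← Algebra.TensorProduct.one_def]
    abel
  · have e := congrArg (· * s) hc
    simp only [add_mul, mul_assoc, hs's, mul_one, smul_mul_assoc, one_mul] at e
    rw [mul_sub, sub_mul, mul_smul_comm, smul_mul_assoc, mul_one, one_mul,
      eq_sub_of_add_eq e]
    have : c • s = (c / 2) • s + (c / 2) • s := by rw [← add_smul, add_halves]
    rw [this]
    abel

end IsGaloisComodule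

/-- In a Galois object, elements that satisfy the compatibilities of a frame also satisfy the
deformed relations for suitable parameters, because the defining relations are coinvariant. -/
lemma IsGaloisComodule.exists_parameters {K A : Type*} [Field K] [Ring A] [Algebra K A]
    [Nontrivial A] {ρ : A →ₐ[K] A ⊗[K] Boson K} (hρ : IsGaloisComodule ρ) {G : S3 →* A}
    {w : Fin 3 → A}
    (hG : ∀ g, ρ (G g) = G g ⊗ₜ Boson.grp K g)
    (hc : ∀ g i, G g * w i = ((Equiv.Perm.sign g : ℤˣ) : ℤ) • (w (g i) * G g))
    (hw : ρ (w FK3.ia) = w FK3.ia ⊗ₜ 1 + G s12 ⊗ₜ Boson.X K FK3.ia) :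
    ∃ p : Fin 2 → K, IsNormalFrame ρ (p 0) (p 1) G w := by
  have hu : ∀ g, IsUnit (G g) := fun g => (Group.isUnit g).map G
  have hd : FK3.deg FK3.ia = s12 := by decide
  have hsurj : ∀ i, ∃ g : S3, g FK3.ia = i := by decide
  have hgen : ∀ i, ρ (w i) = w i ⊗ₜ 1 + G (FK3.deg i) ⊗ₜ Boson.X K i := by
    intro i
    obtain ⟨g, rfl⟩ := hsurj i
    have e := congrArg ρ (hc g FK3.ia)
    rw [map_mul, hG, hw, ← hd, GalObj.coact_conj hc, map_zsmul, map_mul, hG] at e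
    have hu' : IsUnit (G g ⊗ₜ[K] Boson.grp K g) := by
      refine isUnit_iff_exists.mpr ⟨G g⁻¹ ⊗ₜ Boson.grp K g⁻¹, ?_, ?_⟩ <;>
        simp [← map_mul, Algebra.TensorProduct.one_def]
    rcases Int.units_eq_one_or (Equiv.Perm.sign g) with h | h <;>
      simp only [h, Units.val_neg, Units.val_one, neg_smul, one_smul, neg_inj] at e <;>
      exact (hu'.mul_left_injective e).symm
  obtain ⟨lam, hlam⟩ := hρ.eq_smul_one (z := w FK3.ia * w FK3.ia) (by
    rw [map_mul, hgen, GalObj.coact_sq hc])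
  obtain ⟨mu, hmu⟩ := hρ.eq_smul_one
    (z := w FK3.ia * w FK3.ib + w FK3.ib * w FK3.ic + w FK3.ic * w FK3.ia) (by
      rw [map_add, map_add, map_mul, map_mul, map_mul, hgen, hgen, hgen,
        GalObj.coact_cyclic hc Boson.X_abc (by decide) (by decide) (by decide) (by decide)
          (by decide)])
  have hcc : ∀ g i j, G g * (w i * w j) = w (g i) * w (g j) * G g := by
    intro g i j
    rcases Int.units_eq_one_or (Equiv.Perm.sign g) with h | h
    · rw [← mul_assoc, hc, h, Units.val_one, one_smul, mul_assoc, hc, h, Units.val_one, one_smul,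
        mul_assoc]
    · rw [← mul_assoc, hc, h, Units.val_neg, Units.val_one, neg_smul, one_smul, neg_mul, mul_assoc,
        hc, h, Units.val_neg, Units.val_one, neg_smul, one_smul, mul_neg, neg_neg, mul_assoc]
  refine ⟨![lam, mu], ⟨fun i => ?_, ?_, ?_, hc⟩, hG, hgen⟩
  · obtain ⟨g, rfl⟩ := hsurj i
    refine (hu g).mul_left_injective ?_
    change _ * G g = _ * G g
    rw [← hcc, hlam, Matrix.cons_val_zero, Algebra.algebraMap_eq_smul_one, mul_smul_comm,
      smul_mul_assoc, mul_one, one_mul]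
  · rw [hmu, Algebra.algebraMap_eq_smul_one]
    rfl
  · refine (hu s12).mul_left_injective ?_
    change _ * G s12 = _ * G s12
    have e := congrArg (G s12 * ·) hmu
    simp only [mul_add, hcc] at e
    rw [show s12 FK3.ia = FK3.ia by decide, show s12 FK3.ib = FK3.ic by decide,
      show s12 FK3.ic = FK3.ib by decide, ← add_mul, ← add_mul] at e
    rw [e, Algebra.algebraMap_eq_smul_one, mul_smul_comm, smul_mul_assoc, mul_one, one_mul]
    rfl

section Classification

variable {K A : Type*} [Field K] [IsAlgClosed K] [Ring A] [Algebra K A] [Nontrivial A]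
  [FiniteDimensional K A] {ρ : A →ₐ[K] A ⊗[K] Boson K}

/-- A comodule algebra of dimension `72` with a normalized frame is a member of the family: the
composite of `E(λ, μ) # KS_3 → A` with a map `x ↦ f(x₀) x₁` is bijective by triangularity. -/
lemma IsNormalFrame.exists_equiv (hA : Module.finrank K A = 72) {p : Fin 2 → K} {G : S3 →* A}
    {w : Fin 3 → A} (h : IsNormalFrame ρ (p 0) (p 1) G w) :
    ∃ Φ : GalObj K p ≃ₐ[K] A, (∀ g, Φ (GalObj.grp K p g) = G g) ∧
      (∀ i, Φ (GalObj.gen K p i) = w i) ∧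
      ∀ x, ρ (Φ x) = Φ.toLinearMap.rTensor (Boson K) (GalObj.coact K p x) := by
  have hcol : ρ.comp (GalObj.lift h.rel)
      = (Algebra.TensorProduct.map (GalObj.lift h.rel) (AlgHom.id K (Boson K))).comp
        (GalObj.coact K p) := by
    refine GalObj.algHom_ext (fun g => ?_) fun i => ?_
    · simp [GalObj.isNormalFrame.coact_grp, h.coact_grp]
    · simp [GalObj.isNormalFrame.coact_gen, h.coact_gen]
  have hcol' : ∀ x, ρ (GalObj.lift h.rel x)
      = (GalObj.lift h.rel).toLinearMap.rTensor (Boson K) (GalObj.coact K p x) :=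
    DFunLike.congr_fun hcol
  obtain ⟨f, hf⟩ := exists_form_grpLike h.coact_grp
  have hfac : ∀ x, coMap ρ.toLinearMap f (GalObj.lift h.rel x)
      = coMap (GalObj.coact K p).toLinearMap (f ∘ₗ (GalObj.lift h.rel).toLinearMap) x := by
    intro x
    rw [coMap, LinearMap.comp_apply, AlgHom.toLinearMap_apply, hcol', coMap, LinearMap.comp_apply,
      AlgHom.toLinearMap_apply, slice, slice, LinearMap.rTensor_comp]
    rfl
  have hinj : Function.Injective (GalObj.lift h.rel) := by
    refine Function.Injective.of_comp (f := coMap ρ.toLinearMap f) ?_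
    have := (GalObj.coMap_bijective K p (f ∘ₗ (GalObj.lift h.rel).toLinearMap) fun g => by
      simp [hf]).1
    intro x y hxy
    exact this (by rw [← hfac, ← hfac]; exact hxy)
  have hsurj : Function.Surjective (GalObj.lift h.rel) :=
    (LinearMap.injective_iff_surjective_of_finrank_eq_finrank
      (f := (GalObj.lift h.rel).toLinearMap) (by rw [GalObj.finrank_eq, hA])).mp hinj
  exact ⟨AlgEquiv.ofBijective _ ⟨hinj, hsurj⟩, fun g => GalObj.lift_grp h.rel g,
    fun i => GalObj.lift_gen h.rel i, hcol'⟩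

/-- The main step of the classification: after rescaling `s` and `x` by the same factor,
distinguished elements become the standard generators of `E(λ, μ) # KS_3`. -/
lemma IsGaloisComodule.exists_equiv (hρ : IsGaloisComodule ρ) (hA : Module.finrank K A = 72)
    {s v r x : A} (hs0 : s ≠ 0) (hs : ρ s = s ⊗ₜ Boson.grp K s12) (hv0 : v ≠ 0)
    (hv : ρ v = v ⊗ₜ Boson.grp K s23) (hr : v * r * s = s * v)
    (hx : ρ x = x ⊗ₜ 1 + s ⊗ₜ Boson.X K FK3.ia) (hsx : s * x = -(x * s)) :
    ∃ (ν : K) (p : Fin 2 → K) (Φ : GalObj K p ≃ₐ[K] A), ν ≠ 0 ∧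
      (∀ y, ρ (Φ y) = Φ.toLinearMap.rTensor (Boson K) (GalObj.coact K p y)) ∧
      s = ν • Φ (GalObj.grp K p s12) ∧ r = Φ (GalObj.grp K p c123) ∧
      x = ν • Φ (GalObj.gen K p FK3.ia) := by
  -- homogeneous elements of degree an involution are rescaled to have square `1`
  have normalize : ∀ (g : S3) (y : A), g * g = 1 → y ≠ 0 → ρ y = y ⊗ₜ Boson.grp K g →
      ∃ (ν : K) (y' : A), ν ≠ 0 ∧ y = ν • y' ∧ y' * y' = 1 ∧ ρ y' = y' ⊗ₜ Boson.grp K g := by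
    intro g y hg hy0 hy
    have hu := hρ.isUnit_of_homogeneous hy0 hy
    obtain ⟨c, hc⟩ := hρ.eq_smul_one (z := y * y) (by
      rw [map_mul, hy, Algebra.TensorProduct.tmul_mul_tmul, ← map_mul, hg, map_one])
    obtain ⟨ν, hν⟩ := IsAlgClosed.exists_pow_nat_eq c (n := 2) (by norm_num)
    have hν0 : ν ≠ 0 := by
      rintro rfl
      rw [← hν, zero_pow two_ne_zero, zero_smul] at hc
      exact (hu.mul hu).ne_zero hc
    refine ⟨ν, ν⁻¹ • y, hν0, (smul_inv_smul₀ hν0 y).symm, ?_, ?_⟩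
    · rw [smul_mul_smul_comm, hc, smul_smul, ← hν]
      have : ν⁻¹ * ν⁻¹ * ν ^ 2 = 1 := by field_simp
      rw [this, one_smul]
    · rw [map_smul, hy, TensorProduct.smul_tmul']
  obtain ⟨ν, t, hν, rfl, htt, ht⟩ := normalize s12 s (by decide) hs0 hs
  obtain ⟨ν', u, hν', rfl, huu, hu⟩ := normalize s23 v (by decide) hv0 hv
  have hr' : r = u * t * (u * t) := by
    simp only [smul_mul_assoc, mul_smul_comm] at hr
    have hr1 : u * r * t = t * u := by
      rw [smul_comm] at hr
      exact smul_right_injective A hν (smul_right_injective A hν' hr)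
    calc r = u * u * r * (t * t) := by rw [huu, htt, one_mul, mul_one]
      _ = u * (u * r * t) * t := by simp only [mul_assoc]
      _ = _ := by rw [hr1]; simp only [mul_assoc]
  have hut : (u * t) * (t * u) = 1 := by
    rw [mul_assoc, ← mul_assoc t, htt, one_mul, huu]
  -- `(ut)³` is coinvariant, hence a scalar, and it is inverse to its conjugate `(tu)³` by `t`
  obtain ⟨k, hk⟩ := hρ.eq_smul_one (z := u * t * (u * t) * (u * t)) (by
    simp only [map_mul, hu, ht, Algebra.TensorProduct.tmul_mul_tmul]
    simp only [← map_mul]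
    rw [show s23 * s12 * (s23 * s12) * (s23 * s12) = 1 by decide, map_one])
  have hk' : t * u * (t * u) * (t * u) = k • 1 := by
    calc t * u * (t * u) * (t * u) = t * (u * t * (u * t) * (u * t)) * t * (t * t) := by
          rw [htt, mul_one]
          simp only [mul_assoc, htt, mul_one]
      _ = _ := by rw [hk, htt, mul_one, mul_smul_comm, mul_one, smul_mul_assoc, htt]
  have hkk : (k * k) • (1 : A) = 1 := by
    calc (k * k) • (1 : A) = (k • 1) * (k • 1) := by rw [smul_mul_smul_comm, one_mul]
      _ = (u * t * (u * t) * (u * t)) * (t * u * (t * u) * (t * u)) := by rw [hk, hk']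
      _ = u * t * (u * t * (u * t * (t * u)) * (t * u)) * (t * u) := by simp only [mul_assoc]
      _ = 1 := by rw [hut, mul_one, hut, mul_one, hut]
  have hrrr : r * r * r = 1 := by
    calc r * r * r = (u * t * (u * t) * (u * t)) * (u * t * (u * t) * (u * t)) := by
          rw [hr']; simp only [mul_assoc]
      _ = 1 := by rw [hk, smul_mul_smul_comm, one_mul, hkk]
  have htrt : t * r * t = r * r := by
    have e : r * (t * r * t) = 1 := by
      calc r * (t * r * t) = u * t * (u * t * (t * u)) * (t * u) * (t * t) := by
            rw [hr', htt, mul_one]; simp only [mul_assoc, htt, mul_one]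
        _ = 1 := by rw [hut, mul_one, hut, one_mul, htt]
    calc t * r * t = r * r * r * (t * r * t) := by rw [hrrr, one_mul]
      _ = r * r * (r * (t * r * t)) := by simp only [mul_assoc]
      _ = r * r := by rw [e, mul_one]
  obtain ⟨G, hGs, hGr⟩ := exists_hom_S3 htt hrrr htrt
  have hG : ∀ g, ρ (G g) = G g ⊗ₜ Boson.grp K g := by
    intro g
    induction g using S3_induction with
    | h1 => rw [map_one, map_one, map_one]; rfl
    | hm g h hg hh =>
      rw [map_mul, map_mul, map_mul, hg, hh, Algebra.TensorProduct.tmul_mul_tmul]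
    | hs => rw [hGs, ht]
    | hr =>
      rw [hGr, hr', map_mul, map_mul, hu, ht]
      simp only [Algebra.TensorProduct.tmul_mul_tmul, ← map_mul]
      rw [show s23 * s12 * (s23 * s12) = c123 by decide]
  obtain ⟨y, hy⟩ : ∃ y, y = ν⁻¹ • x := ⟨_, rfl⟩
  have hxy : x = ν • y := by rw [hy, smul_inv_smul₀ hν]
  have hty : t * y = -(y * t) := by
    rw [smul_mul_assoc, mul_smul_comm, ← smul_neg] at hsx
    rw [hy, mul_smul_comm, smul_mul_assoc, smul_right_injective A hν hsx, smul_neg]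
  have hρy : ρ y = y ⊗ₜ 1 + G s12 ⊗ₜ Boson.X K FK3.ia := by
    rw [hy, map_smul, hx, smul_add, TensorProduct.smul_tmul', TensorProduct.smul_tmul',
      inv_smul_smul₀ hν, hGs]
  let w : Fin 3 → A := ![r * y * (r * r), r * r * y * r, y]
  have hwa : w FK3.ia = y := rfl
  have hwb : w FK3.ib = r * y * (r * r) := rfl
  have hwc : w FK3.ic = r * r * y * r := rfl
  have hrt : r * t = t * (r * r) := by
    rw [← htrt, ← mul_assoc, ← mul_assoc, htt, one_mul]
  have hrrt : r * r * t = t * r := by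
    rw [← htrt, mul_assoc, htt, mul_one]
  have hc : ∀ g i, G g * w i = ((Equiv.Perm.sign g : ℤˣ) : ℤ) • (w (g i) * G g) := by
    intro g
    induction g using S3_induction with
    | h1 => intro i; simp
    | hm g h hg hh =>
      intro i
      rw [map_mul, mul_assoc, hh, mul_smul_comm, ← mul_assoc, hg, smul_mul_assoc, smul_smul,
        Equiv.Perm.sign_mul, Units.val_mul, mul_comm ((Equiv.Perm.sign h : ℤˣ) : ℤ), mul_assoc]
      rfl
    | hs =>
      have e : Equiv.Perm.sign s12 = -1 := by decide
      intro i
      rw [e, hGs, Units.val_neg, Units.val_one, neg_smul, one_smul]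
      have h3 : ∀ i, i = FK3.ia ∨ i = FK3.ib ∨ i = FK3.ic := by decide
      rcases h3 i with rfl | rfl | rfl
      · exact hty
      · rw [show s12 FK3.ib = FK3.ic by decide, hwb, hwc]
        calc t * (r * y * (r * r)) = t * r * y * (r * r) := by simp only [mul_assoc]
          _ = r * r * (t * y) * (r * r) := by rw [← hrrt]; simp only [mul_assoc]
          _ = -(r * r * y * (t * (r * r))) := by rw [hty]; simp only [mul_assoc, neg_mul, mul_neg]
          _ = _ := by rw [← hrt]; simp only [mul_assoc]
      · rw [show s12 FK3.ic = FK3.ib by decide, hwb, hwc]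
        calc t * (r * r * y * r) = t * (r * r) * y * r := by simp only [mul_assoc]
          _ = r * (t * y) * r := by rw [← hrt]; simp only [mul_assoc]
          _ = -(r * y * (t * r)) := by rw [hty]; simp only [mul_assoc, neg_mul, mul_neg]
          _ = _ := by rw [← hrrt]; simp only [mul_assoc]
    | hr =>
      have e : Equiv.Perm.sign c123 = 1 := by decide
      intro i
      rw [e, hGr, Units.val_one, one_smul]
      have h3 : ∀ i, i = FK3.ia ∨ i = FK3.ib ∨ i = FK3.ic := by decide
      rcases h3 i with rfl | rfl | rfl
      · rw [show c123 FK3.ia = FK3.ib by decide, hwa, hwb, mul_assoc (r * y), hrrr, mul_one]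
      · rw [show c123 FK3.ib = FK3.ic by decide, hwb, hwc]
        simp only [mul_assoc]
      · rw [show c123 FK3.ic = FK3.ia by decide, hwc, hwa]
        calc r * (r * r * y * r) = r * r * r * (y * r) := by simp only [mul_assoc]
          _ = y * r := by rw [hrrr, one_mul]
  obtain ⟨p, hp⟩ := hρ.exists_parameters hG hc hρy
  obtain ⟨Φ, h1, h2, h3⟩ := hp.exists_equiv hA
  exact ⟨ν, p, Φ, hν, h3, by rw [h1, hGs], by rw [h1, hGr], by rw [h2, hwa, hxy]⟩

end Classification

/-! ### Isomorphisms of comodule algebras and distinguished elements -/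

section StructIso

variable {K H W W' W'' : Type*} [Field K] [Ring H] [Bialgebra K H] [AddCommGroup W] [Module K W]
  [AddCommGroup W'] [Module K W'] [AddCommGroup W''] [Module K W'']

/-- The linear isomorphism `g` is an isomorphism of comodule algebras. -/
def IsStructIso (g : W ≃ₗ[K] W') (m : W ⊗[K] W →ₗ[K] W) (ρ : W →ₗ[K] W ⊗[K] H)
    (m' : W' ⊗[K] W' →ₗ[K] W') (ρ' : W' →ₗ[K] W' ⊗[K] H) : Prop :=
  g.toLinearMap ∘ₗ m = m' ∘ₗ TensorProduct.map g.toLinearMap g.toLinearMap ∧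
    g.toLinearMap.rTensor H ∘ₗ ρ = ρ' ∘ₗ g.toLinearMap

namespace IsStructIso

variable {g : W ≃ₗ[K] W'} {m : W ⊗[K] W →ₗ[K] W} {ρ : W →ₗ[K] W ⊗[K] H}
  {m' : W' ⊗[K] W' →ₗ[K] W'} {ρ' : W' →ₗ[K] W' ⊗[K] H}
  {m'' : W'' ⊗[K] W'' →ₗ[K] W''} {ρ'' : W'' →ₗ[K] W'' ⊗[K] H}

lemma map_mul (h : IsStructIso g m ρ m' ρ') (x y : W) : g (m (x ⊗ₜ y)) = m' (g x ⊗ₜ g y) := by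
  simpa using LinearMap.congr_fun h.1 (x ⊗ₜ y)

lemma map_coact (h : IsStructIso g m ρ m' ρ') (x : W) :
    ρ' (g x) = g.toLinearMap.rTensor H (ρ x) :=
  (LinearMap.congr_fun h.2 x).symm

lemma map_coact_eq (h : IsStructIso g m ρ m' ρ') {x : W} {t : W ⊗[K] H} (hx : ρ x = t) :
    ρ' (g x) = g.toLinearMap.rTensor H t := by rw [h.map_coact, hx]

lemma of_apply (h1 : ∀ x y, g (m (x ⊗ₜ y)) = m' (g x ⊗ₜ g y))
    (h2 : ∀ x, ρ' (g x) = g.toLinearMap.rTensor H (ρ x)) : IsStructIso g m ρ m' ρ' :=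
  ⟨TensorProduct.ext' fun x y => by simpa using h1 x y, LinearMap.ext fun x => (h2 x).symm⟩

protected lemma trans (h : IsStructIso g m ρ m' ρ') {g' : W' ≃ₗ[K] W''}
    (h' : IsStructIso g' m' ρ' m'' ρ'') : IsStructIso (g.trans g') m ρ m'' ρ'' := by
  refine of_apply (fun x y => ?_) fun x => ?_
  · simp [h.map_mul, h'.map_mul]
  · rw [LinearEquiv.trans_apply, h'.map_coact, h.map_coact, ← LinearMap.comp_apply,
      ← LinearMap.rTensor_comp]
    rfl

protected lemma symm (h : IsStructIso g m ρ m' ρ') : IsStructIso g.symm m' ρ' m ρ := by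
  refine of_apply (fun x y => ?_) fun x => ?_
  · rw [LinearEquiv.symm_apply_eq, h.map_mul, g.apply_symm_apply, g.apply_symm_apply]
  · obtain ⟨x, rfl⟩ := g.surjective x
    rw [g.symm_apply_apply, h.map_coact, ← LinearMap.comp_apply, ← LinearMap.rTensor_comp]
    simp

lemma canMap_comp (h : IsStructIso g m ρ m' ρ') :
    canMap m' ρ' ∘ₗ TensorProduct.map g.toLinearMap g.toLinearMap
      = g.toLinearMap.rTensor H ∘ₗ canMap m ρ := by
  refine TensorProduct.ext' fun x y => ?_
  simp only [canMap, LinearMap.comp_apply, TensorProduct.map_tmul, LinearMap.lTensor_tmul,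
    LinearEquiv.coe_coe, h.map_coact]
  induction ρ y with
  | zero => simp
  | tmul a k => simp [h.map_mul]
  | add s t hs ht => simp only [map_add, TensorProduct.tmul_add, hs, ht]

lemma canMap_bijective (h : IsStructIso g m ρ m' ρ') (hb : Function.Bijective (canMap m ρ)) :
    Function.Bijective (canMap m' ρ') := by
  have e1 : TensorProduct.map g.toLinearMap g.toLinearMap
      = (TensorProduct.congr g g).toLinearMap := rfl
  have e2 : g.toLinearMap.rTensor H = (LinearEquiv.rTensor H g).toLinearMap := rfl
  have e : ⇑(canMap m' ρ') ∘ ⇑(TensorProduct.congr g g)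
      = ⇑(LinearEquiv.rTensor H g) ∘ canMap m ρ := by
    have := h.canMap_comp
    rw [e1, e2] at this
    exact funext fun x => LinearMap.congr_fun this x
  rw [← Function.Bijective.of_comp_iff _ (TensorProduct.congr g g).bijective, e]
  exact (LinearEquiv.rTensor H g).bijective.comp hb

/-- Comodule algebra structures are transported along linear isomorphisms. -/
lemma isComoduleAlgebra (h : IsStructIso g m ρ m' ρ') (hm : IsComoduleAlgebra m ρ) :
    IsComoduleAlgebra m' ρ' where
  assoc x y z := by
    obtain ⟨x, rfl⟩ := g.surjective x
    obtain ⟨y, rfl⟩ := g.surjective y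
    obtain ⟨z, rfl⟩ := g.surjective z
    simp only [← h.map_mul, hm.assoc]
  exists_one := by
    obtain ⟨e, he, he'⟩ := hm.exists_one
    refine ⟨g e, fun x => ?_, ?_⟩
    · obtain ⟨x, rfl⟩ := g.surjective x
      rw [← h.map_mul, ← h.map_mul, (he x).1, (he x).2]
      exact ⟨rfl, rfl⟩
    · rw [h.map_coact, he', LinearMap.rTensor_tmul]
      rfl
  coassoc := by
    refine LinearMap.ext fun x => ?_
    obtain ⟨x, rfl⟩ := g.surjective x
    have hx := congrArg (g.toLinearMap.rTensor (H ⊗[K] H)) (LinearMap.congr_fun hm.coassoc x)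
    simp only [LinearMap.comp_apply, LinearEquiv.coe_coe] at hx ⊢
    rw [h.map_coact]
    have e1 : ∀ t : W ⊗[K] H, TensorProduct.assoc K W' H H
        (ρ'.rTensor H (g.toLinearMap.rTensor H t)) = g.toLinearMap.rTensor (H ⊗[K] H)
          (TensorProduct.assoc K W H H (ρ.rTensor H t)) := by
      intro t
      induction t with
      | zero => simp
      | tmul a k =>
        simp only [LinearMap.rTensor_tmul, LinearEquiv.coe_coe, h.map_coact]
        induction ρ a with
        | zero => simp
        | tmul b l => simp
        | add s t hs ht => simp only [map_add, TensorProduct.add_tmul, hs, ht]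
      | add s t hs ht => simp only [map_add, hs, ht]
    rw [e1, hx]
    clear hx
    induction ρ x with
    | zero => simp
    | tmul a k => simp
    | add s t hs ht => simp only [map_add, hs, ht]
  counit := by
    refine LinearMap.ext fun x => ?_
    obtain ⟨x, rfl⟩ := g.surjective x
    have hx := congrArg g (LinearMap.congr_fun hm.counit x)
    simp only [LinearMap.comp_apply, LinearEquiv.coe_coe, LinearMap.id_apply] at hx ⊢
    rw [h.map_coact, ← hx]
    clear hx
    induction ρ x with
    | zero => simp
    | tmul a k => simp
    | add s t hs ht => simp only [map_add, hs, ht]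
  map_mul := by
    refine TensorProduct.ext' fun x y => ?_
    obtain ⟨x, rfl⟩ := g.surjective x
    obtain ⟨y, rfl⟩ := g.surjective y
    have hx := congrArg (g.toLinearMap.rTensor H) (LinearMap.congr_fun hm.map_mul (x ⊗ₜ y))
    simp only [LinearMap.comp_apply, LinearEquiv.coe_coe, TensorProduct.map_tmul] at hx ⊢
    rw [← h.map_mul, h.map_coact, hx, h.map_coact, h.map_coact]
    induction ρ x with
    | zero => simp
    | tmul a k =>
      induction ρ y with
      | zero => simp
      | tmul b l => simp [h.map_mul]
      | add s t hs ht => simp only [map_add, TensorProduct.tmul_add, hs, ht]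
    | add s t hs ht => simp only [map_add, TensorProduct.add_tmul, hs, ht]

end IsStructIso

/-- Any comodule algebra can be transported along a linear isomorphism. -/
lemma exists_isStructIso (g : W ≃ₗ[K] W') (m : W ⊗[K] W →ₗ[K] W) (ρ : W →ₗ[K] W ⊗[K] H) :
    IsStructIso g m ρ
      (g.toLinearMap ∘ₗ m ∘ₗ TensorProduct.map g.symm.toLinearMap g.symm.toLinearMap)
      (g.toLinearMap.rTensor H ∘ₗ ρ ∘ₗ g.symm.toLinearMap) :=
  .of_apply (fun x y => by simp) fun x => by simp

end StructIso

section Frames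

variable {K W W' : Type*} [Field K] [AddCommGroup W] [Module K W] [AddCommGroup W'] [Module K W']
  {g : W ≃ₗ[K] W'} {m : W ⊗[K] W →ₗ[K] W} {ρ : W →ₗ[K] W ⊗[K] Boson K}
  {m' : W' ⊗[K] W' →ₗ[K] W'} {ρ' : W' →ₗ[K] W' ⊗[K] Boson K}

lemma IsStructIso.isFrame (h : IsStructIso g m ρ m' ρ') {G : S3 → W} {w : Fin 3 → W}
    (hf : IsFrame m ρ G w) : IsFrame m' ρ' (fun k => g (G k)) (fun i => g (w i)) where
  one x := by
    obtain ⟨x, rfl⟩ := g.surjective x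
    rw [← h.map_mul, ← h.map_mul, (hf.one x).1, (hf.one x).2]
    exact ⟨rfl, rfl⟩
  s12_ne_zero := by simpa using hf.s12_ne_zero
  coact_s12 := by rw [h.map_coact_eq hf.coact_s12]; rfl
  c123_eq := by
    obtain ⟨v, hv0, hv, hv'⟩ := hf.c123_eq
    refine ⟨g v, by simpa using hv0, by rw [h.map_coact_eq hv]; rfl, ?_⟩
    rw [← h.map_mul, ← h.map_mul, ← h.map_mul, hv']
  c132_eq := by rw [hf.c132_eq, h.map_mul]
  s23_eq := by rw [hf.s23_eq, h.map_mul]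
  s13_eq := by rw [hf.s13_eq, h.map_mul]
  coact_a := by rw [h.map_coact_eq hf.coact_a, map_add]; rfl
  conj_a := by rw [← h.map_mul, ← h.map_mul, hf.conj_a, map_neg]
  b_eq := by rw [← h.map_mul, ← h.map_mul, hf.b_eq]
  c_eq := by rw [← h.map_mul, ← h.map_mul, hf.c_eq]

lemma IsStructIso.realizes (h : IsStructIso g m ρ m' ρ') {lam mu : K}
    (hr : Realizes m ρ lam mu) : Realizes m' ρ' lam mu := by
  obtain ⟨G, w, c₀, lam₀, mu₀, hf, hc, h1, h2, h3, h4⟩ := hr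
  refine ⟨_, _, c₀, lam₀, mu₀, h.isFrame hf, hc, ?_, ?_, ?_, h4⟩
  · rw [← h.map_mul, h1, map_smul]
  · rw [← h.map_mul, h2, map_smul]
  · rw [← h.map_mul, ← h.map_mul, ← h.map_mul, ← map_add, ← map_add, h3, map_smul]

end Frames

section Rings

variable {K : Type*} [Field K]

lemma mul'_tensorTensorTensorComm {A H : Type*} [Ring A] [Algebra K A] [Ring H] [Algebra K H]
    (s t : A ⊗[K] H) : TensorProduct.map (LinearMap.mul' K A) (LinearMap.mul' K H)
      (TensorProduct.tensorTensorTensorComm K A H A H (s ⊗ₜ t)) = s * t := by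
  induction s with
  | zero => simp
  | tmul a k =>
    induction t with
    | zero => simp
    | tmul b l => simp
    | add s t hs ht => rw [TensorProduct.tmul_add, map_add, map_add, hs, ht, mul_add]
  | add s t hs ht => rw [TensorProduct.add_tmul, map_add, map_add, hs, ht, add_mul]

lemma IsGaloisComodule.isComoduleAlgebra {A : Type*} [Ring A] [Algebra K A]
    {ρ : A →ₐ[K] A ⊗[K] Boson K} (hρ : IsGaloisComodule ρ) :
    IsComoduleAlgebra (LinearMap.mul' K A) ρ.toLinearMap where
  assoc x y z := by simp [mul_assoc]
  exists_one := ⟨1, fun x => by simp, by simp [Algebra.TensorProduct.one_def]⟩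
  coassoc := hρ.coassoc
  counit := hρ.counit
  map_mul := TensorProduct.ext' fun x y => by
    simp only [LinearMap.comp_apply, LinearEquiv.coe_coe, TensorProduct.map_tmul]
    rw [mul'_tensorTensorTensorComm]
    simp

variable {W : Type*} [AddCommGroup W] [Module K W] {m : W ⊗[K] W →ₗ[K] W}
  {ρ : W →ₗ[K] W ⊗[K] Boson K}

/-- The space `W`, as a ring with the multiplication `m`. -/
def IsComoduleAlgebra.Carrier (_ : IsComoduleAlgebra m ρ) : Type _ := W

namespace IsComoduleAlgebra

variable (h : IsComoduleAlgebra m ρ)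

instance : AddCommGroup h.Carrier := inferInstanceAs (AddCommGroup W)

/-- The unit of the multiplication `m`. -/
def unit : W := h.exists_one.choose

instance : Ring h.Carrier where
  mul x y := m ((x : W) ⊗ₜ[K] (y : W))
  one := h.unit
  left_distrib x y z := LinearMap.map_add (TensorProduct.curry m x) y z
  right_distrib x y z := LinearMap.map_add₂ (TensorProduct.curry m) x y z
  zero_mul x := LinearMap.map_zero₂ (TensorProduct.curry m) x
  mul_zero x := LinearMap.map_zero (TensorProduct.curry m x)
  mul_assoc x y z := h.assoc x y z
  one_mul x := (h.exists_one.choose_spec.1 x).1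
  mul_one x := (h.exists_one.choose_spec.1 x).2
  zsmul := fun n x => n • x
  zsmul_zero' x := zero_zsmul (G := W) x
  zsmul_succ' n x := SubNegMonoid.zsmul_succ' (G := W) n x
  zsmul_neg' n x := SubNegMonoid.zsmul_neg' (G := W) n x
  sub_eq_add_neg x y := sub_eq_add_neg (G := W) x y
  neg_add_cancel x := neg_add_cancel (G := W) x

instance : Module K h.Carrier := inferInstanceAs (Module K W)

instance : Algebra K h.Carrier := Algebra.ofModule
  (fun r x y => LinearMap.map_smul₂ (TensorProduct.curry m) r x y)
  (fun r x y => LinearMap.map_smul (TensorProduct.curry m x) r y)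

/-- The identity map from `W` to the ring with the multiplication `m`. -/
def equiv : W ≃ₗ[K] h.Carrier := LinearEquiv.refl K W

lemma equiv_mul (x y : W) : h.equiv (m (x ⊗ₜ y)) = h.equiv x * h.equiv y := rfl

/-- The coaction as an algebra homomorphism. -/
def coactHom : h.Carrier →ₐ[K] h.Carrier ⊗[K] Boson K :=
  AlgHom.ofLinearMap (h.equiv.toLinearMap.rTensor (Boson K) ∘ₗ ρ ∘ₗ h.equiv.symm.toLinearMap)
    (by
      have := congrArg (h.equiv.toLinearMap.rTensor (Boson K)) h.exists_one.choose_spec.2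
      rw [LinearMap.rTensor_tmul] at this
      exact this)
    (fun x y => by
      obtain ⟨x, rfl⟩ := h.equiv.surjective x
      obtain ⟨y, rfl⟩ := h.equiv.surjective y
      have hx := congrArg (h.equiv.toLinearMap.rTensor (Boson K))
        (LinearMap.congr_fun h.map_mul (x ⊗ₜ y))
      simp only [LinearMap.comp_apply, LinearEquiv.coe_coe, TensorProduct.map_tmul] at hx
      simp only [LinearMap.comp_apply, LinearEquiv.coe_coe, ← equiv_mul,
        LinearEquiv.symm_apply_apply, hx]
      induction ρ x with
      | zero => simp
      | tmul a k =>
        induction ρ y with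
        | zero => simp
        | tmul b l => simp [equiv_mul]
        | add s t hs ht => simp only [map_add, TensorProduct.tmul_add, mul_add, hs, ht]
      | add s t hs ht => simp only [map_add, TensorProduct.add_tmul, add_mul, hs, ht])

lemma isStructIso : IsStructIso h.equiv m ρ (LinearMap.mul' K h.Carrier)
    h.coactHom.toLinearMap :=
  .of_apply (fun _ _ => rfl) fun _ => rfl

lemma isGaloisComodule (hb : Function.Bijective (canMap m ρ)) : IsGaloisComodule h.coactHom :=
  have h' := h.isStructIso.isComoduleAlgebra h
  ⟨h'.coassoc, h'.counit, h.isStructIso.canMap_bijective hb⟩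

end IsComoduleAlgebra

end Rings

section Realizations

variable {K : Type*} [Field K] [IsAlgClosed K]

/-- The exponent by which rescaling of a frame acts on the group element `w_g`. -/
def signExp (g : S3) : ℕ := if Equiv.Perm.sign g = 1 then 0 else 1

/-- Every frame of a Galois object is obtained from the standard frame of a member of the family by
an isomorphism and a rescaling. -/
lemma IsGaloisComodule.frame_normalForm {A : Type*} [Ring A] [Algebra K A] [FiniteDimensional K A]
    {ρ : A →ₐ[K] A ⊗[K] Boson K} (hρ : IsGaloisComodule ρ) (hA : Module.finrank K A = 72)
    {G : S3 → A} {w : Fin 3 → A} (hf : IsFrame (LinearMap.mul' K A) ρ.toLinearMap G w) :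
    ∃ (ν : K) (p : Fin 2 → K) (Φ : GalObj K p ≃ₗ[K] A), ν ≠ 0 ∧
      IsStructIso Φ (LinearMap.mul' K _) (GalObj.coact K p).toLinearMap (LinearMap.mul' K A)
        ρ.toLinearMap ∧
      (∀ g, G g = ν ^ signExp g • Φ (GalObj.grp K p g)) ∧
      ∀ i, w i = ν • Φ (GalObj.gen K p i) := by
  have : Nontrivial A := Module.nontrivial_of_finrank_pos (R := K) (by rw [hA]; norm_num)
  obtain ⟨v, hv0, hv, hvr⟩ := hf.c123_eq
  have h132 := hf.c132_eq
  have h23 := hf.s23_eq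
  have h13 := hf.s13_eq
  have hb := hf.b_eq
  have hc := hf.c_eq
  have h1 := (hf.one 1).1
  have hca := hf.conj_a
  simp only [LinearMap.mul'_apply, mul_one] at hvr h132 h23 h13 hb hc h1 hca
  obtain ⟨ν, p, Φ, hν, hcol, hs, hr, hx⟩ := hρ.exists_equiv hA hf.s12_ne_zero hf.coact_s12 hv0 hv
    hvr hf.coact_a hca
  have hur : IsUnit (Φ (GalObj.grp K p c123)) :=
    ((Group.isUnit c123).map (GalObj.grp K p)).map Φ
  have hconj := (GalObj.fkRelations K p).conj c123
  rw [show Equiv.Perm.sign c123 = 1 by decide] at hconj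
  simp only [Units.val_one, one_smul] at hconj
  refine ⟨ν, p, Φ.toLinearEquiv, hν, .of_apply (fun x y => by simp) hcol, ?_, ?_⟩
  · have key : ∀ g : S3, g = 1 ∨ g = c123 ∨ g = c123 * c123 ∨ g = s12 ∨ g = s23 ∨ g = s13 := by
      decide
    intro g
    rw [AlgEquiv.toLinearEquiv_apply]
    rcases key g with rfl | rfl | rfl | rfl | rfl | rfl
    · rw [h1, show signExp 1 = 0 by decide, pow_zero, one_smul, map_one, map_one]
    · rw [hr, show signExp c123 = 0 by decide, pow_zero, one_smul]
    · rw [h132, hr, show signExp (c123 * c123) = 0 by decide, pow_zero, one_smul, map_mul, map_mul]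
    · rw [show signExp s12 = 1 by decide, pow_one]
      exact hs
    · rw [h23, hs, hr, show signExp s23 = 1 by decide, pow_one, smul_mul_assoc, ← map_mul,
        ← map_mul, show s12 * c123 = s23 by decide]
    · rw [h13, h132, hs, hr, show signExp s13 = 1 by decide, pow_one, smul_mul_assoc, ← map_mul,
        ← map_mul, ← map_mul, ← map_mul, show s12 * (c123 * c123) = s13 by decide]
  · intro i
    rw [AlgEquiv.toLinearEquiv_apply]
    have h3 : ∀ i, i = FK3.ia ∨ i = FK3.ib ∨ i = FK3.ic := by decide
    rcases h3 i with rfl | rfl | rfl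
    · exact hx
    · refine hur.mul_left_injective ?_
      change _ * Φ (GalObj.grp K p c123) = _ * Φ (GalObj.grp K p c123)
      rw [smul_mul_assoc, ← map_mul, ← show c123 FK3.ia = FK3.ib by decide, ← hconj, map_mul,
        ← hr, show c123 FK3.ia = FK3.ib by decide, hb, hx, mul_smul_comm]
    · refine hur.mul_right_injective ?_
      change Φ (GalObj.grp K p c123) * _ = Φ (GalObj.grp K p c123) * _
      rw [mul_smul_comm, ← map_mul, hconj, show c123 FK3.ic = FK3.ia by decide, map_mul, ← hr, hc,
        hx, smul_mul_assoc]

variable (K) in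
lemma GalObj.isFrame (p : Fin 2 → K) : IsFrame (LinearMap.mul' K (GalObj K p))
    (GalObj.coact K p).toLinearMap (GalObj.grp K p) (GalObj.gen K p) := by
  have hconj : ∀ i, grp K p c123 * gen K p i = gen K p (c123 i) * grp K p c123 := fun i => by
    rw [(GalObj.fkRelations K p).conj c123, show Equiv.Perm.sign c123 = 1 by decide,
      Units.val_one, one_smul]
  refine ⟨fun x => by simp, ((Group.isUnit s12).map _).ne_zero, isNormalFrame.coact_grp _,
    ⟨grp K p s23, ((Group.isUnit s23).map _).ne_zero, isNormalFrame.coact_grp _, ?_⟩, ?_, ?_, ?_,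
    isNormalFrame.coact_gen FK3.ia, ?_, ?_, ?_⟩
  · simp only [LinearMap.mul'_apply, ← map_mul]
    exact congrArg _ (by decide)
  · rw [LinearMap.mul'_apply, map_mul]
  · rw [LinearMap.mul'_apply, ← map_mul]
    exact congrArg _ (by decide)
  · rw [LinearMap.mul'_apply, ← map_mul]
    exact congrArg _ (by decide)
  · rw [LinearMap.mul'_apply, LinearMap.mul'_apply, (fkRelations K p).conj s12,
      show Equiv.Perm.sign s12 = -1 by decide, show s12 FK3.ia = FK3.ia by decide, Units.val_neg,
      Units.val_one, neg_smul, one_smul]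
  · rw [LinearMap.mul'_apply, LinearMap.mul'_apply, hconj, show c123 FK3.ia = FK3.ib by decide]
  · rw [LinearMap.mul'_apply, LinearMap.mul'_apply, hconj, show c123 FK3.ic = FK3.ia by decide]

lemma GalObj.realizes (p : Fin 2 → K) : Realizes (LinearMap.mul' K (GalObj K p))
    (GalObj.coact K p).toLinearMap (p 0) (p 1) := by
  refine ⟨_, _, 1, p 0, p 1, GalObj.isFrame K p, one_ne_zero, ?_, ?_, ?_, (div_one _).symm,
    (div_one _).symm⟩
  · rw [LinearMap.mul'_apply, ← map_mul, one_smul]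
    exact congrArg _ (by decide)
  · rw [LinearMap.mul'_apply, (fkRelations K p).sq, map_one, Algebra.algebraMap_eq_smul_one]
  · simp only [LinearMap.mul'_apply]
    rw [(fkRelations K p).abc, map_one, Algebra.algebraMap_eq_smul_one]

variable {W : Type*} [AddCommGroup W] [Module K W] [FiniteDimensional K W]
  {m : W ⊗[K] W →ₗ[K] W} {ρ : W →ₗ[K] W ⊗[K] Boson K}

lemma IsComoduleAlgebra.frame_normalForm (h : IsComoduleAlgebra m ρ)
    (hb : Function.Bijective (canMap m ρ)) (hW : Module.finrank K W = 72)
    {G : S3 → W} {w : Fin 3 → W} (hf : IsFrame m ρ G w) :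
    ∃ (ν : K) (p : Fin 2 → K) (Φ : GalObj K p ≃ₗ[K] W), ν ≠ 0 ∧
      IsStructIso Φ (LinearMap.mul' K _) (GalObj.coact K p).toLinearMap m ρ ∧
      (∀ g, G g = ν ^ signExp g • Φ (GalObj.grp K p g)) ∧
      ∀ i, w i = ν • Φ (GalObj.gen K p i) := by
  have : FiniteDimensional K h.Carrier := Module.Finite.equiv h.equiv
  obtain ⟨ν, p, Φ, hν, hΦ, hG, hw⟩ := (h.isGaloisComodule hb).frame_normalForm
    (by rw [← h.equiv.finrank_eq, hW]) (h.isStructIso.isFrame hf)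
  refine ⟨ν, p, Φ.trans h.equiv.symm, hν, hΦ.trans h.isStructIso.symm, fun g => ?_, fun i => ?_⟩
  · rw [LinearEquiv.trans_apply, ← map_smul, LinearEquiv.eq_symm_apply]
    exact hG g
  · rw [LinearEquiv.trans_apply, ← map_smul, LinearEquiv.eq_symm_apply]
    exact hw i

/-- Every Galois object is isomorphic to a member of the family. -/
lemma IsComoduleAlgebra.exists_galObj [CharZero K] (h : IsComoduleAlgebra m ρ)
    (hb : Function.Bijective (canMap m ρ)) (hW : Module.finrank K W = 72) :
    ∃ (p : Fin 2 → K) (Φ : GalObj K p ≃ₗ[K] W),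
      IsStructIso Φ (LinearMap.mul' K _) (GalObj.coact K p).toLinearMap m ρ := by
  have : FiniteDimensional K h.Carrier := Module.Finite.equiv h.equiv
  have hA : Module.finrank K h.Carrier = 72 := by rw [← h.equiv.finrank_eq, hW]
  have : Nontrivial h.Carrier := Module.nontrivial_of_finrank_pos (R := K) (by rw [hA]; norm_num)
  have hρ := h.isGaloisComodule hb
  obtain ⟨s, v, r, x, hs0, hs, hv0, hv, hr, hx, hsx⟩ := hρ.exists_distinguished
  obtain ⟨ν, p, Φ, -, hcol, -⟩ := hρ.exists_equiv hA hs0 hs hv0 hv hr hx hsx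
  refine ⟨p, Φ.toLinearEquiv.trans h.equiv.symm, IsStructIso.trans (.of_apply (fun x y => ?_) hcol)
    h.isStructIso.symm⟩
  simp

lemma IsComoduleAlgebra.realizes_iff (h : IsComoduleAlgebra m ρ)
    (hb : Function.Bijective (canMap m ρ)) (hW : Module.finrank K W = 72) (p : Fin 2 → K) :
    Realizes m ρ (p 0) (p 1) ↔ ∃ Φ : GalObj K p ≃ₗ[K] W,
      IsStructIso Φ (LinearMap.mul' K _) (GalObj.coact K p).toLinearMap m ρ := by
  refine ⟨?_, fun ⟨Φ, hΦ⟩ => hΦ.realizes (GalObj.realizes p)⟩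
  rintro ⟨G, w, c₀, lam₀, mu₀, hf, hc₀, h1, h2, h3, h4, h5⟩
  obtain ⟨ν, q, Φ, hν, hΦ, hG, hw⟩ := h.frame_normalForm hb hW hf
  have hG1 : G 1 = Φ 1 := by
    rw [hG, show signExp 1 = 0 by decide, pow_zero, one_smul, map_one]
  have hinj : ∀ c d : K, c • Φ (1 : GalObj K q) = d • Φ 1 → c = d := fun c d hcd =>
    smul_left_injective K ((map_ne_zero_iff Φ Φ.injective).mpr one_ne_zero) hcd
  have hmul : ∀ x y : GalObj K q, m ((ν • Φ x) ⊗ₜ (ν • Φ y)) = (ν * ν) • Φ (x * y) := fun x y => by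
    rw [TensorProduct.smul_tmul_smul, map_smul, ← hΦ.map_mul, LinearMap.mul'_apply]
  rw [hG1, hG, show signExp s12 = 1 by decide, pow_one, hmul, ← _root_.map_mul,
    show s12 * s12 = 1 by decide, map_one] at h1
  have hc := hinj _ _ h1
  rw [hG1, hw, hmul, (GalObj.fkRelations K q).sq, Algebra.algebraMap_eq_smul_one, map_smul,
    smul_smul] at h2
  have hl := hinj _ _ h2
  rw [hG1, hw, hw, hw, hmul, hmul, hmul, ← smul_add, ← smul_add, ← map_add, ← map_add,
    (GalObj.fkRelations K q).abc, Algebra.algebraMap_eq_smul_one, map_smul, smul_smul] at h3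
  have hm := hinj _ _ h3
  have hpq : p = q := by
    funext i
    have hνν : ν * ν ≠ 0 := mul_ne_zero hν hν
    fin_cases i
    · change p 0 = q 0
      rw [h4, ← hl, ← hc, mul_div_cancel_left₀ _ hνν]
    · change p 1 = q 1
      rw [h5, ← hm, ← hc, mul_div_cancel_left₀ _ hνν]
  subst hpq
  exact ⟨Φ, hΦ⟩

end Realizations

/-! ### Cocycles and their deformations -/

section Convolution

variable {K C V : Type*} [Field K] [AddCommGroup C] [Module K C] [Coalgebra K C]
  [AddCommGroup V] [Module K V]

lemma slice_assoc {V L P : Type*} [AddCommGroup V] [Module K V] [AddCommGroup L] [Module K L]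
    [AddCommGroup P] [Module K P] (f : V →ₗ[K] K) (t : (V ⊗[K] L) ⊗[K] P) :
    slice f (TensorProduct.assoc K V L P t) = (slice f).rTensor P t := by
  induction t with
  | zero => simp
  | tmul s c =>
    induction s with
    | zero => simp
    | tmul a b => simp [TensorProduct.smul_tmul']
    | add s t hs ht => simp only [TensorProduct.add_tmul, map_add, hs, ht]
  | add s t hs ht => simp only [map_add, hs, ht]

lemma slice_lTensor {V L P : Type*} [AddCommGroup V] [Module K V] [AddCommGroup L] [Module K L]
    [AddCommGroup P] [Module K P] (f : V →ₗ[K] K) (g : L →ₗ[K] P) (t : V ⊗[K] L) :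
    slice f (g.lTensor V t) = g (slice f t) := by
  induction t with
  | zero => simp
  | tmul a b => simp
  | add s t hs ht => simp only [map_add, hs, ht]

lemma slice_rTensor {V L P : Type*} [AddCommGroup V] [Module K V] [AddCommGroup L] [Module K L]
    [AddCommGroup P] [Module K P] (f : P →ₗ[K] K) (g : V →ₗ[K] P) (t : V ⊗[K] L) :
    slice f (g.rTensor L t) = slice (f ∘ₗ g) t := by
  induction t with
  | zero => simp
  | tmul a b => simp
  | add s t hs ht => simp only [map_add, hs, ht]

/-- The map `x ↦ f(x₀) x₁` is colinear. -/
lemma coMap_colinear {ρ : V →ₗ[K] V ⊗[K] C}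
    (hρ : (TensorProduct.assoc K V C C).toLinearMap ∘ₗ ρ.rTensor C ∘ₗ ρ
      = (Coalgebra.comul (R := K) (A := C)).lTensor V ∘ₗ ρ) (f : V →ₗ[K] K) (x : V) :
    Coalgebra.comul (R := K) (coMap ρ f x) = (coMap ρ f).rTensor C (ρ x) := by
  have h := congrArg (slice f) (LinearMap.congr_fun hρ x)
  simp only [LinearMap.comp_apply, LinearEquiv.coe_coe, slice_assoc, slice_lTensor] at h
  rw [coMap, LinearMap.comp_apply, ← h, LinearMap.rTensor_comp, LinearMap.comp_apply]

lemma comul_coMap (f : C →ₗ[K] K) (x : C) :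
    Coalgebra.comul (R := K) (coMap Coalgebra.comul f x)
      = (coMap Coalgebra.comul f).rTensor C (Coalgebra.comul x) :=
  coMap_colinear Coalgebra.coassoc f x

lemma counit_coMap (f : C →ₗ[K] K) :
    Coalgebra.counit (R := K) ∘ₗ coMap Coalgebra.comul f = f := by
  refine LinearMap.ext fun x => ?_
  have h := congrArg (fun t => f (TensorProduct.rid K C t))
    (Coalgebra.lTensor_counit_comul (R := K) x)
  simp only [TensorProduct.rid_tmul, one_smul] at h
  rw [← h, coMap, LinearMap.comp_apply, LinearMap.comp_apply]
  induction (Coalgebra.comul (R := K) x : C ⊗[K] C) with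
  | zero => simp
  | tmul a b => simp [mul_comm]
  | add s t hs ht => simp only [map_add, hs, ht]

lemma coMap_counit : coMap Coalgebra.comul (Coalgebra.counit (R := K) (A := C)) = LinearMap.id := by
  refine LinearMap.ext fun x => ?_
  rw [coMap, LinearMap.comp_apply, slice, LinearMap.comp_apply, Coalgebra.rTensor_counit_comul]
  simp

lemma coMap_comp (f g : C →ₗ[K] K) (x : C) :
    coMap Coalgebra.comul g (coMap Coalgebra.comul f x)
      = coMap Coalgebra.comul (g ∘ₗ coMap Coalgebra.comul f) x := by
  conv_lhs => rw [coMap, LinearMap.comp_apply, comul_coMap, slice_rTensor]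
  rfl

/-- Convolution of linear forms corresponds to composition of the maps `x ↦ f(x₁) x₂`. -/
lemma convMul_eq (f g : C →ₗ[K] K) :
    WithConv.toConv f * WithConv.toConv g = WithConv.toConv (g ∘ₗ coMap Coalgebra.comul f) := by
  rw [LinearMap.convMul_def]
  congr 1
  refine LinearMap.ext fun x => ?_
  rw [coMap, LinearMap.comp_apply, LinearMap.comp_apply, LinearMap.comp_apply,
    LinearMap.comp_apply]
  induction (Coalgebra.comul (R := K) x : C ⊗[K] C) with
  | zero => simp
  | tmul a b => simp
  | add s t hs ht => simp only [map_add, hs, ht]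

lemma convOne_eq : (1 : WithConv (C →ₗ[K] K)) = WithConv.toConv (Coalgebra.counit (R := K)) := rfl

/-- A linear form is convolution invertible if and only if `x ↦ f(x₁) x₂` is bijective. -/
lemma isUnit_toConv_iff (f : C →ₗ[K] K) :
    IsUnit (WithConv.toConv f) ↔ Function.Bijective (coMap Coalgebra.comul f) := by
  constructor
  · intro h
    obtain ⟨g, h1, h2⟩ := isUnit_iff_exists.mp h
    obtain ⟨g, rfl⟩ : ∃ g', g = WithConv.toConv g' := ⟨g.ofConv, rfl⟩
    rw [convMul_eq, convOne_eq] at h1 h2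
    have h1' := WithConv.toConv_injective h1
    have h2' := WithConv.toConv_injective h2
    refine Function.bijective_iff_has_inverse.mpr
      ⟨coMap Coalgebra.comul g, fun x => ?_, fun x => ?_⟩
    · rw [coMap_comp, h1', coMap_counit, LinearMap.id_apply]
    · rw [coMap_comp, h2', coMap_counit, LinearMap.id_apply]
  · intro h
    let e := LinearEquiv.ofBijective _ h
    obtain ⟨g, hg⟩ : ∃ g, g = Coalgebra.counit (R := K) ∘ₗ e.symm.toLinearMap := ⟨_, rfl⟩
    have h1 : g ∘ₗ coMap Coalgebra.comul f = Coalgebra.counit (R := K) := by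
      refine LinearMap.ext fun x => ?_
      rw [hg, LinearMap.comp_apply, LinearMap.comp_apply]
      exact congrArg _ (e.symm_apply_apply x)
    have h2 : f ∘ₗ coMap Coalgebra.comul g = Coalgebra.counit (R := K) := by
      have h3 : ∀ x, coMap Coalgebra.comul f (coMap Coalgebra.comul g x) = x := by
        intro x
        obtain ⟨x, rfl⟩ := h.2 x
        rw [coMap_comp f g x, h1, coMap_counit, LinearMap.id_apply]
      rw [← counit_coMap (f ∘ₗ coMap Coalgebra.comul g)]
      refine LinearMap.ext fun x => ?_
      rw [LinearMap.comp_apply, ← coMap_comp, h3]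
    exact isUnit_iff_exists.mpr ⟨WithConv.toConv g, by rw [convMul_eq, h1]; rfl,
      by rw [convMul_eq, h2]; rfl⟩

end Convolution

section Deformations

variable {K H : Type*} [Field K] [Ring H] [Bialgebra K H]

/-- The product `x ⊗ y ↦ f(x₁, y₁) x₂ y₂` for a linear form `f`. -/
def deformedMul (f : H ⊗[K] H →ₗ[K] K) : H ⊗[K] H →ₗ[K] H :=
  LinearMap.mul' K H ∘ₗ coMap Coalgebra.comul f

lemma lid_map_eq_slice (f : H ⊗[K] H →ₗ[K] K) (t : (H ⊗[K] H) ⊗[K] (H ⊗[K] H)) :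
    TensorProduct.lid K H (TensorProduct.map f (LinearMap.mul' K H) t)
      = LinearMap.mul' K H (slice f t) := by
  induction t with
  | zero => simp
  | tmul a b => simp
  | add s t hs ht => simp only [map_add, hs, ht]

lemma TwoCocycle.mul_eq (α : TwoCocycle K H) : α.mul = deformedMul α.form :=
  LinearMap.ext fun _ => lid_map_eq_slice _ _

lemma comul_mul' (t : H ⊗[K] H) : Coalgebra.comul (R := K) (LinearMap.mul' K H t)
    = TensorProduct.map (LinearMap.mul' K H) (LinearMap.mul' K H) (Coalgebra.comul t) := by
  induction t with
  | zero => simp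
  | tmul x y =>
    rw [LinearMap.mul'_apply, Bialgebra.comul_mul, TensorProduct.comul_tmul]
    exact (mul'_tensorTensorTensorComm _ _).symm
  | add s t hs ht => simp only [map_add, hs, ht]

lemma comul_deformedMul (f : H ⊗[K] H →ₗ[K] K) (t : H ⊗[K] H) :
    Coalgebra.comul (R := K) (deformedMul f t)
      = TensorProduct.map (deformedMul f) (LinearMap.mul' K H) (Coalgebra.comul t) := by
  rw [deformedMul, LinearMap.comp_apply, comul_mul', comul_coMap, ← LinearMap.comp_apply,
    LinearMap.map_comp_rTensor]

open Coalgebra in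
lemma coMap_tmul (f : H ⊗[K] H →ₗ[K] K) {ι : Type*} {x : H} (R : Repr K x ι) (y : H) :
    coMap comul f (x ⊗ₜ y) = ∑ i ∈ R.index,
      R.right i ⊗ₜ[K] coMap comul (f ∘ₗ TensorProduct.mk K H H (R.left i)) y := by
  rw [coMap, LinearMap.comp_apply, TensorProduct.comul_tmul, ← R.eq, TensorProduct.sum_tmul,
    map_sum, map_sum]
  refine Finset.sum_congr rfl fun i _ => ?_
  rw [coMap, LinearMap.comp_apply]
  induction (comul (R := K) y : H ⊗[K] H) with
  | zero => simp
  | tmul a b => simp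
  | add s t hs ht => simp only [map_add, TensorProduct.tmul_add, hs, ht]

/-- The canonical map of a deformation is the canonical map of `H` after `z ↦ f(z₁) z₂`. -/
lemma canMap_deformedMul (f : H ⊗[K] H →ₗ[K] K) :
    canMap (deformedMul f) (Coalgebra.comul (R := K) (A := H))
      = canMap (LinearMap.mul' K H) Coalgebra.comul ∘ₗ coMap Coalgebra.comul f := by
  refine TensorProduct.ext' fun x y => ?_
  let R := Coalgebra.Repr.arbitrary K x
  have e : ∀ u : H ⊗[K] H, (coMap Coalgebra.comul f).rTensor H
      ((TensorProduct.assoc K H H H).symm (x ⊗ₜ u)) = ∑ i ∈ R.index,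
        (TensorProduct.assoc K H H H).symm (R.right i ⊗ₜ[K]
          (coMap Coalgebra.comul (f ∘ₗ TensorProduct.mk K H H (R.left i))).rTensor H u) := by
    intro u
    induction u with
    | zero => simp
    | tmul a b => simp [coMap_tmul f R, TensorProduct.sum_tmul]
    | add s t hs ht =>
      simp only [TensorProduct.tmul_add, map_add, hs, ht, Finset.sum_add_distrib]
  rw [canMap, canMap, deformedMul, LinearMap.rTensor_comp]
  simp only [LinearMap.comp_apply, LinearMap.lTensor_tmul, LinearEquiv.coe_coe]
  rw [e, coMap_tmul f R]
  simp only [map_sum, LinearMap.lTensor_tmul, comul_coMap]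

open Coalgebra in
lemma deformedMul_tmul (f : H ⊗[K] H →ₗ[K] K) {ι κ : Type*} {x y : H} (R : Repr K x ι)
    (S : Repr K y κ) : deformedMul f (x ⊗ₜ y) = ∑ i ∈ R.index, ∑ j ∈ S.index,
      f (R.left i ⊗ₜ S.left j) • (R.right i * S.right j) := by
  rw [deformedMul, LinearMap.comp_apply, coMap_tmul f R, map_sum]
  refine Finset.sum_congr rfl fun i _ => ?_
  rw [coMap, LinearMap.comp_apply, ← S.eq]
  simp [Finset.mul_sum]

/-- The cocycle identity implies the associativity of the deformed product, because the
comultiplication is multiplicative from the deformed product to the tensor product of the deformed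
and the original product. -/
lemma deformedMul_assoc {f : H ⊗[K] H →ₗ[K] K}
    (hf : ∀ x y z, f (deformedMul f (x ⊗ₜ y) ⊗ₜ z) = f (x ⊗ₜ deformedMul f (y ⊗ₜ z))) (x y z : H) :
    deformedMul f (deformedMul f (x ⊗ₜ y) ⊗ₜ z) = deformedMul f (x ⊗ₜ deformedMul f (y ⊗ₜ z)) := by
  let R := Coalgebra.Repr.arbitrary K x
  let S := Coalgebra.Repr.arbitrary K y
  let T := Coalgebra.Repr.arbitrary K z
  have key : ∀ a b : H, deformedMul f (a ⊗ₜ b) = LinearMap.mul' K H (slice f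
      (TensorProduct.tensorTensorTensorComm K H H H H
        (Coalgebra.comul a ⊗ₜ Coalgebra.comul b))) := fun _ _ => rfl
  have hΔ : ∀ a b : H, Coalgebra.comul (R := K) (deformedMul f (a ⊗ₜ b))
      = TensorProduct.map (deformedMul f) (LinearMap.mul' K H)
        (TensorProduct.tensorTensorTensorComm K H H H H
          (Coalgebra.comul a ⊗ₜ Coalgebra.comul b)) := fun a b => comul_deformedMul f _
  rw [key (deformedMul f (x ⊗ₜ y)) z, key x (deformedMul f (y ⊗ₜ z)), hΔ, hΔ, ← R.eq, ← S.eq,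
    ← T.eq]
  simp only [TensorProduct.sum_tmul, TensorProduct.tmul_sum, map_sum,
    TensorProduct.tensorTensorTensorComm_tmul, TensorProduct.map_tmul, slice_tmul, map_smul,
    LinearMap.mul'_apply, hf, mul_assoc]

end Deformations

section Cocycles

variable {K H : Type*} [Field K] [Ring H] [Bialgebra K H]

lemma TwoCocycle.mul_assoc' (α : TwoCocycle K H) (x y z : H) :
    α.mul (α.mul (x ⊗ₜ y) ⊗ₜ z) = α.mul (x ⊗ₜ α.mul (y ⊗ₜ z)) := by
  have h : ∀ x y z, α.form (α.mul (x ⊗ₜ y) ⊗ₜ z) = α.form (x ⊗ₜ α.mul (y ⊗ₜ z)) := α.cocycle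
  rw [α.mul_eq] at h ⊢
  exact deformedMul_assoc h x y z

open Coalgebra in
lemma TwoCocycle.one_mul' (α : TwoCocycle K H) (x : H) : α.mul (1 ⊗ₜ x) = x := by
  let R : Repr K (1 : H) Unit := ⟨Finset.univ, fun _ => 1, fun _ => 1,
    by simp [Algebra.TensorProduct.one_def]⟩
  let S := Repr.arbitrary K x
  rw [α.mul_eq, deformedMul_tmul _ R S]
  simp only [R, Finset.univ_unique, Finset.sum_singleton, α.one_left, one_mul]
  exact sum_counit_smul S

open Coalgebra in
lemma TwoCocycle.mul_one' (α : TwoCocycle K H) (x : H) : α.mul (x ⊗ₜ 1) = x := by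
  let R : Repr K (1 : H) Unit := ⟨Finset.univ, fun _ => 1, fun _ => 1,
    by simp [Algebra.TensorProduct.one_def]⟩
  let S := Repr.arbitrary K x
  rw [α.mul_eq, deformedMul_tmul _ S R]
  simp only [R, Finset.univ_unique, Finset.sum_singleton, α.one_right, mul_one]
  exact sum_counit_smul S

/-- A cocycle deformation is a comodule algebra. -/
lemma TwoCocycle.isComoduleAlgebra (α : TwoCocycle K H) :
    IsComoduleAlgebra α.mul (Coalgebra.comul (R := K) (A := H)) where
  assoc := α.mul_assoc'
  exists_one := ⟨1, fun x => ⟨α.one_mul' x, α.mul_one' x⟩, Bialgebra.comul_one⟩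
  coassoc := Coalgebra.coassoc
  counit := LinearMap.ext fun x => by
    simp [Coalgebra.lTensor_counit_comul]
  map_mul := by
    rw [α.mul_eq]
    exact LinearMap.ext fun t => comul_deformedMul α.form t

/-- A comodule algebra structure on the regular comodule whose canonical map is bijective is given
by a cocycle, provided that the canonical map of `H` itself is bijective. -/
lemma exists_twoCocycle
    (hH : Function.Bijective (canMap (LinearMap.mul' K H) (Coalgebra.comul (R := K) (A := H))))
    {m : H ⊗[K] H →ₗ[K] H} (hm : IsComoduleAlgebra m (Coalgebra.comul (R := K) (A := H)))
    (hb : Function.Bijective (canMap m (Coalgebra.comul (R := K) (A := H))))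
    (h1 : ∀ x, m (1 ⊗ₜ x) = x ∧ m (x ⊗ₜ 1) = x) : ∃ α : TwoCocycle K H, α.mul = m := by
  -- the cocycle is the composition of the multiplication with the counit
  obtain ⟨f, hf⟩ : ∃ f, f = Coalgebra.counit (R := K) ∘ₗ m := ⟨_, rfl⟩
  have hfm : deformedMul f = m := by
    refine LinearMap.ext fun t => ?_
    have e := LinearMap.congr_fun hm.map_mul t
    have e' : Coalgebra.comul (R := K) (m t)
      = TensorProduct.map m (LinearMap.mul' K H) (Coalgebra.comul t) := e
    have h2 := congrArg (TensorProduct.lid K H) (Coalgebra.rTensor_counit_comul (R := K) (m t))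
    rw [TensorProduct.lid_tmul, one_smul] at h2
    have h3 : ∀ u, TensorProduct.map f (LinearMap.mul' K H) u
        = (Coalgebra.counit (R := K) (A := H)).rTensor H
          (TensorProduct.map m (LinearMap.mul' K H) u) := fun u => by
      rw [hf, ← LinearMap.rTensor_comp_map, LinearMap.comp_apply]
    rw [← h2, e', ← h3, lid_map_eq_slice]
    rfl
  have hfun : (fun t : H ⊗[K] H => TensorProduct.lid K H (TensorProduct.map f (LinearMap.mul' K H)
      (Coalgebra.comul (R := K) t))) = m := by
    rw [← hfm]
    exact funext fun t => lid_map_eq_slice f _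
  have hfun' : ∀ t : H ⊗[K] H, TensorProduct.lid K H (TensorProduct.map f (LinearMap.mul' K H)
      (Coalgebra.comul (R := K) t)) = m t := fun t => congrFun hfun t
  have hu : IsUnit (WithConv.toConv f) := by
    rw [isUnit_toConv_iff]
    have e := canMap_deformedMul f
    rw [hfm] at e
    have e' : ⇑(canMap m (Coalgebra.comul (R := K) (A := H)))
      = ⇑(canMap (LinearMap.mul' K H) (Coalgebra.comul (R := K) (A := H)))
        ∘ ⇑(coMap Coalgebra.comul f) := funext fun t => LinearMap.congr_fun e t
    rw [e'] at hb
    exact (Function.Bijective.of_comp_iff' hH _).mp hb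
  refine ⟨⟨f, hu, fun x y z => ?_, fun x => ?_, fun x => ?_⟩, ?_⟩
  · rw [hfun', hfun', hf, LinearMap.comp_apply, LinearMap.comp_apply, hm.assoc]
  · rw [hf, LinearMap.comp_apply, (h1 x).1]
  · rw [hf, LinearMap.comp_apply, (h1 x).2]
  · rw [TwoCocycle.mul_eq, hfm]

variable (K) in
lemma Boson.canMap_bijective : Function.Bijective
    (canMap (LinearMap.mul' K (Boson K)) (Coalgebra.comul (R := K) (A := Boson K))) :=
  canMap_bijective_of_surjective rfl Boson.isNormalFrame.canMap_surjective

lemma TwoCocycle.canMap_bijective (α : TwoCocycle K (Boson K)) :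
    Function.Bijective (canMap α.mul (Coalgebra.comul (R := K) (A := Boson K))) := by
  rw [α.mul_eq, canMap_deformedMul]
  exact (Boson.canMap_bijective K).comp ((isUnit_toConv_iff α.form).mp α.isUnit_conv)

/-- Every member of the family is a cocycle deformation of `H`. -/
lemma GalObj.exists_twoCocycle [IsAlgClosed K] (p : Fin 2 → K) :
    ∃ (α : TwoCocycle K (Boson K)) (Φ : GalObj K p ≃ₗ[K] Boson K),
      IsStructIso Φ (LinearMap.mul' K _) (GalObj.coact K p).toLinearMap α.mul
        (Coalgebra.comul (R := K) (A := Boson K)) := by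
  have hg := GalObj.isGalois K p
  -- the Galois object is cleft: a linear form with value `1` on the group elements gives an
  -- isomorphism of comodules with `H`
  let ψ : GalObj K p ≃ₗ[K] Boson K := LinearEquiv.ofBijective _
    (GalObj.coMap_bijective K p (GalObj.form K p) fun g => by
      rw [GalObj.form_grp]; exact one_ne_zero)
  have hψ1 : ψ 1 = 1 := by
    have : ψ 1 = coMap (GalObj.coact K p).toLinearMap (GalObj.form K p) (GalObj.grp K p 1) := by
      rw [map_one (GalObj.grp K p)]
      rfl
    rw [this, GalObj.isNormalFrame.coMap_grp, GalObj.form_grp, one_smul, map_one]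
  have hψ : IsStructIso ψ (LinearMap.mul' K _) (GalObj.coact K p).toLinearMap
      (ψ.toLinearMap ∘ₗ LinearMap.mul' K _ ∘ₗ
        TensorProduct.map ψ.symm.toLinearMap ψ.symm.toLinearMap)
      (Coalgebra.comul (R := K) (A := Boson K)) :=
    .of_apply (fun x y => by simp) fun x => coMap_colinear hg.coassoc (GalObj.form K p) x
  obtain ⟨α, hα⟩ := _root_.exists_twoCocycle (Boson.canMap_bijective K)
    (hψ.isComoduleAlgebra hg.isComoduleAlgebra) (hψ.canMap_bijective hg.bijective) (fun x => by
      have e : ψ.symm 1 = 1 := by rw [LinearEquiv.symm_apply_eq, hψ1]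
      simp [e])
  exact ⟨α, ψ, hα ▸ hψ⟩

end Cocycles

/-! ### Regular maps and the regularity of the parameters -/

section RegularMaps

variable {K Y V V' V'' : Type*} [Field K] [AddCommGroup V] [Module K V] [AddCommGroup V']
  [Module K V'] [AddCommGroup V''] [Module K V'']

/-- The map `F` from `Y` to a vector space is regular with respect to the ring `R` of functions on
`Y`: its composition with every linear form is in `R`. -/
def RegularMap (R : Subalgebra K (Y → K)) (F : Y → V) : Prop :=
  ∀ φ : Module.Dual K V, (fun y => φ (F y)) ∈ R

namespace RegularMap

variable {R : Subalgebra K (Y → K)} {F : Y → V} {F' : Y → V'}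

protected lemma const (v : V) : RegularMap R fun _ => v := fun φ => R.algebraMap_mem (φ v)

lemma map (h : RegularMap R F) (L : V →ₗ[K] V') : RegularMap R fun y => L (F y) :=
  fun φ => h (φ ∘ₗ L)

lemma add {F₂ : Y → V} (h : RegularMap R F) (h₂ : RegularMap R F₂) :
    RegularMap R fun y => F y + F₂ y := fun φ => by
  simp only [map_add]
  exact R.add_mem (h φ) (h₂ φ)

/-- A bilinear map of regular maps is regular, as one sees by expanding the first argument in a
basis. -/
lemma map₂ [FiniteDimensional K V] (h : RegularMap R F) (h' : RegularMap R F')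
    (B : V →ₗ[K] V' →ₗ[K] V'') : RegularMap R fun y => B (F y) (F' y) := fun φ => by
  let b := Module.finBasis K V
  have e : (fun y => φ (B (F y) (F' y)))
      = ∑ i, (fun y => b.coord i (F y)) * fun y => (φ ∘ₗ B (b i)) (F' y) := by
    funext y
    rw [Finset.sum_apply]
    conv_lhs => rw [← b.sum_repr (F y), map_sum, LinearMap.sum_apply, map_sum]
    refine Finset.sum_congr rfl fun i _ => ?_
    rw [map_smul, LinearMap.smul_apply, map_smul, smul_eq_mul]
    rfl
  rw [e]
  exact R.sum_mem fun i _ => R.mul_mem (h _) (h' _)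

lemma apply [FiniteDimensional K V] {L : Y → V →ₗ[K] V'} (h : RegularMap R L)
    (h' : RegularMap R F) : RegularMap R fun y => L y (F y) :=
  h'.map₂ h LinearMap.id.flip

lemma tmul [FiniteDimensional K V] (h : RegularMap R F) (h' : RegularMap R F') :
    RegularMap R fun y => F y ⊗ₜ[K] F' y := h.map₂ h' (TensorProduct.mk K V V')

lemma of_coordRing {Y : Set V} : RegularMap (K := K) (coordRing Y) fun y : Y => y.1 :=
  fun φ => Algebra.subset_adjoin ⟨φ, rfl⟩

end RegularMap

end RegularMaps

section Parameters

variable {K W : Type*} [Field K] [AddCommGroup W] [Module K W]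

/-- The value at `1 ⊗ h` of the inverse `T` of the canonical map.  The unit element is recovered
from `T(x ⊗ 1) = x ⊗ 1`, with a vector `x` and a linear form `f` such that `f x = 1`. -/
def translation (T : W ⊗[K] Boson K →ₗ[K] W ⊗[K] W) (x : W) (f : W →ₗ[K] K) (h : Boson K) :
    W ⊗[K] W := T (slice f (T (x ⊗ₜ 1)) ⊗ₜ h)

/-- For `T(1 ⊗ h) = h' ⊗ h''` with `h` the generator `i`, the product `h'' h'`.  It is equal to
`-2 w_s⁻¹ w_i`, where `s` is the degree of `w_i`, and it is invariant under rescaling. -/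
def invariantGen (m : W ⊗[K] W →ₗ[K] W) (T : W ⊗[K] Boson K →ₗ[K] W ⊗[K] W) (x : W)
    (f : W →ₗ[K] K) (i : Fin 3) : W :=
  m (TensorProduct.comm K W W (translation T x f (Boson.X K i)))

/-- The product `g' h' g'' h''`, where `T(1 ⊗ g) = g' ⊗ g''` and `T(1 ⊗ h) = h' ⊗ h''`.  It is the
commutator of `w_g⁻¹` and `w_h⁻¹`. -/
def translationCommutator (m : W ⊗[K] W →ₗ[K] W) (T : W ⊗[K] Boson K →ₗ[K] W ⊗[K] W) (x : W)
    (f : W →ₗ[K] K) (g h : S3) : W :=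
  m (TensorProduct.map m m (TensorProduct.tensorTensorTensorComm K W W W W
    (translation T x f (Boson.grp K g) ⊗ₜ translation T x f (Boson.grp K h))))

/-- The parameters of a Galois object as polynomials in its structure constants.  If `u_i` are the
invariant generators, then `u_a² = -4 λ`, and `u_c u_b + u_a u_c + u_b u_a` is `-4 μ` times the
inverse of a commutator of group elements.  The scalars are read off from their product with a
vector `x` by means of a linear form `f` with `f x = 1`. -/
def param (m : W ⊗[K] W →ₗ[K] W) (T : W ⊗[K] Boson K →ₗ[K] W ⊗[K] W) (x : W) (f : W →ₗ[K] K) :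
    Fin 2 → K :=
  let u := invariantGen m T x f
  ![-4⁻¹ * f (m (m (u FK3.ia ⊗ₜ u FK3.ia) ⊗ₜ x)),
    -4⁻¹ * f (m (m (translationCommutator m T x f (FK3.deg FK3.ic) (FK3.deg FK3.ib) ⊗ₜ
      (m (u FK3.ic ⊗ₜ u FK3.ib) + m (u FK3.ia ⊗ₜ u FK3.ic) + m (u FK3.ib ⊗ₜ u FK3.ia))) ⊗ₜ x))]

lemma param_mem_coordRing [FiniteDimensional K W] (Y : Set (AffSp K (Boson K) W)) (x : W)
    (f : W →ₗ[K] K) (i : Fin 2) :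
    (fun y : Y => param y.1.1 y.1.2.1 x f i) ∈ coordRing Y := by
  have hY : RegularMap (coordRing (K := K) Y) fun y : Y => y.1 := .of_coordRing
  have hm : RegularMap (coordRing Y) fun y : Y => y.1.1 := hY.map (LinearMap.fst K _ _)
  have hT : RegularMap (coordRing Y) fun y : Y => y.1.2.1 :=
    hY.map (LinearMap.fst K _ _ ∘ₗ LinearMap.snd K _ _)
  have ht : ∀ h, RegularMap (coordRing Y) fun y : Y => translation y.1.2.1 x f h := fun h =>
    hT.apply (((hT.apply (.const _)).map (slice f)).tmul (.const h))
  have hu : ∀ i, RegularMap (coordRing Y) fun y : Y => invariantGen y.1.1 y.1.2.1 x f i := fun i =>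
    hm.apply ((ht _).map (TensorProduct.comm K W W).toLinearMap)
  have hmm : ∀ {F F' : Y → W}, RegularMap (coordRing Y) F → RegularMap (coordRing Y) F' →
      RegularMap (coordRing Y) fun y : Y => y.1.1 (F y ⊗ₜ F' y) := fun h h' => hm.apply (h.tmul h')
  have hc : ∀ g h, RegularMap (coordRing Y) fun y : Y =>
      translationCommutator y.1.1 y.1.2.1 x f g h := fun g h =>
    hm.apply ((hm.map₂ hm
      (TensorProduct.mapBilinear (RingHom.id K) (W ⊗[K] W) (W ⊗[K] W) W W)).apply
      (((ht _).tmul (ht _)).map (TensorProduct.tensorTensorTensorComm K W W W W).toLinearMap))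
  fin_cases i
  · exact ((hmm (hmm (hu _) (hu _)) (.const x)).map f) ((-4⁻¹ : K) • LinearMap.id)
  · exact ((hmm (hmm (hc _ _) (((hmm (hu _) (hu _)).add (hmm (hu _) (hu _))).add
      (hmm (hu _) (hu _)))) (.const x)).map f) ((-4⁻¹ : K) • LinearMap.id)

/-- The inverse of the canonical map is compatible with isomorphisms. -/
lemma IsStructIso.inverse_apply {W' H : Type*} [AddCommGroup W'] [Module K W'] [Ring H]
    [Bialgebra K H] {g : W ≃ₗ[K] W'} {m : W ⊗[K] W →ₗ[K] W} {ρ : W →ₗ[K] W ⊗[K] H}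
    {m' : W' ⊗[K] W' →ₗ[K] W'} {ρ' : W' →ₗ[K] W' ⊗[K] H} (h : IsStructIso g m ρ m' ρ')
    {T : W' ⊗[K] H →ₗ[K] W' ⊗[K] W'} (hT : T ∘ₗ canMap m' ρ' = LinearMap.id) {t : W ⊗[K] W}
    {x : W} {k : H} (ht : canMap m ρ t = x ⊗ₜ k) :
    T (g x ⊗ₜ k) = TensorProduct.map g.toLinearMap g.toLinearMap t := by
  have e := LinearMap.congr_fun h.canMap_comp t
  rw [LinearMap.comp_apply, LinearMap.comp_apply, ht, LinearMap.rTensor_tmul] at e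
  rw [← LinearEquiv.coe_coe, ← e]
  exact LinearMap.congr_fun hT _

/-- The polynomials `param` compute the parameters, in terms of the standard generators. -/
lemma param_eq [CharZero K] {p : Fin 2 → K} {Φ : GalObj K p ≃ₗ[K] W} {m : W ⊗[K] W →ₗ[K] W}
    {ρ : W →ₗ[K] W ⊗[K] Boson K} (h : IsStructIso Φ (LinearMap.mul' K _)
      (GalObj.coact K p).toLinearMap m ρ) {T : W ⊗[K] Boson K →ₗ[K] W ⊗[K] W}
    (hT : T ∘ₗ canMap m ρ = LinearMap.id) {x : W} {f : W →ₗ[K] K} (hf : f x = 1) :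
    param m T x f = p := by
  have hF := GalObj.isNormalFrame (K := K) (p := p)
  obtain ⟨x, rfl⟩ := Φ.surjective x
  have hone : slice f (T (Φ x ⊗ₜ 1)) = Φ 1 := by
    rw [h.inverse_apply hT (IsNormalFrame.canMap_one x), TensorProduct.map_tmul, slice_tmul,
      LinearEquiv.coe_coe, hf, one_smul]
  have hgrp : ∀ g, translation T (Φ x) f (Boson.grp K g)
      = Φ (GalObj.grp K p g⁻¹) ⊗ₜ Φ (GalObj.grp K p g) := fun g => by
    rw [translation, hone, h.inverse_apply hT
      (t := GalObj.grp K p g⁻¹ ⊗ₜ GalObj.grp K p g), TensorProduct.map_tmul]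
    · rfl
    · rw [canMap_mul'_tmul, AlgHom.toLinearMap_apply, hF.coact_grp,
        Algebra.TensorProduct.tmul_mul_tmul, one_mul, IsNormalFrame.inv_mul_grp]
  have hmul : ∀ y z, m (Φ y ⊗ₜ Φ z) = Φ (y * z) := fun y z => (h.map_mul y z).symm
  have hsw : ∀ i, GalObj.grp K p (FK3.deg i) * GalObj.gen K p i
      = -(GalObj.gen K p i * GalObj.grp K p (FK3.deg i)) := fun i => by
    rw [hF.rel.conj, show Equiv.Perm.sign (FK3.deg i) = -1 by revert i; decide,
      show FK3.deg i i = i by revert i; decide, Units.val_neg, Units.val_one, neg_smul, one_smul]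
  have hgen : ∀ i, invariantGen m T (Φ x) f i
      = (2 : K) • Φ (GalObj.gen K p i * GalObj.grp K p (FK3.deg i)) := fun i => by
    rw [invariantGen, translation, hone, h.inverse_apply hT
      (t := GalObj.grp K p (FK3.deg i) ⊗ₜ GalObj.gen K p i
        - (GalObj.grp K p (FK3.deg i) * GalObj.gen K p i) ⊗ₜ 1)]
    · simp only [map_sub, TensorProduct.map_tmul, TensorProduct.comm_tmul, LinearEquiv.coe_coe,
        hmul, one_mul, hsw, map_neg,
        TensorProduct.tmul_neg]
      rw [two_smul, sub_neg_eq_add]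
    · rw [map_sub, canMap_mul'_tmul, canMap_mul'_tmul, AlgHom.toLinearMap_apply,
        AlgHom.toLinearMap_apply, hF.coact_gen, map_one, mul_add]
      simp only [Algebra.TensorProduct.tmul_mul_tmul, one_mul, map_one, ← map_mul,
        Boson.deg_mul_self, mul_one, Algebra.TensorProduct.one_def]
      rw [add_sub_cancel_left]
  have hcomm : ∀ g k, translationCommutator m T (Φ x) f g k
      = Φ (GalObj.grp K p (g⁻¹ * k⁻¹ * (g * k))) := fun g k => by
    rw [translationCommutator, hgrp, hgrp, TensorProduct.tensorTensorTensorComm_tmul,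
      TensorProduct.map_tmul, hmul, hmul, hmul]
    simp only [map_mul]
  have h2 : ∀ y z : GalObj K p, m (((2 : K) • Φ y) ⊗ₜ ((2 : K) • Φ z)) = (4 : K) • Φ (y * z) :=
    fun y z => by
      rw [TensorProduct.smul_tmul_smul, map_smul, hmul]
      norm_num
  have hs : ∀ i, Equiv.Perm.sign (FK3.deg i) = -1 := by decide
  have hgg : ∀ i j, GalObj.gen K p i * GalObj.grp K p (FK3.deg i)
      * (GalObj.gen K p j * GalObj.grp K p (FK3.deg j))
      = -(GalObj.gen K p i * GalObj.gen K p (FK3.deg i j)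
        * GalObj.grp K p (FK3.deg i * FK3.deg j)) := fun i j => by
    rw [mul_assoc, ← mul_assoc (GalObj.grp K p (FK3.deg i)), hF.rel.conj, hs, Units.val_neg,
      Units.val_one, neg_smul, one_smul, map_mul]
    noncomm_ring
  have hval : ∀ c : K, f (m (((4 : K) • Φ (-algebraMap K (GalObj K p) c)) ⊗ₜ Φ x)) = -4 * c :=
    fun c => by
      rw [← map_smul, hmul, smul_mul_assoc, neg_mul, ← Algebra.smul_def, map_smul,
        map_smul, map_neg, map_neg, map_smul, map_smul, hf]
      simp
  funext i
  fin_cases i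
  · simp only [param, Fin.zero_eta, Matrix.cons_val_zero]
    rw [hgen, h2, hgg, show FK3.deg FK3.ia FK3.ia = FK3.ia by decide, hF.rel.sq,
      Boson.deg_mul_self, map_one, mul_one, hval]
    field_simp
  · simp only [param, Fin.mk_one, Matrix.cons_val_one, Matrix.cons_val_zero]
    rw [hcomm, hgen, hgen, hgen, h2, h2, h2, hgg, hgg, hgg, ← smul_add, ← smul_add, ← map_add,
      ← map_add, ← map_smul, hmul, mul_smul_comm, map_smul,
      show FK3.deg FK3.ic FK3.ib = FK3.ia by decide, show FK3.deg FK3.ia FK3.ic = FK3.ib by decide,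
      show FK3.deg FK3.ib FK3.ia = FK3.ic by decide,
      show FK3.deg FK3.ia * FK3.deg FK3.ic = FK3.deg FK3.ic * FK3.deg FK3.ib by decide,
      show FK3.deg FK3.ib * FK3.deg FK3.ia = FK3.deg FK3.ic * FK3.deg FK3.ib by decide,
      show (FK3.deg FK3.ic)⁻¹ * (FK3.deg FK3.ib)⁻¹ * (FK3.deg FK3.ic * FK3.deg FK3.ib)
        = (FK3.deg FK3.ic * FK3.deg FK3.ib)⁻¹ by decide]
    generalize FK3.deg FK3.ic * FK3.deg FK3.ib = g
    have e : GalObj.grp K p g⁻¹ * (-(GalObj.gen K p FK3.ic * GalObj.gen K p FK3.ia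
        * GalObj.grp K p g) + -(GalObj.gen K p FK3.ia * GalObj.gen K p FK3.ib * GalObj.grp K p g)
        + -(GalObj.gen K p FK3.ib * GalObj.gen K p FK3.ic * GalObj.grp K p g))
        = -algebraMap K (GalObj K p) (p 1) := by
      rw [← neg_add, ← neg_add, ← add_mul, ← add_mul, add_assoc, add_comm, hF.rel.abc,
        mul_neg, Algebra.commutes, ← mul_assoc, IsNormalFrame.inv_mul_grp, one_mul]
    rw [e, hval]
    field_simp

end Parameters

/-! ### A polynomial family of structures on a fixed space -/

section Families

variable {K Y : Type*} [Field K]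

lemma RegularMap.sum {V ι : Type*} [AddCommGroup V] [Module K V] {R : Subalgebra K (Y → K)}
    {s : Finset ι} {F : ι → Y → V} (h : ∀ i ∈ s, RegularMap R (F i)) :
    RegularMap R fun y => ∑ i ∈ s, F i y := fun φ => by
  have e : (fun y => φ (∑ i ∈ s, F i y)) = ∑ i ∈ s, fun y => φ (F i y) := by
    funext y
    rw [map_sum, Finset.sum_apply]
  rw [e]
  exact R.sum_mem fun i hi => h i hi φ

/-- A family of linear maps is regular if its values on a basis are. -/
lemma RegularMap.of_basis {V V' ι : Type*} [AddCommGroup V] [Module K V] [AddCommGroup V']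
    [Module K V'] [Fintype ι] {R : Subalgebra K (Y → K)} {L : Y → V →ₗ[K] V'}
    (b : Module.Basis ι K V) (h : ∀ i, RegularMap R fun y => L y (b i)) : RegularMap R L := by
  have e : L = fun y => ∑ i, LinearMap.smulRightₗ (b.coord i) (L y (b i)) := by
    funext y
    refine b.ext fun j => ?_
    classical
    simp [LinearMap.sum_apply, Finsupp.single_apply, ite_smul]
  rw [e]
  exact .sum fun i _ => (h i).map _

/-- The families `p ↦ ∑ x p ⊗ y p` with `x` in `S` and `y` in `S'`. -/
def tensorFamilies {A A' : Y → Type*} [∀ p, Ring (A p)] [∀ p, Algebra K (A p)]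
    [∀ p, Ring (A' p)] [∀ p, Algebra K (A' p)] (S : Submonoid (∀ p, A p))
    (S' : Submonoid (∀ p, A' p)) : Submodule K (∀ p, A p ⊗[K] A' p) :=
  Submodule.span K {F | ∃ x ∈ S, ∃ y ∈ S', F = fun p => x p ⊗ₜ[K] y p}

section

variable {A A' : Y → Type*} [∀ p, Ring (A p)] [∀ p, Algebra K (A p)]
  [∀ p, Ring (A' p)] [∀ p, Algebra K (A' p)] {S : Submonoid (∀ p, A p)}
  {S' : Submonoid (∀ p, A' p)}

lemma tmul_mem_tensorFamilies {x : ∀ p, A p} (hx : x ∈ S) {y : ∀ p, A' p} (hy : y ∈ S') :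
    (fun p => x p ⊗ₜ[K] y p) ∈ tensorFamilies (K := K) S S' :=
  Submodule.subset_span ⟨x, hx, y, hy, rfl⟩

lemma mul_mem_tensorFamilies {F F' : ∀ p, A p ⊗[K] A' p} (h : F ∈ tensorFamilies (K := K) S S')
    (h' : F' ∈ tensorFamilies (K := K) S S') : F * F' ∈ tensorFamilies (K := K) S S' := by
  induction h using Submodule.span_induction with
  | zero => rw [zero_mul]; exact Submodule.zero_mem _
  | add F₁ F₂ _ _ h₁ h₂ => rw [add_mul]; exact Submodule.add_mem _ h₁ h₂
  | smul c F _ h => rw [smul_mul_assoc]; exact Submodule.smul_mem _ _ h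
  | mem F hF =>
    obtain ⟨x, hx, y, hy, rfl⟩ := hF
    induction h' using Submodule.span_induction with
    | zero => rw [mul_zero]; exact Submodule.zero_mem _
    | add F₁ F₂ _ _ h₁ h₂ => rw [mul_add]; exact Submodule.add_mem _ h₁ h₂
    | smul c F _ h => rw [mul_smul_comm]; exact Submodule.smul_mem _ _ h
    | mem F hF =>
      obtain ⟨x', hx', y', hy', rfl⟩ := hF
      have e : (fun p => x p ⊗ₜ[K] y p) * (fun p => x' p ⊗ₜ[K] y' p)
          = fun p => (x * x') p ⊗ₜ[K] (y * y') p :=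
        funext fun p => Algebra.TensorProduct.tmul_mul_tmul _ _ _ _
      rw [e]
      exact tmul_mem_tensorFamilies (S.mul_mem hx hx') (S'.mul_mem hy hy')

lemma RegularMap.of_tensorFamilies {V V' : Type*} [AddCommGroup V] [Module K V] [AddCommGroup V']
    [Module K V'] [FiniteDimensional K V] {R : Subalgebra K (Y → K)} {Ψ : ∀ p, A p →ₗ[K] V}
    {Ψ' : ∀ p, A' p →ₗ[K] V'} (h : ∀ x ∈ S, RegularMap R fun p => Ψ p (x p))
    (h' : ∀ x ∈ S', RegularMap R fun p => Ψ' p (x p)) {F : ∀ p, A p ⊗[K] A' p}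
    (hF : F ∈ tensorFamilies (K := K) S S') :
    RegularMap R fun p => TensorProduct.map (Ψ p) (Ψ' p) (F p) := by
  induction hF using Submodule.span_induction with
  | zero => simpa using RegularMap.const (R := R) 0
  | add F₁ F₂ _ _ h₁ h₂ => simpa using h₁.add h₂
  | smul c F _ h =>
    simp only [Pi.smul_apply, map_smul]
    exact h.map (c • LinearMap.id)
  | mem F hF =>
    obtain ⟨x, hx, y, hy, rfl⟩ := hF
    exact (h x hx).tmul (h' y hy)

end

end Families

/-- The polynomial functions on the affine plane. -/
def polyFun (K : Type*) [Field K] : Subalgebra K ((Fin 2 → K) → K) :=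
  (MvPolynomial.aeval fun (i : Fin 2) (p : Fin 2 → K) => p i).range

lemma proj_mem_polyFun {K : Type*} [Field K] (i : Fin 2) : (fun p => p i) ∈ polyFun K :=
  ⟨MvPolynomial.X i, MvPolynomial.aeval_X _ _⟩

namespace GalObj

variable (K : Type*) [Field K]

/-- Families of elements of the algebras `E(λ, μ) # KS_3` are multiplied by polynomial functions
of the parameters. -/
instance : Algebra (polyFun K) (∀ p, GalObj K p) :=
  RingHom.toAlgebra' (RingHom.comp (RingHom.pi fun p =>
      (algebraMap K (GalObj K p)).comp (Pi.evalRingHom _ p)) (polyFun K).val.toRingHom)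
    fun c x => funext fun p => Algebra.commutes (R := K) (c.1 p) (x p)

lemma family_smul_apply (c : polyFun K) (x : ∀ p, GalObj K p) (p : Fin 2 → K) :
    (c • x) p = c.1 p • x p := by
  rw [Algebra.smul_def (c.1 p)]
  exact congrFun (Algebra.smul_def c x) p

/-- The relations hold in the algebra of families, over the ring of polynomial functions. -/
lemma family_fkRelations : FKRelations (R := ∀ p, GalObj K p)
    (⟨_, proj_mem_polyFun 0⟩ : polyFun K) ⟨_, proj_mem_polyFun 1⟩
    (MonoidHom.pi (grp K)) (fun i p => gen K p i) where
  sq i := funext fun p => (fkRelations K p).sq i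
  abc := funext fun p => (fkRelations K p).abc
  acb := funext fun p => (fkRelations K p).acb
  conj g i := funext fun p => (fkRelations K p).conj g i

/-- The families whose coordinates with respect to the basis of words are polynomial functions of
the parameters. -/
def polyFamilies : Submonoid (∀ p, GalObj K p) where
  carrier := FKRelations.wordSpan (polyFun K) (MonoidHom.pi (grp K)) (fun i p => gen K p i)
  one_mem' := FKRelations.one_mem_wordSpan
  mul_mem' hx hy := (family_fkRelations K).mul_mem hx hy

lemma gen_mem_polyFamilies (i : Fin 3) : (fun p => gen K p i) ∈ polyFamilies K :=
  (family_fkRelations K).gen_mem i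

lemma grp_mem_polyFamilies (g : S3) : (fun p => grp K p g) ∈ polyFamilies K :=
  (family_fkRelations K).grp_mem g

/-- The constant families. -/
def constFamilies : Submonoid ((Fin 2 → K) → Boson K) :=
  MonoidHom.mrange (Pi.constMonoidHom (Fin 2 → K) (Boson K))

lemma const_mem_constFamilies (h : Boson K) : (fun _ => h) ∈ constFamilies K := ⟨h, rfl⟩

variable [IsAlgClosed K]

lemma wordBasis_mem_polyFamilies (q : Fin 12 × S3) :
    (fun p => wordBasis K p q) ∈ polyFamilies K := by
  have e : (fun p => wordBasis K p q)
      = ((words q.1).map fun i p => gen K p i).prod * fun p => grp K p q.2 := by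
    funext p
    rw [wordBasis_apply, Pi.mul_apply, Pi.list_prod_apply, List.map_map]
    rfl
  rw [e]
  exact FKRelations.word_mul_mem_wordSpan _ _

lemma coact_mem (q : Fin 12 × S3) : (fun p => coact K p (wordBasis K p q))
    ∈ tensorFamilies (K := K) (polyFamilies K) (constFamilies K) := by
  have key : ∀ l : List (Fin 3), (fun p => coact K p ((l.map (gen K p)).prod * grp K p q.2))
      ∈ tensorFamilies (K := K) (polyFamilies K) (constFamilies K) := by
    intro l
    induction l with
    | nil =>
      simp only [List.map_nil, List.prod_nil, one_mul, isNormalFrame.coact_grp]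
      exact tmul_mem_tensorFamilies (grp_mem_polyFamilies K _) (const_mem_constFamilies K _)
    | cons i l ih =>
      simp only [List.map_cons, List.prod_cons, mul_assoc]
      simp only [map_mul (coact K _) (gen K _ i), isNormalFrame.coact_gen]
      exact mul_mem_tensorFamilies (Submodule.add_mem _
        (tmul_mem_tensorFamilies (gen_mem_polyFamilies K i) (const_mem_constFamilies K _))
        (tmul_mem_tensorFamilies (grp_mem_polyFamilies K _) (const_mem_constFamilies K _))) ih
  simpa only [wordBasis_apply] using key (words q.1)

/-- The inverse of the canonical map. -/
def canInv (p : Fin 2 → K) : GalObj K p ⊗[K] Boson K →ₗ[K] GalObj K p ⊗[K] GalObj K p :=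
  (LinearEquiv.ofBijective _ (isGalois K p).bijective).symm.toLinearMap

lemma canInv_canMap (p : Fin 2 → K) (t : GalObj K p ⊗[K] GalObj K p) :
    canInv K p (canMap (LinearMap.mul' K _) (coact K p).toLinearMap t) = t :=
  (LinearEquiv.ofBijective _ (isGalois K p).bijective).symm_apply_apply t

lemma canMap_canInv (p : Fin 2 → K) (t : GalObj K p ⊗[K] Boson K) :
    canMap (LinearMap.mul' K _) (coact K p).toLinearMap (canInv K p t) = t :=
  (LinearEquiv.ofBijective _ (isGalois K p).bijective).apply_symm_apply t

/-- The inverse of the canonical map depends polynomially on the parameters, because it is computed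
by the recursion that proves the surjectivity of the canonical map. -/
lemma canInv_mem {x : ∀ p, GalObj K p} (hx : x ∈ polyFamilies K) (h : Boson K) :
    (fun p => canInv K p (x p ⊗ₜ h))
      ∈ tensorFamilies (K := K) (polyFamilies K) (polyFamilies K) := by
  let S : Submodule K (Boson K) :=
    { carrier := {y | ∀ x ∈ polyFamilies K, (fun p => canInv K p (x p ⊗ₜ y))
        ∈ tensorFamilies (K := K) (polyFamilies K) (polyFamilies K)}
      add_mem' := by
        intro y z hy hz x hx
        simp only [TensorProduct.tmul_add, map_add]
        exact Submodule.add_mem _ (hy x hx) (hz x hx)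
      zero_mem' := by
        intro x hx
        simp only [TensorProduct.tmul_zero, map_zero]
        exact Submodule.zero_mem _
      smul_mem' := by
        intro c y hy x hx
        simp only [TensorProduct.tmul_smul, map_smul]
        exact Submodule.smul_mem _ c (hy x hx) }
  have hr : ∀ {z}, z ∈ polyFamilies K → (fun p => (1 : GalObj K p) ⊗ₜ[K] z p)
      ∈ tensorFamilies (K := K) (polyFamilies K) (polyFamilies K) := fun hz =>
    tmul_mem_tensorFamilies (polyFamilies K).one_mem hz
  refine Boson.mem_of_right_closed S (fun x hx => ?_) (fun g y hy x hx => ?_)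
    (fun i y hy x hx => ?_) h x hx
  · have e : (fun p => canInv K p (x p ⊗ₜ 1)) = fun p => x p ⊗ₜ[K] (1 : GalObj K p) := by
      funext p
      rw [← IsNormalFrame.canMap_one (ρ := coact K p), canInv_canMap]
    rw [e]
    exact tmul_mem_tensorFamilies hx (polyFamilies K).one_mem
  · have hx' := (polyFamilies K).mul_mem hx (grp_mem_polyFamilies K g⁻¹)
    have e : (fun p => canInv K p (x p ⊗ₜ (y * Boson.grp K g)))
        = (fun p => canInv K p ((x p * grp K p g⁻¹) ⊗ₜ y))
          * fun p => (1 : GalObj K p) ⊗ₜ[K] grp K p g := by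
      funext p
      rw [← isNormalFrame.canMap_grp g (canMap_canInv K p ((x p * grp K p g⁻¹) ⊗ₜ y)),
        canInv_canMap]
      rfl
    rw [e]
    exact mul_mem_tensorFamilies (hy _ hx') (hr (grp_mem_polyFamilies K g))
  · have hx' := (polyFamilies K).mul_mem hx (grp_mem_polyFamilies K (FK3.deg i))
    have hx'' := (polyFamilies K).mul_mem hx' (gen_mem_polyFamilies K i)
    have e : (fun p => canInv K p (x p ⊗ₜ (y * Boson.X K i)))
        = (fun p => canInv K p ((x p * grp K p (FK3.deg i)) ⊗ₜ y))
          * (fun p => (1 : GalObj K p) ⊗ₜ[K] gen K p i)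
          - fun p => canInv K p ((x p * grp K p (FK3.deg i) * gen K p i) ⊗ₜ y) := by
      funext p
      rw [← isNormalFrame.canMap_gen i
        (canMap_canInv K p ((x p * grp K p (FK3.deg i)) ⊗ₜ y))
        (canMap_canInv K p ((x p * grp K p (FK3.deg i) * gen K p i) ⊗ₜ y)), canInv_canMap]
      rfl
    rw [e]
    exact Submodule.sub_mem _ (mul_mem_tensorFamilies (hy _ hx') (hr (gen_mem_polyFamilies K i)))
      (hy _ hx'')

variable {K} {W : Type*} [AddCommGroup W] [Module K W] (B : Module.Basis (Fin 12 × S3) K W)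

/-- The identification of `E(λ, μ) # KS_3` with a space that has a basis indexed by the words. -/
def model (p : Fin 2 → K) : GalObj K p ≃ₗ[K] W := (wordBasis K p).equiv B (Equiv.refl _)

@[simp] lemma model_wordBasis (p : Fin 2 → K) (q : Fin 12 × S3) :
    model B p (wordBasis K p q) = B q := by simp [model]

@[simp] lemma model_symm_basis (p : Fin 2 → K) (q : Fin 12 × S3) :
    (model B p).symm (B q) = wordBasis K p q := by
  rw [LinearEquiv.symm_apply_eq, model_wordBasis]

/-- The structure of `E(λ, μ) # KS_3`, transported to a fixed space with a basis indexed by the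
words. -/
def point (p : Fin 2 → K) : AffSp K (Boson K) W :=
  ((model B p).toLinearMap ∘ₗ LinearMap.mul' K _ ∘ₗ
      TensorProduct.map (model B p).symm.toLinearMap (model B p).symm.toLinearMap,
    TensorProduct.map (model B p).toLinearMap (model B p).toLinearMap ∘ₗ canInv K p ∘ₗ
      (model B p).symm.toLinearMap.rTensor (Boson K),
    (model B p).toLinearMap.rTensor (Boson K) ∘ₗ (coact K p).toLinearMap ∘ₗ
      (model B p).symm.toLinearMap)

lemma point_isStructIso (p : Fin 2 → K) : IsStructIso (model B p) (LinearMap.mul' K _)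
    (coact K p).toLinearMap (point B p).1 (point B p).2.2 :=
  exists_isStructIso (model B p) _ _

lemma point_inverse (p : Fin 2 → K) :
    canMap (point B p).1 (point B p).2.2 ∘ₗ (point B p).2.1 = LinearMap.id := by
  refine LinearMap.ext fun t => ?_
  have h := LinearMap.congr_fun (point_isStructIso B p).canMap_comp
    (canInv K p ((model B p).symm.toLinearMap.rTensor (Boson K) t))
  rw [LinearMap.comp_apply, LinearMap.comp_apply, canMap_canInv,
    ← LinearMap.comp_apply ((model B p).toLinearMap.rTensor (Boson K)),
    ← LinearMap.rTensor_comp] at h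
  simp only [LinearEquiv.comp_symm, LinearMap.rTensor_id] at h
  exact h

lemma point_mem [FiniteDimensional K W] (p : Fin 2 → K) : point B p ∈ YH K (Boson K) W := by
  have hs := point_isStructIso B p
  refine ⟨hs.isComoduleAlgebra (isGalois K p).isComoduleAlgebra, point_inverse B p, ?_⟩
  have hb := hs.canMap_bijective (isGalois K p).bijective
  refine LinearMap.ext fun t => hb.1 ?_
  exact LinearMap.congr_fun (point_inverse B p) _

lemma regular_model [FiniteDimensional K W] {x : ∀ p, GalObj K p} (hx : x ∈ polyFamilies K) :
    RegularMap (polyFun K) fun p => model B p (x p) := by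
  have hx' : x ∈ FKRelations.wordSpan (polyFun K) (MonoidHom.pi (grp K))
    (fun i p => gen K p i) := hx
  clear hx
  induction hx' using Submodule.span_induction with
  | zero => simpa using RegularMap.const (R := polyFun K) (0 : W)
  | add x y _ _ h₁ h₂ => simpa using h₁.add h₂
  | smul c x _ h =>
    intro φ
    have e : (fun p => φ (model B p ((c • x) p))) = c.1 * fun p => φ (model B p (x p)) := by
      funext p
      refine (congrArg (fun z => φ (model B p z)) (family_smul_apply K c x p)).trans ?_
      rw [map_smul, map_smul]
      rfl
    exact e ▸ (polyFun K).mul_mem c.2 (h φ)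
  | mem x hx =>
    obtain ⟨q, rfl⟩ := hx
    have e : (fun p => model B p ((((words q.1).map fun i p => gen K p i).prod
        * MonoidHom.pi (grp K) q.2 : ∀ p, GalObj K p) p)) = fun _ => B q := by
      funext p
      rw [← model_wordBasis B p, wordBasis_apply, Pi.mul_apply, Pi.list_prod_apply, List.map_map]
      rfl
    simp only [e]
    exact .const _

/-- The structure constants of `E(λ, μ) # KS_3` are polynomials in the parameters. -/
lemma regular_point [FiniteDimensional K W] : RegularMap (polyFun K) (point B) := by
  have hT := fun {x} (hx : x ∈ polyFamilies K) => regular_model B hx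
  have hH : ∀ x ∈ constFamilies K, RegularMap (polyFun K)
      fun p => (LinearMap.id : Boson K →ₗ[K] Boson K) (x p) := by
    rintro _ ⟨h, rfl⟩
    exact .const h
  have h1 : RegularMap (polyFun K) fun p => (point B p).1 := by
    refine .of_basis (B.tensorProduct B) fun q => ?_
    simp only [point, Module.Basis.tensorProduct_apply', LinearMap.comp_apply,
      TensorProduct.map_tmul, LinearEquiv.coe_coe, model_symm_basis, LinearMap.mul'_apply]
    exact hT ((polyFamilies K).mul_mem (wordBasis_mem_polyFamilies K _)
      (wordBasis_mem_polyFamilies K _))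
  have h2 : RegularMap (polyFun K) fun p => (point B p).2.1 := by
    refine .of_basis (B.tensorProduct (Boson.wordBasis K)) fun q => ?_
    simp only [point, Module.Basis.tensorProduct_apply', LinearMap.comp_apply,
      LinearMap.rTensor_tmul, LinearEquiv.coe_coe, model_symm_basis]
    exact .of_tensorFamilies (fun x hx => hT hx) (fun x hx => hT hx)
      (canInv_mem K (wordBasis_mem_polyFamilies K _) _)
  have h3 : RegularMap (polyFun K) fun p => (point B p).2.2 := by
    refine .of_basis B fun q => ?_
    simp only [point, LinearMap.comp_apply, LinearEquiv.coe_coe, model_symm_basis]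
    exact .of_tensorFamilies (fun x hx => hT hx) hH (coact_mem K q)
  have e : point B = fun p => (LinearMap.inl K _ _ (point B p).1
      + LinearMap.inr K _ _ (LinearMap.inl K _ _ (point B p).2.1
      + LinearMap.inr K _ _ (point B p).2.2) : AffSp K (Boson K) W) := by
    funext p
    simp
  rw [e]
  exact (h1.map _).add (((h2.map _).add (h3.map _)).map _)

end GalObj

/-! ### Orbits and the moduli space -/

section Orbits

variable {K H W : Type*} [Field K] [Ring H] [Bialgebra K H] [AddCommGroup W] [Module K W]

lemma bijective_of_mem_YH {y : AffSp K H W} (hy : y ∈ YH K H W) :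
    Function.Bijective (canMap y.1 y.2.2) :=
  ⟨Function.LeftInverse.injective fun t => LinearMap.congr_fun hy.2.2 t,
    Function.RightInverse.surjective fun t => LinearMap.congr_fun hy.2.1 t⟩

/-- The transport of a point is determined by its multiplication and coaction, because the third
component is an inverse map. -/
lemma transport_eq_iff {y y' : AffSp K H W} (hy : y ∈ YH K H W) (hy' : y' ∈ YH K H W)
    {g : W ≃ₗ[K] W} : transport g y = y' ↔ IsStructIso g y.1 y.2.2 y'.1 y'.2.2 := by
  constructor
  · rintro rfl
    exact exists_isStructIso g _ _
  · intro h
    refine Prod.ext ?_ (Prod.ext ?_ ?_)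
    · refine TensorProduct.ext' fun x z => ?_
      simp [transport, h.map_mul]
    · refine LinearMap.ext fun t => ?_
      obtain ⟨t, rfl⟩ := (LinearEquiv.rTensor H g).surjective t
      obtain ⟨t, rfl⟩ := (bijective_of_mem_YH hy).2 t
      have e := LinearMap.congr_fun h.canMap_comp t
      rw [LinearMap.comp_apply, LinearMap.comp_apply] at e
      change TensorProduct.map g.toLinearMap g.toLinearMap (y.2.1
        (g.symm.toLinearMap.rTensor H (g.toLinearMap.rTensor H _)))
        = y'.2.1 (g.toLinearMap.rTensor H _)
      have e0 : ∀ s, g.symm.toLinearMap.rTensor H (g.toLinearMap.rTensor H s) = s :=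
        (LinearEquiv.rTensor H g).symm_apply_apply
      have e1 := LinearMap.congr_fun hy.2.2 t
      have e2 := LinearMap.congr_fun hy'.2.2 (TensorProduct.map g.toLinearMap g.toLinearMap t)
      rw [e0, ← e]
      exact (congrArg _ e1).trans e2.symm
    · refine LinearMap.ext fun x => ?_
      obtain ⟨x, rfl⟩ := g.surjective x
      simp [transport, h.map_coact]

/-- Regular functions become polynomials along a regular map from the affine plane. -/
lemma comp_mem_of_mem_coordRing {K Z V : Type*} [Field K] [AddCommGroup V] [Module K V]
    {R : Subalgebra K (Z → K)} {Y : Set V} {σ : Z → Y} (hσ : RegularMap R fun z => (σ z).1)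
    {f : Y → K} (hf : f ∈ coordRing Y) : (fun z => f (σ z)) ∈ R := by
  induction hf using Algebra.adjoin_induction with
  | mem f hf =>
    obtain ⟨ℓ, rfl⟩ := hf
    exact hσ ℓ
  | algebraMap r => exact R.algebraMap_mem r
  | add f f' _ _ h h' => exact R.add_mem h h'
  | mul f f' _ _ h h' => exact R.mul_mem h h'

end Orbits

section Polynomials

variable {K Z ι : Type*} [Field K]

lemma aeval_pi_apply (q : MvPolynomial ι K) (F : Z → ι → K) (z : Z) :
    (MvPolynomial.aeval fun i z => F z i : MvPolynomial ι K →ₐ[K] (Z → K)) q z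
      = MvPolynomial.eval (F z) q := by
  induction q using MvPolynomial.induction_on with
  | C a => simp
  | add p q hp hq => simp only [map_add, Pi.add_apply, hp, hq]
  | mul_X p i hp => simp only [map_mul, Pi.mul_apply, hp, MvPolynomial.aeval_X, MvPolynomial.eval_X]

/-- Polynomial functions of a family of points are the composition of the family with polynomial
functions. -/
lemma aeval_pi_comp (q : MvPolynomial ι K) (F : Z → ι → K) (z : Z) :
    (MvPolynomial.aeval fun i z => F z i : MvPolynomial ι K →ₐ[K] (Z → K)) q z
      = (MvPolynomial.aeval fun i p => p i : MvPolynomial ι K →ₐ[K] ((ι → K) → K)) q (F z) := by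
  rw [aeval_pi_apply, aeval_pi_apply q (fun p => p)]

end Polynomials

section Words

variable {K W : Type*} [Field K] [AddCommGroup W] [Module K W]

/-- Rescaling the generators by `ν` multiplies a word by a power of `ν`. -/
lemma IsStructIso.wordMul_smul {A : Type*} [Ring A] [Algebra K A] {ρA : A →ₗ[K] A ⊗[K] Boson K}
    {Φ : A ≃ₗ[K] W} {m : W ⊗[K] W →ₗ[K] W} {ρ : W →ₗ[K] W ⊗[K] Boson K}
    (h : IsStructIso Φ (LinearMap.mul' K A) ρA m ρ) (ν : K) (w : Fin 3 → A) (l : List (Fin 3))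
    (y : A) : wordMul m (fun i => ν • Φ (w i)) l (Φ y) = ν ^ l.length • Φ ((l.map w).prod * y) := by
  induction l with
  | nil => simp [wordMul]
  | cons i l ih =>
    change m ((ν • Φ (w i)) ⊗ₜ wordMul m (fun i => ν • Φ (w i)) l (Φ y)) = _
    rw [ih, TensorProduct.smul_tmul_smul, map_smul, ← h.map_mul, LinearMap.mul'_apply,
      List.map_cons, List.prod_cons, mul_assoc, List.length_cons, pow_succ']

lemma wordMul_smul_right (m : W ⊗[K] W →ₗ[K] W) (w : Fin 3 → W) (l : List (Fin 3)) (c : K)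
    (y : W) : wordMul m w l (c • y) = c • wordMul m w l y := by
  induction l with
  | nil => rfl
  | cons i l ih =>
    change m (w i ⊗ₜ wordMul m w l (c • y)) = c • m (w i ⊗ₜ wordMul m w l y)
    rw [ih, TensorProduct.tmul_smul, map_smul]

lemma GalObj.point_mem_YPrime [IsAlgClosed K] [FiniteDimensional K W]
    (B : Module.Basis (Fin 12 × S3) K W) (p : Fin 2 → K) :
    GalObj.point B p ∈ YPrime B := by
  have h := GalObj.point_isStructIso B p
  refine ⟨GalObj.point_mem B p, _, _, h.isFrame (GalObj.isFrame K p), fun i g => ?_⟩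
  have e := h.wordMul_smul 1 (gen K p) (words i) (grp K p g)
  simp only [one_smul, one_pow] at e
  rw [e, ← GalObj.model_wordBasis B p, GalObj.wordBasis_apply]

end Words

section Moduli

variable {K : Type*} [Field K] [IsAlgClosed K] [CharZero K]
  {W : Type*} [AddCommGroup W] [Module K W] [FiniteDimensional K W]

/-- The parameters of a Galois object are determined by it. -/
lemma GalObj.eq_of_isStructIso {m : W ⊗[K] W →ₗ[K] W} {ρ : W →ₗ[K] W ⊗[K] Boson K}
    (hb : Function.Bijective (canMap m ρ)) {p q : Fin 2 → K} {Φ : GalObj K p ≃ₗ[K] W}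
    {Ψ : GalObj K q ≃ₗ[K] W}
    (hΦ : IsStructIso Φ (LinearMap.mul' K _) (GalObj.coact K p).toLinearMap m ρ)
    (hΨ : IsStructIso Ψ (LinearMap.mul' K _) (GalObj.coact K q).toLinearMap m ρ) : p = q := by
  obtain ⟨f, hf⟩ := Module.Projective.exists_dual_ne_zero K
    (x := Φ 1) ((map_ne_zero_iff Φ Φ.injective).mpr one_ne_zero)
  have hx : ((f (Φ 1))⁻¹ • f) (Φ 1) = 1 := by
    rw [LinearMap.smul_apply, smul_eq_mul, inv_mul_cancel₀ hf]
  have hT : (LinearEquiv.ofBijective _ hb).symm.toLinearMap ∘ₗ canMap m ρ = LinearMap.id :=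
    LinearMap.ext fun t => (LinearEquiv.ofBijective _ hb).symm_apply_apply t
  rw [← param_eq hΦ hT hx, param_eq hΨ hT hx]

lemma existsUnique_realizes {m : W ⊗[K] W →ₗ[K] W} {ρ : W →ₗ[K] W ⊗[K] Boson K}
    (h : IsComoduleAlgebra m ρ) (hb : Function.Bijective (canMap m ρ))
    (hW : Module.finrank K W = 72) : ∃! p : Fin 2 → K, Realizes m ρ (p 0) (p 1) := by
  obtain ⟨p, Φ, hΦ⟩ := h.exists_galObj hb hW
  refine ⟨p, (h.realizes_iff hb hW p).mpr ⟨Φ, hΦ⟩, fun q hq => ?_⟩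
  obtain ⟨Ψ, hΨ⟩ := (h.realizes_iff hb hW q).mp hq
  exact GalObj.eq_of_isStructIso hb hΨ hΦ

/-- Two Galois objects are isomorphic if and only if they realize the same pair. -/
lemma isoComoduleAlgebra_iff {W' : Type*} [AddCommGroup W'] [Module K W'] [FiniteDimensional K W']
    {m : W ⊗[K] W →ₗ[K] W} {ρ : W →ₗ[K] W ⊗[K] Boson K} {m' : W' ⊗[K] W' →ₗ[K] W'}
    {ρ' : W' →ₗ[K] W' ⊗[K] Boson K} (h : IsComoduleAlgebra m ρ)
    (hb : Function.Bijective (canMap m ρ)) (hW : Module.finrank K W = 72)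
    (h' : IsComoduleAlgebra m' ρ') (hb' : Function.Bijective (canMap m' ρ'))
    (hW' : Module.finrank K W' = 72) : IsoComoduleAlgebra m ρ m' ρ' ↔
      ∃ p : Fin 2 → K, Realizes m ρ (p 0) (p 1) ∧ Realizes m' ρ' (p 0) (p 1) := by
  constructor
  · rintro ⟨g, hg⟩
    have hg : IsStructIso g m ρ m' ρ' := hg
    obtain ⟨p, hp, -⟩ := existsUnique_realizes h hb hW
    exact ⟨p, hp, hg.realizes hp⟩
  · rintro ⟨p, hp, hp'⟩
    obtain ⟨Φ, hΦ⟩ := (h.realizes_iff hb hW p).mp hp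
    obtain ⟨Φ', hΦ'⟩ := (h'.realizes_iff hb' hW' p).mp hp'
    exact ⟨_, hΦ.symm.trans hΦ'⟩

/-- The pair that is realized by a point of `Y_H`. -/
def parameters (hW : Module.finrank K W = 72) (y : YH K (Boson K) W) : Fin 2 → K :=
  (existsUnique_realizes y.2.1 (bijective_of_mem_YH y.2) hW).choose

lemma realizes_iff_parameters (hW : Module.finrank K W = 72) (y : YH K (Boson K) W)
    (p : Fin 2 → K) : Realizes y.1.1 y.1.2.2 (p 0) (p 1) ↔ parameters hW y = p := by
  have h := (existsUnique_realizes y.2.1 (bijective_of_mem_YH y.2) hW).choose_spec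
  exact ⟨fun hp => (h.2 p hp).symm, fun hp => hp ▸ h.1⟩

lemma parameters_eq (hW : Module.finrank K W = 72) {y : YH K (Boson K) W} {p : Fin 2 → K}
    {Φ : GalObj K p ≃ₗ[K] W} (hΦ : IsStructIso Φ (LinearMap.mul' K _)
      (GalObj.coact K p).toLinearMap y.1.1 y.1.2.2) : parameters hW y = p :=
  (realizes_iff_parameters hW y p).mp
    ((y.2.1.realizes_iff (bijective_of_mem_YH y.2) hW p).mpr ⟨Φ, hΦ⟩)

/-- The fibres of `(λ, μ)` are the orbits. -/
lemma parameters_eq_iff (hW : Module.finrank K W = 72) (y y' : YH K (Boson K) W) :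
    parameters hW y = parameters hW y' ↔ (orbitSetoid K (Boson K) W).r y y' := by
  have hy := realizes_iff_parameters hW y
  have hy' := realizes_iff_parameters hW y'
  have h := isoComoduleAlgebra_iff y.2.1 (bijective_of_mem_YH y.2) hW y'.2.1
    (bijective_of_mem_YH y'.2) hW
  have e : IsoComoduleAlgebra y.1.1 y.1.2.2 y'.1.1 y'.1.2.2
      ↔ (orbitSetoid K (Boson K) W).r y y' :=
    exists_congr fun g => (transport_eq_iff y.2 y'.2).symm
  rw [← e, h]
  exact ⟨fun he => ⟨_, (hy _).mpr rfl, (hy' _).mpr he.symm⟩,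
    fun ⟨p, hp, hp'⟩ => ((hy p).mp hp).trans ((hy' p).mp hp').symm⟩

/-- The parameters are regular functions. -/
lemma parameters_mem_coordRing (hW : Module.finrank K W = 72) {Y : Set (AffSp K (Boson K) W)}
    (hY : Y ⊆ YH K (Boson K) W) (i : Fin 2) :
    (fun y : Y => parameters hW ⟨y.1, hY y.2⟩ i) ∈ coordRing Y := by
  have : Nontrivial W := Module.nontrivial_of_finrank_pos (R := K) (by rw [hW]; norm_num)
  obtain ⟨x, hx⟩ := exists_ne (0 : W)
  obtain ⟨f, hf⟩ := Module.Projective.exists_dual_ne_zero K hx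
  have hf' : ((f x)⁻¹ • f) x = 1 := by
    rw [LinearMap.smul_apply, smul_eq_mul, inv_mul_cancel₀ hf]
  convert param_mem_coordRing Y x ((f x)⁻¹ • f) i with y
  have hy := hY y.2
  obtain ⟨p, Φ, hΦ⟩ := hy.1.exists_galObj (bijective_of_mem_YH hy) hW
  rw [param_eq hΦ hy.2.2 hf', parameters_eq hW (y := ⟨y.1, hy⟩) hΦ]

/-- The map from the moduli space to the affine plane that is given by `(λ, μ)`. -/
def moduliEquiv (hW : Module.finrank K W = 72) (B : Module.Basis (Fin 12 × S3) K W) :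
    XH K (Boson K) W ≃ (Fin 2 → K) where
  toFun := Quotient.lift (parameters hW) fun y y' h => (parameters_eq_iff hW y y').mpr h
  invFun p := Quotient.mk _ ⟨GalObj.point B p, GalObj.point_mem B p⟩
  left_inv x := by
    induction x using Quotient.inductionOn with
    | h y =>
      exact Quotient.sound ((parameters_eq_iff hW _ _).mp
        (parameters_eq hW (GalObj.point_isStructIso B _)))
  right_inv p := parameters_eq hW (GalObj.point_isStructIso B p)

/-- Every point of `Y'` is in the `N`-orbit of a standard point. -/
lemma exists_transport_point_eq (hW : Module.finrank K W = 72)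
    (B : Module.Basis (Fin 12 × S3) K W) (y : YPrime B) :
    ∃ ν : Kˣ, transport (actN B ν) (GalObj.point B (parameters hW ⟨y.1, y.2.1⟩)) = y.1 := by
  obtain ⟨y, hy, G, w, hf, hB⟩ := y
  obtain ⟨ν, p, Φ, hν, hΦ, hG, hw⟩ := hy.1.frame_normalForm (bijective_of_mem_YH hy) hW hf
  have hp : parameters hW ⟨y, hy⟩ = p := parameters_eq hW hΦ
  refine ⟨(Units.mk0 ν hν)⁻¹, ?_⟩
  dsimp only
  rw [hp, transport_eq_iff (GalObj.point_mem B p) hy]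
  have e : actN B (Units.mk0 ν hν)⁻¹ = (GalObj.model B p).symm.trans Φ := by
    refine B.ext' fun q => ?_
    have hq : B q = ν ^ ((words q.1).length + signExp q.2) • Φ (GalObj.wordBasis K p q) := by
      rw [← Prod.mk.eta (p := q), hB, hG, wordMul_smul_right, funext hw, hΦ.wordMul_smul,
        smul_smul, pow_add, mul_comm, GalObj.wordBasis_apply]
    rw [LinearEquiv.trans_apply, GalObj.model_symm_basis, actN, Module.Basis.equiv_apply,
      Equiv.refl_apply, Module.Basis.unitsSMul_apply]
    nth_rewrite 1 [hq]
    rw [Units.smul_def, smul_smul, inv_pow, ← signExp, Units.val_inv_eq_inv_val,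
      Units.val_pow_eq_pow_val, Units.val_mk0,
      inv_mul_cancel₀ (pow_ne_zero _ hν), one_smul]
  rw [e]
  exact (GalObj.point_isStructIso B p).symm.trans hΦ

/-- Regular functions on the moduli space are polynomials in the parameters: they are determined by
their values on the standard structures, which are a polynomial family. -/
lemma range_aeval_moduliEquiv (hW : Module.finrank K W = 72)
    (B : Module.Basis (Fin 12 × S3) K W) :
    (MvPolynomial.aeval fun (i : Fin 2) (x : XH K (Boson K) W) => moduliEquiv hW B x i :
        MvPolynomial (Fin 2) K →ₐ[K] (XH K (Boson K) W → K)).range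
      = coordRingXH K (Boson K) W := by
  refine le_antisymm ?_ fun f hf => ?_
  · rw [← Algebra.adjoin_range_eq_range_aeval, Algebra.adjoin_le_iff]
    rintro _ ⟨i, rfl⟩
    exact parameters_mem_coordRing hW subset_rfl i
  · obtain ⟨q, hq⟩ := comp_mem_of_mem_coordRing
      (σ := fun p => ⟨GalObj.point B p, GalObj.point_mem B p⟩) (GalObj.regular_point B) hf
    refine ⟨q, funext fun x => ?_⟩
    have h := congrFun hq (moduliEquiv hW B x)
    have hx : f ((moduliEquiv hW B).symm (moduliEquiv hW B x)) = f x := by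
      rw [Equiv.symm_apply_apply]
    refine Eq.trans ?_ (h.trans hx)
    exact aeval_pi_comp q (fun x i => moduliEquiv hW B x i) x

/-- Evaluating at a standard point shows that an invariant function is a polynomial in the
parameters. -/
lemma range_aeval_parameters (hW : Module.finrank K W = 72)
    (B : Module.Basis (Fin 12 × S3) K W) :
    (MvPolynomial.aeval fun (i : Fin 2) (y : YPrime B) => parameters hW ⟨y.1, y.2.1⟩ i :
        MvPolynomial (Fin 2) K →ₐ[K] (YPrime B → K)).range = coordRingYPrime B := by
  refine le_antisymm ?_ fun f hf => ?_
  · rw [← Algebra.adjoin_range_eq_range_aeval, Algebra.adjoin_le_iff]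
    rintro _ ⟨i, rfl⟩
    refine ⟨parameters_mem_coordRing hW (fun _ hy => hy.1) i, fun ν y y' h => ?_⟩
    exact congrFun ((parameters_eq_iff hW _ _).mpr ⟨_, h⟩) i
  · obtain ⟨q, hq⟩ := comp_mem_of_mem_coordRing
      (σ := fun p => ⟨GalObj.point B p, GalObj.point_mem_YPrime B p⟩) (GalObj.regular_point B) hf.1
    refine ⟨q, funext fun y => ?_⟩
    have h := congrFun hq (parameters hW ⟨y.1, y.2.1⟩)
    obtain ⟨ν, hν⟩ := exists_transport_point_eq hW B y
    refine Eq.trans ?_ (h.trans (hf.2 ν _ _ hν))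
    exact aeval_pi_comp q (fun (y : YPrime B) i => parameters hW ⟨y.1, y.2.1⟩ i) y

/-- All pairs occur on `Y'`, so a polynomial that vanishes on `Y'` is zero. -/
lemma ker_aeval_parameters (hW : Module.finrank K W = 72) (B : Module.Basis (Fin 12 × S3) K W) :
    RingHom.ker (MvPolynomial.aeval
      fun (i : Fin 2) (y : YPrime B) => parameters hW ⟨y.1, y.2.1⟩ i :
        MvPolynomial (Fin 2) K →ₐ[K] (YPrime B → K)) = ⊥ := by
  refine (RingHom.injective_iff_ker_eq_bot _).mp
    ((injective_iff_map_eq_zero _).mpr fun q hq => MvPolynomial.funext fun p => ?_)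
  have h := congrFun hq ⟨GalObj.point B p, GalObj.point_mem_YPrime B p⟩
  have hp : parameters hW ⟨GalObj.point B p, GalObj.point_mem B p⟩ = p :=
    parameters_eq hW (GalObj.point_isStructIso B p)
  have e := aeval_pi_apply q (fun (y : YPrime B) i => parameters hW ⟨y.1, y.2.1⟩ i)
    ⟨GalObj.point B p, GalObj.point_mem_YPrime B p⟩
  dsimp only at e
  rw [hp] at e
  rw [map_zero, ← e]
  exact h

end Moduli

end

theorem mainTheorem4 (K : Type*) [Field K] [IsAlgClosed K] [CharZero K]
    (W : Type*) [AddCommGroup W] [Module K W] [FiniteDimensional K W]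
    (hW : Module.finrank K W = Module.finrank K (Boson K)) :
    Module.finrank K (Boson K) = 72 ∧
    -- every cocycle deformation realizes exactly one pair
    (∀ α : TwoCocycle K (Boson K), ∃! p : Fin 2 → K,
      Realizes α.mul Coalgebra.comul (p 0) (p 1)) ∧
    -- every pair is realized by a cocycle deformation
    (∀ lam mu : K, ∃ α : TwoCocycle K (Boson K), Realizes α.mul Coalgebra.comul lam mu) ∧
    -- two cocycle deformations are isomorphic if and only if they realize the same pair
    (∀ α β : TwoCocycle K (Boson K),
      IsoComoduleAlgebra α.mul (Coalgebra.comul (R := K) (A := Boson K))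
        β.mul (Coalgebra.comul (R := K) (A := Boson K)) ↔
      ∃ lam mu : K, Realizes α.mul Coalgebra.comul lam mu ∧
        Realizes β.mul Coalgebra.comul lam mu) ∧
    -- the points of `Y_H` are the cocycle deformation structures on `W`
    (∀ y : YH K (Boson K) W, ∃ α : TwoCocycle K (Boson K),
      IsoComoduleAlgebra y.1.1 y.1.2.2 α.mul (Coalgebra.comul (R := K) (A := Boson K))) ∧
    (∀ α : TwoCocycle K (Boson K), ∃ y : YH K (Boson K) W,
      IsoComoduleAlgebra y.1.1 y.1.2.2 α.mul (Coalgebra.comul (R := K) (A := Boson K))) ∧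
    -- `(λ, μ)` is an isomorphism of the moduli space `X_H` with the affine plane
    ∃ Θ : XH K (Boson K) W ≃ (Fin 2 → K),
      (∀ (y : YH K (Boson K) W) (p : Fin 2 → K),
        Realizes y.1.1 y.1.2.2 (p 0) (p 1) ↔ Θ (Quotient.mk _ y) = p) ∧
      (MvPolynomial.aeval fun (i : Fin 2) (x : XH K (Boson K) W) => Θ x i :
        MvPolynomial (Fin 2) K →ₐ[K] (XH K (Boson K) W → K)).range
          = coordRingXH K (Boson K) W ∧
      -- the ideal `I` in `K[Y']^N ≅ K[λ, μ] / I` is zero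
      ∀ B : Module.Basis (Fin 12 × S3) K W,
        (MvPolynomial.aeval fun (i : Fin 2) (y : YPrime B) => Θ (Quotient.mk _ ⟨y.1, y.2.1⟩) i :
          MvPolynomial (Fin 2) K →ₐ[K] (YPrime B → K)).range = coordRingYPrime B ∧
        RingHom.ker (MvPolynomial.aeval
          fun (i : Fin 2) (y : YPrime B) => Θ (Quotient.mk _ ⟨y.1, y.2.1⟩) i :
          MvPolynomial (Fin 2) K →ₐ[K] (YPrime B → K)) = ⊥ := by
  have hW' : Module.finrank K W = 72 := hW.trans Boson.finrank_eq
  have hcom := fun α : TwoCocycle K (Boson K) => α.isComoduleAlgebra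
  have hcan := fun α : TwoCocycle K (Boson K) => α.canMap_bijective
  have hfin : Module.finrank K (Boson K) = 72 := Boson.finrank_eq
  refine ⟨hfin, fun α => existsUnique_realizes (hcom α) (hcan α) hfin, fun lam mu => ?_,
    fun α β => ?_, fun y => ?_, fun α => ?_, ?_⟩
  · obtain ⟨α, Φ, hΦ⟩ := GalObj.exists_twoCocycle ![lam, mu]
    exact ⟨α, hΦ.realizes (GalObj.realizes ![lam, mu])⟩
  · rw [isoComoduleAlgebra_iff (hcom α) (hcan α) hfin (hcom β) (hcan β) hfin]
    exact ⟨fun ⟨p, hp⟩ => ⟨p 0, p 1, hp⟩, fun ⟨lam, mu, h⟩ => ⟨![lam, mu], h⟩⟩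
  · obtain ⟨p, Φ, hΦ⟩ := y.2.1.exists_galObj (bijective_of_mem_YH y.2) hW'
    obtain ⟨α, Ψ, hΨ⟩ := GalObj.exists_twoCocycle p
    exact ⟨α, _, hΦ.symm.trans hΨ⟩
  · obtain ⟨p, Φ, hΦ⟩ := (hcom α).exists_galObj (hcan α) hfin
    let B := (Boson.wordBasis K).map (LinearEquiv.ofFinrankEq (Boson K) W hW.symm)
    exact ⟨⟨GalObj.point B p, GalObj.point_mem B p⟩, _,
      (GalObj.point_isStructIso B p).symm.trans hΦ⟩
  · let B₀ := (Boson.wordBasis K).map (LinearEquiv.ofFinrankEq (Boson K) W hW.symm)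
    exact ⟨moduliEquiv hW' B₀, realizes_iff_parameters hW', range_aeval_moduliEquiv hW' B₀,
      fun B => ⟨range_aeval_parameters hW' B, ker_aeval_parameters hW' B⟩⟩
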